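/- **Proposition 3.** All Lie algebras are finite-dimensional and real. For $n\in\mathbb N$ let $\mathcal L^n$ be the variety of Lie algebra laws on $\mathbb R^n$: the structure tensors $(C_{ij}^k)$ that are skew-symmetric in $i,j$ and satisfy the Jacobi identity, with the subspace topology. An $n$-dimensional Lie algebra $\mathfrak g$ is *stable* if its orbit (the set of all laws in $\mathcal L^n$ isomorphic to $\mathfrak g$) is open in $\mathcal L^n$. A Lie algebra $\mathfrak g'$ is a *contraction* of $\mathfrak g$ if there are invertible linear maps $\Phi_t$ of $\mathfrak g$ such that $[X,Y]_\infty=\lim_{t\to\infty}\Phi_t^{-1}[\Phi_tX,\Phi_tY]$ exists for all $X,Y\in\mathfrak g$ and $(\mathfrak g,[\cdot,\cdot]_\infty)\cong\mathfrak g'$. $\mathfrak g$ has a *nontrivial Levi decomposition* if $\mathfrak g=\mathfrak s\oplus\mathfrak r$ as a vector space, with $\mathfrak s\ne0$ a semisimple subalgebra, $\mathfrak r\neq 0$ the radical, and $\mathfrak s$ acting nontrivially on $\mathfrak r$; it is *indecomposable* if it is nonzero and not a direct sum of two nonzero ideals. $H^2(\mathfrak g,\mathfrak g)$ is the second cohomology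 with values in the adjoint module. Let $L_{6,1},\dots,L_{6,4}$ be the Lie algebras with basis $X_1,\dots,X_6$ and the following nonzero structure constants, $[X_i,X_j]=C_{ij}^kX_k$ (up to antisymmetry): - $L_{6,1}$: $C_{23}^1=1$, $C_{12}^3=1$, $C_{13}^2=-1$, $C_{15}^6=1$, $C_{16}^5=-1$, $C_{24}^6=-1$, $C_{26}^4=1$, $C_{34}^5=1$, $C_{35}^4=-1$; - $L_{6,2}$: $C_{12}^2=2$, $C_{13}^3=-2$, $C_{23}^1=1$, $C_{14}^4=1$, $C_{25}^4=1$, $C_{34}^5=1$, $C_{15}^5=-1$, $C_{45}^6=1$; - $L_{6,3}$: $C_{12}^2=2$, $C_{13}^3=-2$, $C_{23}^1=1$, $C_{14}^4=1$, $C_{25}^4=1$, $C_{34}^5=1$, $C_{15}^5=-1$, $C_{46}^4=1$, $C_{56}^5=1$; - $L_{6,4}$: $C_{12}^2=2$, $C_{13}^3=-2$, $C_{23}^1=1$, $C_{14}^4=2$, $C_{16}^6=-2$, $C_{25}^4=2$, $C_{26}^5=1$, $C_{34}^5=1$, $C_{35}^6=2$. Then: 1. Every 6-dimensional indecomposable Lie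 algebra with nontrivial Levi decomposition is isomorphic to one of $L_{6,1},\dots,L_{6,4}$, and it is either stable or a contraction of a semisimple Lie algebra, but not both. 2. $L_{6,1}$ is isomorphic to $I\mathfrak{so}(3)=\mathfrak{so}(3)\ltimes\mathbb R^3$ (standard action, $\mathbb R^3$ an abelian ideal). It is a contraction of a semisimple Lie algebra; moreover, it is a contraction of $\mathfrak{so}(4)$ and of $\mathfrak{so}(3,1)$. 3. $L_{6,4}$ is isomorphic to $I\mathfrak{sl}(2,\mathbb R)$, the semidirect sum of $\mathfrak{sl}(2,\mathbb R)$ with its adjoint module as an abelian ideal. It is a contraction of a semisimple Lie algebra; moreover, it is a contraction of $\mathfrak{so}(2,2)$ and of $\mathfrak{so}(3,1)$. 4. $H^2(L_{6,2},L_{6,2})=H^2(L_{6,3},L_{6,3})=0$, and $L_{6,2}$ and $L_{6,3}$ are stable. -/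

import Mathlib

namespace LowDimLie

open Filter Topology Module

/-! ### The variety of real Lie algebra laws, orbits and stability -/

/-- The variety `𝓛ⁿ` of real Lie algebra laws on an `n`-dimensional space, in coordinates: the
structure constants `C i j k` (the coefficient of `X k` in `[X i, X j]`) that are skew-symmetric
in `i, j` and satisfy the Jacobi identity. It carries the subspace topology. -/
def lieVariety (n : ℕ) : Set (Fin n → Fin n → Fin n → ℝ) :=
  {C | (∀ i j k, C i j k = -C j i k) ∧
    ∀ i j k l, ∑ m, (C i j m * C m k l + C j k m * C m i l + C k i m * C m j l) = 0}

section General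

universe u v

variable (g : Type u) [LieRing g] [LieAlgebra ℝ g]

/-- The orbit `𝓞(g)` under the general linear group: all laws isomorphic to `g`, that is, the
structure constants of `g` with respect to all its bases. -/
def orbit : Set (lieVariety (finrank ℝ g)) :=
  {C | ∃ b : Basis (Fin (finrank ℝ g)) ℝ g, ∀ i j k, C.1 i j k = b.repr ⁅b i, b j⁆ k}

/-- A Lie algebra is stable if its orbit is open in the variety of Lie algebra laws. -/
def IsStable : Prop := IsOpen (orbit g)

/-! ### Contractions -/

/-- `g'` is a contraction of the finite-dimensional Lie algebra `g`: there are non-singular linear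
maps `Φ t` of `g` such that `(Φ t)⁻¹ [Φ t X, Φ t Y]` converges as `t → ∞` for all `X, Y`, and the
limit bracket makes the vector space `g` a Lie algebra isomorphic to `g'` (through `e`).
Convergence in the finite-dimensional space `g` is convergence of all linear functionals. -/
def IsContraction (g' : Type v) [LieRing g'] [LieAlgebra ℝ g'] : Prop :=
  ∃ (Φ : ℝ → (g ≃ₗ[ℝ] g)) (e : g' ≃ₗ[ℝ] g), ∀ (X Y : g') (f : Dual ℝ g),
    Tendsto (fun t : ℝ => f ((Φ t).symm ⁅Φ t (e X), Φ t (e Y)⁆)) atTop (𝓝 (f (e ⁅X, Y⁆)))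

/-- `g` is a contraction of some finite-dimensional real semisimple Lie algebra. -/
def IsContractionOfSemisimple : Prop :=
  ∃ (s : Type u) (_ : LieRing s) (_ : LieAlgebra ℝ s),
    FiniteDimensional ℝ s ∧ LieAlgebra.IsSemisimple ℝ s ∧ IsContraction s g

/-! ### Indecomposability and Levi decompositions -/

/-- `g` is nonzero and not a direct sum of two nonzero ideals. -/
def IsIndecomposable : Prop :=
  Nontrivial g ∧ ∀ I J : LieIdeal ℝ g, IsCompl I J → I = ⊥ ∨ J = ⊥

/-- `g` is the vector space direct sum of a semisimple subalgebra `s ≠ 0` and its radical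
`r ≠ 0`, with `s` acting nontrivially on `r`. -/
def HasNontrivialLeviDecomposition : Prop :=
  ∃ s : LieSubalgebra ℝ g,
    LieAlgebra.IsSemisimple ℝ s ∧ s ≠ ⊥ ∧ LieAlgebra.radical ℝ g ≠ ⊥ ∧
    IsCompl s.toSubmodule (LieAlgebra.radical ℝ g).toSubmodule ∧
    ∃ x ∈ s, ∃ y ∈ LieAlgebra.radical ℝ g, ⁅x, y⁆ ≠ 0

/-! ### The second adjoint cohomology space -/

/-- The quotient `Z / B` of two subspaces `B ⊆ Z` of a real vector space (`Z / (Z ∩ B)` in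
general). -/
abbrev Subquotient {V : Type*} [AddCommGroup V] [Module ℝ V] (Z B : Submodule ℝ V) : Type _ :=
  Z ⧸ B.submoduleOf Z

/-- The 2-coboundaries with values in the adjoint module. -/
def B2 : Submodule ℝ (LieModule.Cohomology.twoCochain ℝ g g) :=
  LinearMap.range (LieModule.Cohomology.d₁₂ ℝ g g)

/-- `H²(g, g) = Z²(g, g) / B²(g, g)`, cohomology with values in the adjoint module. -/
abbrev H2 : Type u :=
  Subquotient (V := LieModule.Cohomology.twoCochain ℝ g g)
    (LieModule.Cohomology.twoCocycle ℝ g g) (B2 g)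

end General

/-! ### Lie algebras given by structure constants -/

/-- The Lie algebra on `ℝⁿ` with structure constants `C`. (A new type, since `Fin n → ℝ` carries
an abelian Lie bracket.) -/
def OfLaw {n : ℕ} (_ : lieVariety n) : Type := Fin n → ℝ

namespace OfLaw

variable {n : ℕ} (C : lieVariety n)

instance : AddCommGroup (OfLaw C) := inferInstanceAs (AddCommGroup (Fin n → ℝ))

noncomputable instance : Module ℝ (OfLaw C) := inferInstanceAs (Module ℝ (Fin n → ℝ))

noncomputable instance : Bracket (OfLaw C) (OfLaw C) where
  bracket x y := fun k => ∑ i, ∑ j, x i * y j * C.1 i j k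

variable {C}

theorem lie_apply (x y : OfLaw C) (k : Fin n) :
    ⁅x, y⁆ k = ∑ i, ∑ j, x i * y j * C.1 i j k := rfl

theorem add_apply (x y : OfLaw C) (k : Fin n) : (x + y) k = x k + y k := rfl

theorem neg_apply (x : OfLaw C) (k : Fin n) : (-x) k = -x k := rfl

theorem zero_apply (k : Fin n) : (0 : OfLaw C) k = 0 := rfl

theorem smul_apply (t : ℝ) (x : OfLaw C) (k : Fin n) : (t • x) k = t * x k := rfl

theorem skew (x y : OfLaw C) : ⁅x, y⁆ = -⁅y, x⁆ := by
  funext k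
  rw [neg_apply, lie_apply, lie_apply, Finset.sum_comm, ← Finset.sum_neg_distrib]
  refine Finset.sum_congr rfl fun j _ => ?_
  rw [← Finset.sum_neg_distrib]
  refine Finset.sum_congr rfl fun i _ => ?_
  rw [C.2.1 i j k]
  ring

theorem lie_lie_apply (x y z : OfLaw C) (l : Fin n) :
    ⁅⁅x, y⁆, z⁆ l = ∑ i, ∑ j, ∑ k, x i * y j * z k * ∑ m, C.1 i j m * C.1 m k l := by
  simp only [lie_apply, Finset.sum_mul, Finset.mul_sum]
  calc _ = ∑ k, ∑ m, ∑ i, ∑ j, x i * y j * C.1 i j m * z k * C.1 m k l := Finset.sum_comm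
    _ = ∑ k, ∑ i, ∑ j, ∑ m, x i * y j * C.1 i j m * z k * C.1 m k l := by
        refine Finset.sum_congr rfl fun k _ => ?_
        rw [Finset.sum_comm]
        exact Finset.sum_congr rfl fun i _ => Finset.sum_comm
    _ = ∑ i, ∑ j, ∑ k, ∑ m, x i * y j * C.1 i j m * z k * C.1 m k l := by
        rw [Finset.sum_comm]
        exact Finset.sum_congr rfl fun i _ => Finset.sum_comm
    _ = _ := by
        refine Finset.sum_congr rfl fun i _ => Finset.sum_congr rfl fun j _ =>
          Finset.sum_congr rfl fun k _ => Finset.sum_congr rfl fun m _ => ?_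
        ring

theorem jacobi (x y z : OfLaw C) : ⁅⁅x, y⁆, z⁆ + ⁅⁅y, z⁆, x⁆ + ⁅⁅z, x⁆, y⁆ = 0 := by
  funext l
  rw [add_apply, add_apply, zero_apply, lie_lie_apply, lie_lie_apply, lie_lie_apply]
  have h1 : ∑ i, ∑ j, ∑ k, y i * z j * x k * ∑ m, C.1 i j m * C.1 m k l
      = ∑ i, ∑ j, ∑ k, x i * y j * z k * ∑ m, C.1 j k m * C.1 m i l := by
    rw [Finset.sum_congr rfl fun i _ => Finset.sum_comm, Finset.sum_comm]
    refine Finset.sum_congr rfl fun i _ => Finset.sum_congr rfl fun j _ =>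
      Finset.sum_congr rfl fun k _ => ?_
    ring
  have h2 : ∑ i, ∑ j, ∑ k, z i * x j * y k * ∑ m, C.1 i j m * C.1 m k l
      = ∑ i, ∑ j, ∑ k, x i * y j * z k * ∑ m, C.1 k i m * C.1 m j l := by
    rw [Finset.sum_comm]
    refine Finset.sum_congr rfl fun i _ => ?_
    rw [Finset.sum_comm]
    refine Finset.sum_congr rfl fun j _ => Finset.sum_congr rfl fun k _ => ?_
    ring
  rw [h1, h2]
  simp only [← Finset.sum_add_distrib, ← mul_add]
  refine Finset.sum_eq_zero fun i _ => Finset.sum_eq_zero fun j _ =>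
    Finset.sum_eq_zero fun k _ => ?_
  rw [C.2.2 i j k l, mul_zero]

theorem add_lie' (x y z : OfLaw C) : ⁅x + y, z⁆ = ⁅x, z⁆ + ⁅y, z⁆ := by
  funext k
  simp only [lie_apply, add_apply, add_mul, Finset.sum_add_distrib]

theorem lie_add' (x y z : OfLaw C) : ⁅x, y + z⁆ = ⁅x, y⁆ + ⁅x, z⁆ := by
  funext k
  simp only [lie_apply, add_apply, mul_add, add_mul, Finset.sum_add_distrib]

variable (C)

noncomputable instance : LieRing (OfLaw C) where
  add_lie := add_lie'
  lie_add := lie_add'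
  lie_self x := by
    have h := skew x x
    funext k
    have hk := congrFun h k
    rw [neg_apply] at hk
    rw [zero_apply]
    linarith
  leibniz_lie x y z := by
    have h := jacobi x y z
    rw [skew x ⁅y, z⁆, skew y ⁅x, z⁆, skew x z]
    have h3 : ⁅-⁅z, x⁆, y⁆ = -⁅⁅z, x⁆, y⁆ := by
      funext k
      simp only [lie_apply, neg_apply, neg_mul, Finset.sum_neg_distrib]
    rw [h3, neg_neg]
    have h4 : ⁅⁅x, y⁆, z⁆ + ⁅⁅z, x⁆, y⁆ = -⁅⁅y, z⁆, x⁆ := by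
      rw [eq_neg_iff_add_eq_zero, ← h]
      abel
    exact h4.symm

noncomputable instance : LieAlgebra ℝ (OfLaw C) where
  lie_smul t x y := by
    funext k
    rw [smul_apply]
    simp only [lie_apply, smul_apply, Finset.mul_sum]
    refine Finset.sum_congr rfl fun i _ => Finset.sum_congr rfl fun j _ => ?_
    ring

end OfLaw

/-- Integer structure constants on `{X₁, …, Xₙ}` from a table: an entry `(i, j, k, c)` stands for
`C_{ij}^k = c` and `C_{ji}^k = -c`, and brackets that are not listed vanish. Indices in the table
start at 1. -/
def ofTable (n : ℕ) (T : List (ℕ × ℕ × ℕ × ℤ)) (i j k : Fin n) : ℤ :=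
  (T.map fun e =>
    if e.1 = i.1 + 1 ∧ e.2.1 = j.1 + 1 ∧ e.2.2.1 = k.1 + 1 then e.2.2.2
    else if e.1 = j.1 + 1 ∧ e.2.1 = i.1 + 1 ∧ e.2.2.1 = k.1 + 1 then -e.2.2.2
    else 0).sum

/-- An integral law, seen as a real one. -/
def realLaw {n : ℕ} (c : Fin n → Fin n → Fin n → ℤ)
    (h₁ : ∀ i j k, c i j k = -c j i k)
    (h₂ : ∀ i j k l, ∑ m, (c i j m * c m k l + c j k m * c m i l + c k i m * c m j l) = 0) :
    lieVariety n :=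
  ⟨fun i j k => (c i j k : ℝ),
    fun i j k => by
      have h := congrArg (Int.cast : ℤ → ℝ) (h₁ i j k)
      rwa [Int.cast_neg] at h,
    fun i j k l => by
      have h := congrArg (Int.cast : ℤ → ℝ) (h₂ i j k l)
      push_cast at h
      exact h⟩

/-- Structure constants of `L_{6,1}`. -/
def c61 : Fin 6 → Fin 6 → Fin 6 → ℤ :=
  ofTable 6 [(2, 3, 1, 1), (1, 2, 3, 1), (1, 3, 2, -1), (1, 5, 6, 1), (1, 6, 5, -1),
    (2, 4, 6, -1), (2, 6, 4, 1), (3, 4, 5, 1), (3, 5, 4, -1)]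

/-- Structure constants of `L_{6,2}`. -/
def c62 : Fin 6 → Fin 6 → Fin 6 → ℤ :=
  ofTable 6 [(1, 2, 2, 2), (1, 3, 3, -2), (2, 3, 1, 1), (1, 4, 4, 1), (2, 5, 4, 1),
    (3, 4, 5, 1), (1, 5, 5, -1), (4, 5, 6, 1)]

/-- Structure constants of `L_{6,3}`. -/
def c63 : Fin 6 → Fin 6 → Fin 6 → ℤ :=
  ofTable 6 [(1, 2, 2, 2), (1, 3, 3, -2), (2, 3, 1, 1), (1, 4, 4, 1), (2, 5, 4, 1),
    (3, 4, 5, 1), (1, 5, 5, -1), (4, 6, 4, 1), (5, 6, 5, 1)]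

/-- Structure constants of `L_{6,4}`. -/
def c64 : Fin 6 → Fin 6 → Fin 6 → ℤ :=
  ofTable 6 [(1, 2, 2, 2), (1, 3, 3, -2), (2, 3, 1, 1), (1, 4, 4, 2), (1, 6, 6, -2),
    (2, 5, 4, 2), (2, 6, 5, 1), (3, 4, 5, 1), (3, 5, 6, 2)]

abbrev L61 : Type := OfLaw (realLaw c61 (by decide +kernel) (by decide +kernel))

abbrev L62 : Type := OfLaw (realLaw c62 (by decide +kernel) (by decide +kernel))

abbrev L63 : Type := OfLaw (realLaw c63 (by decide +kernel) (by decide +kernel))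

abbrev L64 : Type := OfLaw (realLaw c64 (by decide +kernel) (by decide +kernel))

/-! ### Inhomogeneous Lie algebras -/

/-- The semidirect sum of a Lie algebra `L` with an `L`-module `M`, where `M` becomes an abelian
ideal: `[(x, v), (y, w)] = ([x, y], x w - y v)`. -/
def Inhom (L M : Type*) : Type _ := L × M

namespace Inhom

variable (L M : Type*) [LieRing L] [LieAlgebra ℝ L] [AddCommGroup M] [Module ℝ M]
  [LieRingModule L M] [LieModule ℝ L M]

instance : AddCommGroup (Inhom L M) := inferInstanceAs (AddCommGroup (L × M))

instance : Module ℝ (Inhom L M) := inferInstanceAs (Module ℝ (L × M))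

instance : Bracket (Inhom L M) (Inhom L M) where
  bracket p q := (⁅p.1, q.1⁆, ⁅p.1, q.2⁆ - ⁅q.1, p.2⁆)

instance : LieRing (Inhom L M) where
  add_lie p q r := Prod.ext (add_lie p.1 q.1 r.1) (by
    change ⁅p.1 + q.1, r.2⁆ - ⁅r.1, p.2 + q.2⁆ =
      (⁅p.1, r.2⁆ - ⁅r.1, p.2⁆) + (⁅q.1, r.2⁆ - ⁅r.1, q.2⁆)
    rw [add_lie, lie_add]; abel)
  lie_add p q r := Prod.ext (lie_add p.1 q.1 r.1) (by
    change ⁅p.1, q.2 + r.2⁆ - ⁅q.1 + r.1, p.2⁆ =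
      (⁅p.1, q.2⁆ - ⁅q.1, p.2⁆) + (⁅p.1, r.2⁆ - ⁅r.1, p.2⁆)
    rw [add_lie, lie_add]; abel)
  lie_self p := Prod.ext (lie_self p.1) (sub_self _)
  leibniz_lie p q r := Prod.ext (leibniz_lie p.1 q.1 r.1) (by
    change ⁅p.1, ⁅q.1, r.2⁆ - ⁅r.1, q.2⁆⁆ - ⁅⁅q.1, r.1⁆, p.2⁆ =
      (⁅⁅p.1, q.1⁆, r.2⁆ - ⁅r.1, ⁅p.1, q.2⁆ - ⁅q.1, p.2⁆⁆) +
      (⁅q.1, ⁅p.1, r.2⁆ - ⁅r.1, p.2⁆⁆ - ⁅⁅p.1, r.1⁆, q.2⁆)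
    simp only [lie_sub, lie_lie]; abel)

instance : LieAlgebra ℝ (Inhom L M) where
  lie_smul t p q := Prod.ext (lie_smul t p.1 q.1) (by
    change ⁅p.1, t • q.2⁆ - ⁅t • q.1, p.2⁆ = t • (⁅p.1, q.2⁆ - ⁅q.1, p.2⁆)
    rw [lie_smul, smul_lie, smul_sub])

end Inhom

/-- `I𝔰𝔬(3)`: rotations and translations of `ℝ³`, with `𝔰𝔬(3)` acting on `ℝ³` as matrices. -/
abbrev Iso3 : Type := Inhom (LieAlgebra.Orthogonal.so (Fin 3) ℝ) (Fin 3 → ℝ)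

/-- `I𝔰𝔩(2,ℝ)`: the semidirect sum of `𝔰𝔩(2,ℝ)` with its three-dimensional irreducible
representation (the adjoint one), turned into an abelian ideal. -/
abbrev Isl2 : Type :=
  Inhom (LieAlgebra.SpecialLinear.sl (Fin 2) ℝ) (LieAlgebra.SpecialLinear.sl (Fin 2) ℝ)

/-- The compact algebra `𝔰𝔬(4)`. -/
abbrev So4 : Type := LieAlgebra.Orthogonal.so (Fin 4) ℝ

/-- The Lorentz algebra `𝔰𝔬(3,1)`. -/
abbrev So31 : Type := LieAlgebra.Orthogonal.so' (Fin 3) (Fin 1) ℝ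

/-- The algebra `𝔰𝔬(2,2)`. -/
abbrev So22 : Type := LieAlgebra.Orthogonal.so' (Fin 2) (Fin 2) ℝ

end LowDimLie

namespace LowDimLie

open Filter Topology Module

/-! ### Structure constants and bases -/

section Laws

variable {g : Type*} [LieRing g] [LieAlgebra ℝ g]
variable {g' : Type*} [LieRing g'] [LieAlgebra ℝ g']
variable {n : ℕ}

/-! Classification. The kernel of the action of the Levi factor on the radical is an ideal, and a
nonzero ideal of a semisimple algebra has dimension at least three. Comparing dimensions with those
of the linear endomorphisms of the radical leaves only the splitting 6 = 3 + 3
(`finrank_eq_three_of_action`). A Killing-orthogonal basis shows that the Levi factor is 𝔰𝔬(3) or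
𝔰𝔩(2,ℝ) (`exists_triple`). Its nontrivial three-dimensional representations are found by hand: the
vector representation of 𝔰𝔬(3), and for 𝔰𝔩(2,ℝ) the adjoint one or the plane plus a trivial line
(`exists_so3_basis`, `exists_sl2_basis`). The bracket of the radical is equivariant, so it is
determined by one scalar in the irreducible cases and by two in the reducible one. Solvability kills
the scalar in the irreducible cases. In the reducible case the Jacobi identity makes the product of
the two scalars zero, and indecomposability excludes that both vanish. Rescaling gives the four
laws.

Contractions. `L61` and `L64` are limits of laws of 𝔰𝔬(4), 𝔰𝔬(3,1) and 𝔰𝔬(2,2), in bases adapted to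
a three-dimensional subalgebra whose complement is scaled to zero (`isContraction_of_degrees`).
Explicit matrices identify these laws. Since 𝔰𝔬(3,1) contracts to both algebras, only its Killing
form has to be examined.

Stability. A complement W of the coboundaries is transversal to the orbit, and by the implicit
function theorem every nearby law can be transported onto the slice through the given law in
direction W. If H² = 0, the linearized law equations are injective on W, while a law on the slice
satisfies them up to a quadratic error; hence a small slice contains no other law
(`orbitIn_mem_nhds`). For `L62` and `L63` the vanishing of H² is a finite computation, because a
cocycle can first be reduced to weight zero for `X₁` (`exists_weight_zero`).

Exclusivity. A contraction is a limit of laws from a single orbit, so an open orbit that contains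
the limit meets that orbit. A stable contraction of a semisimple algebra would then be semisimple
itself, against the nonzero radical. -/

theorem repr_lie (b : Basis (Fin n) ℝ g) (x z : g) (l : Fin n) :
    b.repr ⁅x, z⁆ l = ∑ m, b.repr x m * b.repr ⁅b m, z⁆ l := by
  conv_lhs => rw [← b.sum_repr x, sum_lie, map_sum]
  simp

theorem lie_lie_cyclic {L : Type*} [LieRing L] (x y z : L) :
    ⁅⁅x, y⁆, z⁆ + ⁅⁅y, z⁆, x⁆ + ⁅⁅z, x⁆, y⁆ = 0 := by
  have h := lie_jacobi z x y
  rw [← lie_skew z ⁅x, y⁆, ← lie_skew x ⁅y, z⁆, ← lie_skew y ⁅z, x⁆] at h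
  rw [← neg_eq_zero, ← h]
  abel

/-- The structure constants of a Lie algebra with respect to a basis. -/
noncomputable def lawOfBasis (b : Basis (Fin n) ℝ g) : lieVariety n :=
  ⟨fun i j k => b.repr ⁅b i, b j⁆ k,
    fun i j k => by
      change b.repr ⁅b i, b j⁆ k = -b.repr ⁅b j, b i⁆ k
      rw [← lie_skew, map_neg, Finsupp.neg_apply],
    fun i j k l => by
      simp only [Finset.sum_add_distrib, ← repr_lie]
      rw [← Finsupp.add_apply, ← Finsupp.add_apply, ← map_add, ← map_add, lie_lie_cyclic,
        map_zero, Finsupp.zero_apply]⟩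

theorem lawOfBasis_apply (b : Basis (Fin n) ℝ g) (i j k : Fin n) :
    (lawOfBasis b).1 i j k = b.repr ⁅b i, b j⁆ k := rfl

theorem lie_basis_eq_sum (b : Basis (Fin n) ℝ g) (i j : Fin n) :
    ⁅b i, b j⁆ = ∑ k, (lawOfBasis b).1 i j k • b k :=
  (b.sum_repr _).symm

/-- A linear isomorphism that respects the brackets of the members of a basis. -/
noncomputable def lieEquivOfBasis (b : Basis (Fin n) ℝ g) (e : g ≃ₗ[ℝ] g')
    (h : ∀ i j, e ⁅b i, b j⁆ = ⁅e (b i), e (b j)⁆) : g ≃ₗ⁅ℝ⁆ g' :=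
  { e with
    map_lie' := by
      intro x y
      change e ⁅x, y⁆ = ⁅e x, e y⁆
      rw [← b.sum_repr x, ← b.sum_repr y]
      simp only [sum_lie, lie_sum, map_sum, smul_lie, lie_smul, map_smul, h] }

/-- Lie algebras with the same structure constants are isomorphic. -/
noncomputable def lieEquivOfLawEq (b : Basis (Fin n) ℝ g) (b' : Basis (Fin n) ℝ g')
    (h : ∀ i j k, b.repr ⁅b i, b j⁆ k = b'.repr ⁅b' i, b' j⁆ k) : g ≃ₗ⁅ℝ⁆ g' :=
  lieEquivOfBasis b (b.equiv b' (Equiv.refl _)) fun i j => by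
    apply b'.repr.injective
    ext k
    rw [lie_basis_eq_sum b i j]
    simp [lawOfBasis_apply, h]

/-- The standard basis of the Lie algebra of a law. -/
noncomputable def OfLaw.basis (C : lieVariety n) : Basis (Fin n) ℝ (OfLaw C) :=
  Pi.basisFun ℝ (Fin n)

theorem OfLaw.basis_repr (C : lieVariety n) (x : OfLaw C) (k : Fin n) :
    (OfLaw.basis C).repr x k = x k :=
  rfl

theorem OfLaw.basis_apply (C : lieVariety n) (i j : Fin n) :
    (OfLaw.basis C i : OfLaw C) j = if j = i then 1 else 0 := by
  rw [← OfLaw.basis_repr C (OfLaw.basis C i) j, Basis.repr_self, Finsupp.single_apply]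
  simp [eq_comm]

theorem OfLaw.basis_lie (C : lieVariety n) (i j k : Fin n) :
    (⁅OfLaw.basis C i, OfLaw.basis C j⁆ : OfLaw C) k = C.1 i j k := by
  rw [OfLaw.lie_apply]
  simp [OfLaw.basis_apply]

instance (C : lieVariety n) : FiniteDimensional ℝ (OfLaw C) :=
  Module.Finite.of_basis (OfLaw.basis C)

theorem OfLaw.finrank_eq (C : lieVariety n) : finrank ℝ (OfLaw C) = n := by
  rw [Module.finrank_eq_card_basis (OfLaw.basis C), Fintype.card_fin]

/-- A Lie algebra is given by its structure constants with respect to a basis. -/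
noncomputable def equivOfLaw (b : Basis (Fin n) ℝ g) (C : lieVariety n)
    (h : ∀ i j, ⁅b i, b j⁆ = ∑ k, C.1 i j k • b k) : g ≃ₗ⁅ℝ⁆ OfLaw C :=
  lieEquivOfLawEq b (OfLaw.basis C) fun i j k => by
    rw [OfLaw.basis_repr, OfLaw.basis_lie, h]
    simp [Finsupp.single_apply]

/-- Only the brackets of the members `b i`, `b j` with `i < j` have to be checked. -/
noncomputable def equivOfLawOfLT (b : Basis (Fin n) ℝ g) (C : lieVariety n)
    (h : ∀ i j, i < j → ⁅b i, b j⁆ = ∑ k, C.1 i j k • b k) : g ≃ₗ⁅ℝ⁆ OfLaw C :=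
  equivOfLaw b C fun i j => by
    rcases lt_trichotomy i j with hij | rfl | hij
    · exact h i j hij
    · have hC : ∀ k, C.1 i i k = 0 := fun k => by linarith [C.2.1 i i k]
      simp [hC]
    · rw [← lie_skew, h j i hij, ← Finset.sum_neg_distrib]
      refine Finset.sum_congr rfl fun k _ => ?_
      rw [C.2.1 i j k, neg_smul]

end Laws

/-! ### Orbits, stability and contractions -/

section Orbits

variable {g : Type*} [LieRing g] [LieAlgebra ℝ g]
variable {g' : Type*} [LieRing g'] [LieAlgebra ℝ g']

/-- The laws in `𝓛ⁿ` that are isomorphic to `g`. -/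
def orbitIn (n : ℕ) (g : Type*) [LieRing g] [LieAlgebra ℝ g] : Set (lieVariety n) :=
  {C | ∃ b : Basis (Fin n) ℝ g, ∀ i j k, C.1 i j k = b.repr ⁅b i, b j⁆ k}

/-- The space in `IsStable` depends on `finrank ℝ g`. With a free index `n`, orbits of isomorphic
algebras can be compared inside one variety. -/
theorem isStable_iff_isOpen_orbitIn {n : ℕ} (h : finrank ℝ g = n) :
    IsStable g ↔ IsOpen (orbitIn n g) := by
  subst h
  rfl

theorem orbitIn_subset_of_lieEquiv (n : ℕ) (e : g ≃ₗ⁅ℝ⁆ g') : orbitIn n g ⊆ orbitIn n g' := by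
  rintro C ⟨b, hb⟩
  refine ⟨b.map e.toLinearEquiv, fun i j k => ?_⟩
  have h : e.toLinearEquiv.symm ⁅e (b i), e (b j)⁆ = ⁅b i, b j⁆ := by
    rw [← LieEquiv.map_lie]
    exact e.toLinearEquiv.symm_apply_apply _
  rw [hb, Basis.map_repr, LinearEquiv.trans_apply, Basis.map_apply, Basis.map_apply]
  exact congrArg (fun x => b.repr x k) h.symm

theorem IsStable.of_lieEquiv (h : IsStable g) (e : g ≃ₗ⁅ℝ⁆ g') : IsStable g' := by
  rw [isStable_iff_isOpen_orbitIn (n := finrank ℝ g') rfl]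
  rw [isStable_iff_isOpen_orbitIn (n := finrank ℝ g') e.toLinearEquiv.finrank_eq] at h
  rwa [(orbitIn_subset_of_lieEquiv _ e.symm).antisymm (orbitIn_subset_of_lieEquiv _ e)]

theorem IsContraction.congr_right {s : Type*} [LieRing s] [LieAlgebra ℝ s]
    (h : IsContraction s g) (e : g' ≃ₗ⁅ℝ⁆ g) : IsContraction s g' := by
  obtain ⟨Φ, f, hf⟩ := h
  refine ⟨Φ, e.toLinearEquiv.trans f, fun X Y φ => ?_⟩
  have h := hf (e X) (e Y) φ
  rw [← LieEquiv.map_lie] at h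
  exact h

theorem IsContraction.congr_left {s s' : Type*} [LieRing s] [LieAlgebra ℝ s] [LieRing s']
    [LieAlgebra ℝ s'] (h : IsContraction s g) (e : s ≃ₗ⁅ℝ⁆ s') : IsContraction s' g := by
  obtain ⟨Φ, f, hf⟩ := h
  refine ⟨fun t => (e.toLinearEquiv.symm.trans (Φ t)).trans e.toLinearEquiv,
    f.trans e.toLinearEquiv, fun X Y φ => ?_⟩
  have h := hf X Y (φ ∘ₗ e.toLinearEquiv.toLinearMap)
  refine h.congr fun t => congrArg φ ?_
  change e _ = e ((Φ t).symm (e.symm ⁅e (Φ t (e.symm (e (f X)))), e (Φ t (e.symm (e (f Y))))⁆))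
  rw [← LieEquiv.map_lie, e.symm_apply_apply, e.symm_apply_apply, e.symm_apply_apply]

/-- A stable Lie algebra is a contraction of isomorphic Lie algebras only. -/
theorem IsStable.nonempty_lieEquiv_of_isContraction [FiniteDimensional ℝ g] {s : Type*} [LieRing s]
    [LieAlgebra ℝ s] (hg : IsStable g) (h : IsContraction s g) : Nonempty (s ≃ₗ⁅ℝ⁆ g) := by
  obtain ⟨Φ, e, he⟩ := h
  let b := Module.finBasis ℝ g
  -- The contracted bracket at time `t` is the bracket of `s` read in this moving basis, so all
  -- these laws are laws of `s` and their limit is a law of `g`.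
  let c : ℝ → Basis (Fin (finrank ℝ g)) ℝ s := fun t => b.map (e.trans (Φ t))
  have hlim : Tendsto (fun t => lawOfBasis (c t)) atTop (𝓝 (lawOfBasis b)) := by
    rw [tendsto_subtype_rng, tendsto_pi_nhds]
    refine fun i => tendsto_pi_nhds.2 fun j => tendsto_pi_nhds.2 fun k => ?_
    have h := he (b i) (b j) ((b.map e).coord k)
    simpa [lawOfBasis_apply, c] using h
  have hmem : lawOfBasis b ∈ orbit g := ⟨b, fun i j k => rfl⟩
  obtain ⟨t, ht⟩ := (hlim.eventually (IsOpen.mem_nhds hg hmem)).exists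
  obtain ⟨b', hb'⟩ := ht
  exact ⟨lieEquivOfLawEq (c t) b' hb'⟩

/-- A law is contracted by scaling the members of the standard basis. -/
theorem isContraction_of_scaling {n : ℕ} (C D : lieVariety n) (w : Fin n → ℕ)
    (h : ∀ i j k, Tendsto (fun t : ℝ => t ^ w k * (t ^ w i)⁻¹ * (t ^ w j)⁻¹ * C.1 i j k) atTop
      (𝓝 (D.1 i j k))) : IsContraction (OfLaw C) (OfLaw D) := by
  -- The maps must be invertible for every `t`; the value at `t = 0` is arbitrary and does not
  -- affect the limit.
  let u : ℝ → ℝˣ := fun t => if ht : t = 0 then 1 else Units.mk0 t ht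
  have hu : ∀ᶠ t in atTop, ((u t : ℝˣ) : ℝ) = t := by
    filter_upwards [eventually_ne_atTop (0 : ℝ)] with t ht
    simp [u, ht]
  let Φ : ℝ → (OfLaw C ≃ₗ[ℝ] OfLaw C) := fun t =>
    LinearEquiv.piCongrRight fun i => LinearEquiv.smulOfUnit ((u t)⁻¹ ^ w i)
  have hΦ : ∀ t (x : OfLaw C) i, Φ t x i = ((u t : ℝ) ^ w i)⁻¹ * x i := fun t x i => by
    change ((u t)⁻¹ ^ w i) • x i = _
    simp [Units.smul_def]
  have hΦs : ∀ t (x : OfLaw C) i, (Φ t).symm x i = (u t : ℝ) ^ w i * x i := fun t x i => by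
    have h1 := hΦ t ((Φ t).symm x) i
    rw [LinearEquiv.apply_symm_apply] at h1
    rw [h1]
    have : ((u t : ℝ)) ^ w i ≠ 0 := pow_ne_zero _ (u t).ne_zero
    field_simp
  have key : ∀ (X Y : OfLaw D) (k : Fin n), Tendsto (fun t : ℝ =>
      (Φ t).symm ⁅Φ t (show OfLaw C from X), Φ t (show OfLaw C from Y)⁆ k) atTop
      (𝓝 ((⁅X, Y⁆ : OfLaw D) k)) := by
    intro X Y k
    have h1 : Tendsto (fun t : ℝ => ∑ i, ∑ j, X i * Y j *
        (t ^ w k * (t ^ w i)⁻¹ * (t ^ w j)⁻¹ * C.1 i j k)) atTop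
        (𝓝 (∑ i, ∑ j, X i * Y j * D.1 i j k)) :=
      tendsto_finsetSum _ fun i _ => tendsto_finsetSum _ fun j _ => (h i j k).const_mul _
    refine h1.congr' ?_
    filter_upwards [hu] with t ht
    rw [hΦs, OfLaw.lie_apply, Finset.mul_sum]
    refine Finset.sum_congr rfl fun i _ => ?_
    rw [Finset.mul_sum]
    refine Finset.sum_congr rfl fun j _ => ?_
    rw [hΦ, hΦ, ht]
    ring
  refine ⟨Φ, LinearEquiv.refl ℝ (Fin n → ℝ), fun X Y f => ?_⟩
  have hf : ∀ x : OfLaw C, f x = ∑ k, x k * f (OfLaw.basis C k) := fun x => by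
    conv_lhs => rw [← (OfLaw.basis C).sum_repr x, map_sum]
    simp [OfLaw.basis_repr]
  have h2 : Tendsto (fun t : ℝ => ∑ k, (Φ t).symm ⁅Φ t (show OfLaw C from X),
      Φ t (show OfLaw C from Y)⁆ k * f (OfLaw.basis C k)) atTop
      (𝓝 (∑ k, (⁅X, Y⁆ : OfLaw D) k * f (OfLaw.basis C k))) :=
    tendsto_finsetSum _ fun k _ => (key X Y k).mul_const _
  rw [← hf (show OfLaw C from (⁅X, Y⁆ : OfLaw D))] at h2
  exact h2.congr fun t => (hf _).symm

end Orbits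
end LowDimLie

namespace LowDimLie

open Filter Topology Module

/-! ### Vanishing of the second adjoint cohomology implies stability -/

section Transversality

variable {T E Y : Type*} [NormedAddCommGroup T] [NormedSpace ℝ T] [NormedAddCommGroup E]
  [NormedSpace ℝ E] [NormedAddCommGroup Y] [NormedSpace ℝ Y]

/-- Points near `μ₀` are transported, by parameters near `p₀`, to points `μ₀ + ι w` of a
transversal to the infinitesimal action. -/
theorem eventually_exists_transport [CompleteSpace T] [CompleteSpace E] [CompleteSpace Y]
    (push left right : T →L[ℝ] E →L[ℝ] T) (ι : Y →L[ℝ] T) (μ₀ : T) (p₀ : E)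
    (hpush : ∀ m, push m p₀ = m) (hleft : ∀ m, left m p₀ = m) (hright : ∀ m, right m p₀ = m)
    (hsurj : ∀ z, ∃ φ w, push μ₀ φ - left μ₀ φ - right μ₀ φ + ι w = z)
    {U : Set (E × Y)} (hU : U ∈ 𝓝 ((p₀, 0) : E × Y)) :
    ∀ᶠ μ in 𝓝 μ₀, ∃ p ∈ U, push μ p.1 = right (left (μ₀ + ι p.2) p.1) p.1 := by
  -- Keeping `μ` as first component turns solvability for every nearby `μ` into a single open
  -- mapping statement at `(μ₀, 0)`.
  let Θ : T × E × Y → T × T := fun q => 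
    (q.1, push q.1 q.2.1 - right (left (μ₀ + ι q.2.2) q.2.1) q.2.1)
  let q₀ : T × E × Y := (μ₀, p₀, 0)
  have hμ : HasStrictFDerivAt (fun q : T × E × Y => q.1) (ContinuousLinearMap.fst ℝ T (E × Y)) q₀ :=
    hasStrictFDerivAt_fst
  have hP : HasStrictFDerivAt (fun q : T × E × Y => q.2.1)
      ((ContinuousLinearMap.fst ℝ E Y).comp (ContinuousLinearMap.snd ℝ T (E × Y))) q₀ :=
    hasStrictFDerivAt_fst.comp q₀ hasStrictFDerivAt_snd
  have hν : HasStrictFDerivAt (fun q : T × E × Y => μ₀ + ι q.2.2)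
      (ι.comp ((ContinuousLinearMap.snd ℝ E Y).comp (ContinuousLinearMap.snd ℝ T (E × Y)))) q₀ :=
    HasStrictFDerivAt.const_add μ₀ (ι.hasStrictFDerivAt.comp q₀
      (hasStrictFDerivAt_snd.comp q₀ hasStrictFDerivAt_snd))
  have h₁ := (push.hasStrictFDerivAt.comp q₀ hμ).clm_apply hP
  have h₂ := (left.hasStrictFDerivAt.comp q₀ hν).clm_apply hP
  have h₃ := (right.hasStrictFDerivAt.comp q₀ h₂).clm_apply hP
  have hΘ := hμ.prodMk (h₁.sub h₃)
  have hmap := HasStrictFDerivAt.map_nhds_eq_of_surj hΘ (by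
    rw [LinearMap.range_eq_top]
    rintro ⟨m, z⟩
    obtain ⟨φ, w, hw⟩ := hsurj (z - m)
    -- The derivative of the second component is `m` plus the infinitesimal action of `φ` minus `ι`
    -- of the third variable; this explains both `z - m` and the sign of `w`.
    refine ⟨(m, φ, -w), Prod.ext rfl ?_⟩
    have hz : z = m + (push μ₀ φ - left μ₀ φ - right μ₀ φ + ι w) := by rw [hw]; abel
    rw [hz]
    simp [q₀, hpush, hleft, hright]
    abel)
  have hV : {q : T × E × Y | q.2 ∈ U} ∈ 𝓝 q₀ := continuous_snd.continuousAt hU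
  have hq₀ : Θ q₀ = (μ₀, 0) := by simp [Θ, q₀, hpush, hleft, hright]
  have himg : Θ '' {q | q.2 ∈ U} ∈ 𝓝 ((μ₀, 0) : T × T) := by
    rw [← hq₀]
    exact hmap ▸ image_mem_map hV
  have hlim : Tendsto (fun μ => ((μ, 0) : T × T)) (𝓝 μ₀) (𝓝 (μ₀, 0)) :=
    (Continuous.prodMk_left _).continuousAt
  filter_upwards [hlim himg] with μ hμ'
  obtain ⟨⟨μ', q⟩, hq, hq'⟩ := hμ'
  obtain rfl : μ' = μ := congrArg Prod.fst hq'
  exact ⟨q, hq, sub_eq_zero.1 (congrArg Prod.snd hq')⟩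

end Transversality

/-! ### Bilinear operations in coordinates -/

section Coordinates

variable {T E X Z : Type*} [NormedAddCommGroup T] [NormedSpace ℝ T] [FiniteDimensional ℝ T]
  [NormedAddCommGroup E] [NormedSpace ℝ E] [FiniteDimensional ℝ E]
  [AddCommGroup X] [Module ℝ X] [AddCommGroup Z] [Module ℝ Z]

/-- A bilinear map in coordinates, as a continuous one. -/
noncomputable def continuousInCoordinates (τ : T ≃ₗ[ℝ] X) (ε : E ≃ₗ[ℝ] Z) (B : X →ₗ[ℝ] Z →ₗ[ℝ] X) :
    T →L[ℝ] E →L[ℝ] T :=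
  LinearMap.toContinuousLinearMap (LinearMap.toContinuousLinearMap.toLinearMap ∘ₗ
    ((B.compl₁₂ τ.toLinearMap ε.toLinearMap).compr₂ τ.symm.toLinearMap))

theorem continuousInCoordinates_apply (τ : T ≃ₗ[ℝ] X) (ε : E ≃ₗ[ℝ] Z) (B : X →ₗ[ℝ] Z →ₗ[ℝ] X)
    (x : T) (y : E) : continuousInCoordinates τ ε B x y = τ.symm (B (τ x) (ε y)) := rfl

end Coordinates

/-! ### Rigidity: orbits are open when the second cohomology vanishes -/

section Rigidity

variable {g : Type*} [LieRing g] [LieAlgebra ℝ g] {n : ℕ}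

theorem subsingleton_subquotient_iff {M : Type*} [AddCommGroup M] [Module ℝ M]
    (Z B : Submodule ℝ M) : Subsingleton (Subquotient Z B) ↔ Z ≤ B := by
  rw [Submodule.Quotient.subsingleton_iff, Submodule.submoduleOf, Submodule.eq_top_iff']
  exact ⟨fun h a ha => h ⟨a, ha⟩, fun h a => h a.2⟩

theorem subsingleton_H2_iff : Subsingleton (H2 g) ↔
    ∀ a ∈ LieModule.Cohomology.twoCocycle ℝ g g, ∃ f, LieModule.Cohomology.d₁₂ ℝ g g f = a :=
  subsingleton_subquotient_iff (M := LieModule.Cohomology.twoCochain ℝ g g) _ _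

/-- Bilinear maps in coordinates. -/
noncomputable def bilinEquiv (b : Basis (Fin n) ℝ g) :
    (Fin n → Fin n → Fin n → ℝ) ≃ₗ[ℝ] (g →ₗ[ℝ] g →ₗ[ℝ] g) :=
  (LinearEquiv.piCongrRight fun _ =>
    (LinearEquiv.piCongrRight fun _ => b.equivFun.symm).trans (b.constr ℝ)).trans (b.constr ℝ)

/-- Linear maps in coordinates. -/
noncomputable def endEquiv (b : Basis (Fin n) ℝ g) :
    (Fin n → Fin n → ℝ) ≃ₗ[ℝ] (g →ₗ[ℝ] g) :=
  (LinearEquiv.piCongrRight fun _ => b.equivFun.symm).trans (b.constr ℝ)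

theorem bilinEquiv_basis (b : Basis (Fin n) ℝ g) (C : Fin n → Fin n → Fin n → ℝ) (i j : Fin n) :
    bilinEquiv b C (b i) (b j) = ∑ k, C i j k • b k := by
  simp [bilinEquiv, Basis.equivFun_symm_apply]

theorem repr_bilinEquiv_basis (b : Basis (Fin n) ℝ g) (C : Fin n → Fin n → Fin n → ℝ)
    (i j k : Fin n) : b.repr (bilinEquiv b C (b i) (b j)) k = C i j k := by
  rw [bilinEquiv_basis]
  simp [Finsupp.single_apply]

theorem endEquiv_basis (b : Basis (Fin n) ℝ g) (P : Fin n → Fin n → ℝ) (i : Fin n) :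
    endEquiv b P (b i) = ∑ k, P i k • b k := by
  simp [endEquiv, Basis.equivFun_symm_apply]

theorem bilinEquiv_lawOfBasis (b : Basis (Fin n) ℝ g) (x y : g) :
    bilinEquiv b (lawOfBasis b).1 x y = ⁅x, y⁆ := by
  have h : bilinEquiv b (lawOfBasis b).1 = (LieModule.toEnd ℝ g g : g →ₗ[ℝ] g →ₗ[ℝ] g) := by
    refine b.ext fun i => b.ext fun j => ?_
    rw [bilinEquiv_basis, ← lie_basis_eq_sum]
    rfl
  rw [h]
  rfl

theorem repr_bilinEquiv (b : Basis (Fin n) ℝ g) (C : lieVariety n) (x y : g) (k : Fin n) :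
    b.repr (bilinEquiv b C.1 x y) k =
      (⁅(show OfLaw C from b.equivFun x), (show OfLaw C from b.equivFun y)⁆ : OfLaw C) k := by
  rw [OfLaw.lie_apply]
  conv_lhs => rw [← b.sum_repr x, ← b.sum_repr y]
  simp only [map_sum, map_smul, LinearMap.sum_apply, LinearMap.smul_apply, Finsupp.finsetSum_apply,
    Finsupp.smul_apply, repr_bilinEquiv_basis, smul_eq_mul, Finset.mul_sum]
  rw [Finset.sum_comm]
  exact Finset.sum_congr rfl fun i _ => Finset.sum_congr rfl fun j _ => by
    rw [Basis.equivFun_apply, Basis.equivFun_apply]; ring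

/-- The basis-free form of the law equations is visibly preserved under transport by a linear
automorphism, which is how it is used. -/
theorem mem_lieVariety_iff (b : Basis (Fin n) ℝ g) (C : Fin n → Fin n → Fin n → ℝ) :
    C ∈ lieVariety n ↔ (∀ x y, bilinEquiv b C x y = -bilinEquiv b C y x) ∧
      ∀ x y z, bilinEquiv b C (bilinEquiv b C x y) z + bilinEquiv b C (bilinEquiv b C y z) x +
        bilinEquiv b C (bilinEquiv b C z x) y = 0 := by
  constructor
  · intro hC
    have key : ∀ x y, b.equivFun (bilinEquiv b C x y) =
        (⁅(show OfLaw ⟨C, hC⟩ from b.equivFun x), (show OfLaw ⟨C, hC⟩ from b.equivFun y)⁆ :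
          OfLaw ⟨C, hC⟩) := fun x y => funext fun k => repr_bilinEquiv b ⟨C, hC⟩ x y k
    refine ⟨fun x y => b.equivFun.injective ?_, fun x y z => b.equivFun.injective ?_⟩
    · rw [map_neg, key, key]
      exact OfLaw.skew _ _
    · rw [map_add, map_add, map_zero, key, key, key, key, key, key]
      exact OfLaw.jacobi _ _ _
  · rintro ⟨h₁, h₂⟩
    refine ⟨fun i j k => ?_, fun i j k l => ?_⟩
    · rw [← repr_bilinEquiv_basis b C i j k, h₁, map_neg, Finsupp.neg_apply, repr_bilinEquiv_basis]
    · have h := congrArg (fun x => b.repr x l) (h₂ (b i) (b j) (b k))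
      simp only [bilinEquiv_basis b C i j, bilinEquiv_basis b C j k, bilinEquiv_basis b C k i] at h
      simpa [Finset.sum_add_distrib, repr_bilinEquiv_basis] using h

theorem det_endEquiv (b : Basis (Fin n) ℝ g) (P : Fin n → Fin n → ℝ) :
    LinearMap.det (endEquiv b P) = Matrix.det (Matrix.of P) := by
  rw [← LinearMap.det_toMatrix b, ← Matrix.det_transpose]
  congr 1
  ext i j
  rw [Matrix.transpose_apply, LinearMap.toMatrix_apply, endEquiv_basis]
  simp [Finsupp.single_apply]

/-- The linearization at `C` of the equations of the variety of Lie algebra laws. -/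
noncomputable def linearizedEquations (C : Fin n → Fin n → Fin n → ℝ) :
    (Fin n → Fin n → Fin n → ℝ) →ₗ[ℝ]
      (Fin n → Fin n → Fin n → Fin n → ℝ) × (Fin n → Fin n → Fin n → ℝ) where
  toFun w := (fun i j k l => ∑ m, (C i j m * w m k l + w i j m * C m k l +
      (C j k m * w m i l + w j k m * C m i l) + (C k i m * w m j l + w k i m * C m j l)),
    fun i j k => w i j k + w j i k)
  map_add' w w' := by
    ext i j k
    · simp only [Prod.mk_add_mk, Pi.add_apply, ← Finset.sum_add_distrib]
      exact Finset.sum_congr rfl fun m _ => by ring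
    · simp only [Prod.mk_add_mk, Pi.add_apply]
      ring
  map_smul' t w := by
    ext i j k
    · simp only [Prod.smul_mk, Pi.smul_apply, smul_eq_mul, Finset.mul_sum, RingHom.id_apply]
      exact Finset.sum_congr rfl fun m _ => by ring
    · simp only [Prod.smul_mk, Pi.smul_apply, smul_eq_mul, RingHom.id_apply]
      ring

/-- A law `C + w` satisfies the linearized equations up to a term that is quadratic in `w`. -/
theorem norm_linearizedEquations_le {C w : Fin n → Fin n → Fin n → ℝ} (hC : C ∈ lieVariety n)
    (hw : C + w ∈ lieVariety n) : ‖linearizedEquations C w‖ ≤ n * 3 * ‖w‖ * ‖w‖ := by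
  have hb : ∀ i j k, ‖w i j k‖ ≤ ‖w‖ := fun i j k =>
    (norm_le_pi_norm _ k).trans ((norm_le_pi_norm _ j).trans (norm_le_pi_norm _ i))
  have h0 : 0 ≤ n * 3 * ‖w‖ * ‖w‖ := by positivity
  rw [Prod.norm_def, max_le_iff]
  constructor
  · refine (pi_norm_le_iff_of_nonneg h0).2 fun i => (pi_norm_le_iff_of_nonneg h0).2 fun j =>
      (pi_norm_le_iff_of_nonneg h0).2 fun k => (pi_norm_le_iff_of_nonneg h0).2 fun l => ?_
    have h : (linearizedEquations C w).1 i j k l =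
        -∑ m, (w i j m * w m k l + w j k m * w m i l + w k i m * w m j l) := by
      have h1 : (linearizedEquations C w).1 i j k l =
          (∑ m, ((C + w) i j m * (C + w) m k l + (C + w) j k m * (C + w) m i l +
            (C + w) k i m * (C + w) m j l)) -
          (∑ m, (C i j m * C m k l + C j k m * C m i l + C k i m * C m j l)) -
          ∑ m, (w i j m * w m k l + w j k m * w m i l + w k i m * w m j l) := by
        simp only [linearizedEquations, LinearMap.coe_mk, AddHom.coe_mk, Pi.add_apply]
        rw [← Finset.sum_sub_distrib, ← Finset.sum_sub_distrib]
        exact Finset.sum_congr rfl fun m _ => by ring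
      rw [h1, hw.2, hC.2]
      ring
    rw [h, norm_neg]
    refine (norm_sum_le_of_le _ (f := fun m => _) (n := fun _ => 3 * ‖w‖ * ‖w‖) fun m _ => ?_).trans ?_
    · have hm : ∀ a b c a' b' c', ‖w a b c * w a' b' c'‖ ≤ ‖w‖ * ‖w‖ := fun a b c a' b' c' => by
        rw [norm_mul]
        exact mul_le_mul (hb _ _ _) (hb _ _ _) (norm_nonneg _) (norm_nonneg _)
      refine (norm_add₃_le).trans ?_
      linarith [hm i j m m k l, hm j k m m i l, hm k i m m j l]
    · simp
      apply le_of_eq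
      ring
  · have h : (linearizedEquations C w).2 = 0 := by
      ext i j k
      have h1 := hC.1 i j k
      have h2 := hw.1 i j k
      simp only [Pi.add_apply] at h2
      simp only [linearizedEquations, LinearMap.coe_mk, AddHom.coe_mk, Pi.zero_apply]
      linarith
    rw [h, norm_zero]
    exact h0

/-- If the linearized equations at a law of `g` hold for `w`, then `w` is a 2-cocycle. -/
theorem mem_twoCocycle_of_linearizedEquations (b : Basis (Fin n) ℝ g)
    {w : Fin n → Fin n → Fin n → ℝ} (hw : linearizedEquations (lawOfBasis b).1 w = 0) :
    ∃ a ∈ LieModule.Cohomology.twoCocycle ℝ g g, a.1 = bilinEquiv b w := by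
  have hskew : ∀ x y, bilinEquiv b w x y = -bilinEquiv b w y x := by
    have h : bilinEquiv b w = -(bilinEquiv b w).flip := by
      refine b.ext fun i => b.ext fun j => b.repr.injective (Finsupp.ext fun k => ?_)
      have := congrFun (congrFun (congrFun (congrArg Prod.snd hw) i) j) k
      simp only [linearizedEquations, LinearMap.coe_mk, AddHom.coe_mk] at this
      simp only [LinearMap.neg_apply, LinearMap.flip_apply, map_neg, Finsupp.neg_apply,
        repr_bilinEquiv_basis]
      exact eq_neg_of_add_eq_zero_left this
    intro x y
    conv_lhs => rw [h]
    rfl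
  let a : LieModule.Cohomology.twoCochain ℝ g g := ⟨bilinEquiv b w, fun x => by
    have h := hskew x x
    rwa [eq_neg_iff_add_eq_zero, ← two_smul ℝ, smul_eq_zero_iff_right two_ne_zero] at h⟩
  have ha : ∀ x y, a x y = bilinEquiv b w x y := fun x y => rfl
  refine ⟨a, ?_, rfl⟩
  rw [LieModule.Cohomology.mem_twoCocycle_iff]
  refine b.ext fun i => b.ext fun j => b.ext fun k => b.repr.injective (Finsupp.ext fun l => ?_)
  have h := congrFun (congrFun (congrFun (congrFun (congrArg Prod.fst hw) i) j) k) l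
  simp only [linearizedEquations, LinearMap.coe_mk, AddHom.coe_mk, Finset.sum_add_distrib] at h
  have h₁ : ∀ i j k, b.repr (bilinEquiv b w ⁅b i, b j⁆ (b k)) l =
      ∑ m, (lawOfBasis b).1 i j m * w m k l := fun i j k => by
    rw [lie_basis_eq_sum]
    simp [repr_bilinEquiv_basis]
  have h₂ : ∀ i j k, b.repr ⁅bilinEquiv b w (b i) (b j), b k⁆ l =
      ∑ m, w i j m * (lawOfBasis b).1 m k l := fun i j k => by
    rw [repr_lie]
    simp [repr_bilinEquiv_basis, lawOfBasis_apply]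
  rw [LieModule.Cohomology.d₂₃_apply, ha, ha, ha, ha, ha, ha, hskew (b i) (b k),
    ← lie_skew (b i) (b k), ← lie_skew (b i), ← lie_skew (b k), ← lie_skew (b j)]
  simp only [map_add, map_sub, map_neg, neg_lie, LinearMap.neg_apply, Finsupp.add_apply,
    Finsupp.sub_apply, Finsupp.neg_apply, h₁, h₂, LinearMap.zero_apply, map_zero,
    Finsupp.zero_apply]
  simp only [Pi.zero_apply, Prod.fst_zero] at h
  linarith

/-- The tangent space of the orbit is the space of coboundaries. Transport moves a nearby law to `C₀
+ w` with `w` small in a complement of it, and the estimates below force `w = 0`, so the nearby law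
is isomorphic to `g`. The smoothness of the variety at `C₀` is never needed. -/
theorem orbitIn_mem_nhds (h : Subsingleton (H2 g)) {C₀ : lieVariety n} (hC₀ : C₀ ∈ orbitIn n g) :
    orbitIn n g ∈ 𝓝 C₀ := by
  rw [subsingleton_H2_iff] at h
  obtain ⟨b, hb⟩ := hC₀
  obtain rfl : C₀ = lawOfBasis b := Subtype.ext (funext fun i => funext fun j => funext (hb i j))
  let τ := bilinEquiv b
  let ε := endEquiv b
  let push := continuousInCoordinates τ ε (LinearMap.mk₂ ℝ (fun μ P => μ.compr₂ P)
    (fun _ _ _ => by ext; simp) (fun _ _ _ => by ext; simp)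
    (fun _ _ _ => by ext; simp) (fun _ _ _ => by ext; simp))
  let left := continuousInCoordinates τ ε (LinearMap.mk₂ ℝ (fun μ P => μ ∘ₗ P)
    (fun _ _ _ => by ext; simp) (fun _ _ _ => by ext; simp)
    (fun _ _ _ => by ext; simp) (fun _ _ _ => by ext; simp))
  let right := continuousInCoordinates τ ε (LinearMap.mk₂ ℝ (fun μ P => μ.compl₂ P)
    (fun _ _ _ => by ext; simp) (fun _ _ _ => by ext; simp)
    (fun _ _ _ => by ext; simp) (fun _ _ _ => by ext; simp))
  have hpush : ∀ m P x y, τ (push m P) x y = ε P (τ m x y) := fun m P x y => by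
    simp [push, continuousInCoordinates_apply]
  have hleft : ∀ m P x y, τ (left m P) x y = τ m (ε P x) y := fun m P x y => by
    simp [left, continuousInCoordinates_apply]
  have hright : ∀ m P x y, τ (right m P) x y = τ m x (ε P y) := fun m P x y => by
    simp [right, continuousInCoordinates_apply]
  have hμ₀ : ∀ x y, τ (lawOfBasis b).1 x y = ⁅x, y⁆ := bilinEquiv_lawOfBasis b
  let R : Submodule ℝ (g →ₗ[ℝ] g →ₗ[ℝ] g) :=
    (B2 g).map (LieModule.Cohomology.twoCochain ℝ g g).subtype
  obtain ⟨W, hW⟩ := R.exists_isCompl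
  let Y : Submodule ℝ (Fin n → Fin n → Fin n → ℝ) := W.comap τ.toLinearMap
  -- The kernel of the linearized equations consists of cocycles, which are coboundaries by
  -- hypothesis and so meet the complement only in zero. Injectivity in finite dimension gives a
  -- lower bound with constant `K`.
  obtain ⟨K, hK, hanti⟩ := LinearMap.exists_antilipschitzWith
    (linearizedEquations (lawOfBasis b).1 ∘ₗ Y.subtype) (by
      rw [LinearMap.ker_eq_bot']
      rintro ⟨w, hw⟩ hD
      obtain ⟨a, ha, haw⟩ := mem_twoCocycle_of_linearizedEquations b hD
      have hwR : τ w ∈ R := ⟨a, h a ha, haw⟩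
      have := hW.disjoint.le_bot ⟨hwR, hw⟩
      rw [Submodule.mem_bot, LinearEquiv.map_eq_zero_iff] at this
      exact Subtype.ext this)
  -- Parameters that are invertible and so close to the base point that the quadratic error is
  -- beaten by the linear lower bound.
  let U : Set ((Fin n → Fin n → ℝ) × Y) :=
    {p | LinearMap.det (ε p.1) ≠ 0 ∧ K * (n * 3 * ‖p.2‖) < 1}
  have hU : U ∈ 𝓝 ((ε.symm LinearMap.id, 0) : (Fin n → Fin n → ℝ) × Y) := by
    refine IsOpen.mem_nhds (IsOpen.inter ?_ ?_) ⟨?_, ?_⟩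
    · have hc : Continuous fun p : (Fin n → Fin n → ℝ) × Y => LinearMap.det (ε p.1) := by
        simp only [ε, det_endEquiv]
        exact Continuous.matrix_det continuous_fst
      exact isOpen_ne_fun hc continuous_const
    · exact isOpen_lt (f := fun p : (Fin n → Fin n → ℝ) × Y => (K : ℝ) * (n * 3 * ‖p.2‖))
        (by fun_prop) continuous_const
    · simp
    · simp
  have key := eventually_exists_transport push left right Y.subtypeL (lawOfBasis b).1
    (ε.symm LinearMap.id)
    (fun m => τ.injective (by ext; simp [hpush])) (fun m => τ.injective (by ext; simp [hleft]))
    (fun m => τ.injective (by ext; simp [hright])) (fun z => by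
      obtain ⟨_, ⟨_, ⟨φ, rfl⟩, rfl⟩, w, hw, hsum⟩ := Submodule.mem_sup.1
        (by rw [hW.sup_eq_top]; trivial : τ z ∈ R ⊔ W)
      -- The infinitesimal action of `φ` on the bracket is minus its coboundary, hence the sign.
      refine ⟨ε.symm (-φ), ⟨τ.symm w, by simpa [Y] using hw⟩, τ.injective ?_⟩
      rw [← hsum]
      ext x y
      simp [hpush, hleft, hright, hμ₀]
      rw [← lie_skew y]
      abel) hU
  filter_upwards [continuous_subtype_val.continuousAt key] with C hC
  obtain ⟨⟨P, w⟩, ⟨hdet, hsmall⟩, hPw⟩ := hC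
  let e : g ≃ₗ[ℝ] g := LinearEquiv.ofIsUnitDet (f := ε P) (v := b) (v' := b) (by
    rw [LinearMap.det_toMatrix]; exact hdet.isUnit)
  have he : ∀ x, e x = ε P x := fun x => rfl
  have hrel : ∀ x y, e (τ C.1 x y) = τ ((lawOfBasis b).1 + w.1) (e x) (e y) := fun x y => by
    have := congrArg (fun μ => τ μ x y) hPw
    simp only [hpush, hright, hleft] at this
    exact this
  have hrel' : ∀ x y, τ ((lawOfBasis b).1 + w.1) x y = e (τ C.1 (e.symm x) (e.symm y)) :=
    fun x y => by rw [hrel]; simp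
  have hmem : (lawOfBasis b).1 + w.1 ∈ lieVariety n := by
    have hC := (mem_lieVariety_iff b C.1).1 C.2
    refine (mem_lieVariety_iff b _).2 ⟨fun x y => ?_, fun x y z => ?_⟩
    · rw [hrel', hrel', ← map_neg]
      exact congrArg e (hC.1 _ _)
    · rw [hrel', hrel', hrel', hrel', hrel', hrel', e.symm_apply_apply, e.symm_apply_apply,
        e.symm_apply_apply, ← map_add, ← map_add]
      exact (congrArg e (hC.2 _ _ _)).trans (map_zero e)
  -- Both bounds together give `‖w‖ ≤ 3nK‖w‖²`, while `3nK‖w‖ < 1` on `U`.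
  have hw : w = 0 := by
    have h1 := norm_linearizedEquations_le (lawOfBasis b).2 hmem
    have h2 := hanti.le_mul_dist w 0
    simp only [dist_zero_right, map_zero, LinearMap.comp_apply, Submodule.subtype_apply] at h2
    by_contra hne
    have hpos : 0 < ‖w‖ := norm_pos_iff.2 hne
    have h3 : ‖w‖ ≤ K * (n * 3 * ‖w‖) * ‖w‖ := by
      calc ‖w‖ ≤ K * (n * 3 * ‖w‖ * ‖w‖) := h2.trans (by gcongr; exact h1)
        _ = _ := by ring
    nlinarith
  refine ⟨b.map e, fun i j k => ?_⟩
  have h1 : e.symm ⁅e (b i), e (b j)⁆ = τ C.1 (b i) (b j) := by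
    rw [LinearEquiv.symm_apply_eq, hrel, hw, Submodule.coe_zero, add_zero, hμ₀]
  rw [Basis.map_repr, LinearEquiv.trans_apply, Basis.map_apply, Basis.map_apply, h1]
  exact (repr_bilinEquiv_basis b C.1 i j k).symm

/-- A Lie algebra with `H²(g, g) = 0` is stable. -/
theorem isStable_of_subsingleton_H2 (h : Subsingleton (H2 g)) : IsStable g :=
  isOpen_iff_mem_nhds.2 fun _ hC₀ => orbitIn_mem_nhds h hC₀

end Rigidity
end LowDimLie

namespace LowDimLie

open Filter Topology Module

/-! ### Reduction of 2-cocycles to weight zero -/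

section Weights

variable {g : Type*} [LieRing g] [LieAlgebra ℝ g] {n : ℕ}

open LieModule.Cohomology

/-- The differential commutes with the action of `h` on cochains. -/
theorem d₁₂_lie_comm (h : g) (f : g →ₗ[ℝ] g) (x y : g) :
    d₁₂ ℝ g g ((LieModule.toEnd ℝ g g h) ∘ₗ f - f ∘ₗ (LieModule.toEnd ℝ g g h)) x y =
      ⁅h, d₁₂ ℝ g g f x y⁆ - d₁₂ ℝ g g f ⁅h, x⁆ y - d₁₂ ℝ g g f x ⁅h, y⁆ := by
  simp only [d₁₂_apply_apply, LinearMap.sub_apply, LinearMap.comp_apply,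
    LieModule.toEnd_apply_apply, lie_sub, leibniz_lie h x, leibniz_lie h y]
  rw [map_add]
  abel

/-- Up to a coboundary, a 2-cocycle has weight zero with respect to an element that acts
diagonally. -/
theorem exists_weight_zero (b : Basis (Fin n) ℝ g) (h : g) (w : Fin n → ℝ)
    (hw : ∀ i, ⁅h, b i⁆ = w i • b i) {a : twoCochain ℝ g g} (ha : a ∈ twoCocycle ℝ g g) :
    ∃ f, ∀ i j k, w i + w j ≠ w k → b.repr ((a + d₁₂ ℝ g g f) (b i) (b j)) k = 0 := by
  have hrepr : ∀ x k, b.repr ⁅h, x⁆ k = w k * b.repr x k := fun x k => by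
    conv_lhs => rw [← b.sum_repr x, lie_sum, map_sum]
    simp [hw, Finsupp.single_apply, mul_comm]
  let F : g →ₗ[ℝ] g := a h
  -- This inverts the commutator with `ad h` on the entries of nonzero weight. Where the weights
  -- agree, division by zero gives the entry 0, and what is left of `F` commutes with `ad h`.
  let f : g →ₗ[ℝ] g := b.constr ℝ fun j => ∑ k, (b.repr (F (b j)) k / (w k - w j)) • b k
  have hf : ∀ j k, b.repr (f (b j)) k = b.repr (F (b j)) k / (w k - w j) := fun j k => by
    simp only [f, Basis.constr_basis]
    simp [Finsupp.single_apply]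
  let A := LieModule.toEnd ℝ g g h
  let F₀ : g →ₗ[ℝ] g := F - (A ∘ₗ f - f ∘ₗ A)
  have hcomm : A ∘ₗ F₀ - F₀ ∘ₗ A = 0 := by
    refine b.ext fun j => b.repr.injective (Finsupp.ext fun k => ?_)
    simp only [F₀, A, LinearMap.sub_apply, LinearMap.comp_apply, LieModule.toEnd_apply_apply, hw,
      map_sub, map_smul, Finsupp.sub_apply, hrepr, Finsupp.smul_apply, hf, smul_eq_mul,
      LinearMap.zero_apply, map_zero, Finsupp.zero_apply]
    by_cases hkj : w k - w j = 0
    · rw [hkj, sub_eq_zero.1 hkj]; ring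
    · field_simp; ring
  have hweight : ∀ (φ : g →ₗ[ℝ] g) (i j k : Fin n),
      b.repr (d₁₂ ℝ g g (A ∘ₗ φ - φ ∘ₗ A) (b i) (b j)) k =
        (w k - w i - w j) * b.repr (d₁₂ ℝ g g φ (b i) (b j)) k := fun φ i j k => by
    rw [d₁₂_lie_comm, hw, hw]
    simp only [map_sub, map_smul, Finsupp.sub_apply, hrepr, LinearMap.smul_apply,
      Finsupp.smul_apply, smul_eq_mul]
    ring
  refine ⟨(-1 : ℝ) • f, fun i j k hne => ?_⟩
  have hl : w k - w i - w j ≠ 0 := fun h0 => hne (by linarith)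
  have h₀ : b.repr (d₁₂ ℝ g g F₀ (b i) (b j)) k = 0 := by
    have := hweight F₀ i j k
    have hz : (0 : twoCochain ℝ g g) (b i) (b j) = 0 := rfl
    rw [hcomm, map_zero, hz, map_zero, Finsupp.zero_apply] at this
    exact (mul_eq_zero.1 this.symm).resolve_left hl
  have hcocycle : d₂₃ ℝ g g a h (b i) (b j) = 0 := by
    rw [(mem_twoCocycle_iff ℝ g g a).1 ha]; rfl
  -- Cartan's homotopy formula: for a cocycle, the differential of its contraction with `h` is the
  -- action of `h` on it. Off weight zero, that action is multiplication by the nonzero number `w k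
  -- - w i - w j`.
  have hcartan : d₁₂ ℝ g g F (b i) (b j) =
      ⁅h, a (b i) (b j)⁆ - a ⁅h, b i⁆ (b j) + a ⁅h, b j⁆ (b i) := by
    rw [d₂₃_apply, ← twoCochain_skew a h ⁅b i, b j⁆] at hcocycle
    rw [d₁₂_apply_apply, ← sub_eq_zero, ← neg_eq_zero, ← hcocycle]
    simp only [F]
    abel
  have hF : b.repr (d₁₂ ℝ g g F (b i) (b j)) k =
      (w k - w i - w j) * b.repr (a (b i) (b j)) k := by
    rw [hcartan, hw, hw, map_smul, map_smul, LinearMap.smul_apply, LinearMap.smul_apply,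
      ← twoCochain_skew a (b i) (b j)]
    simp only [map_sub, map_add, map_smul, map_neg, Finsupp.sub_apply, Finsupp.add_apply, hrepr,
      Finsupp.smul_apply, Finsupp.neg_apply, smul_eq_mul]
    ring
  have hsplit : d₁₂ ℝ g g F = d₁₂ ℝ g g F₀ + d₁₂ ℝ g g (A ∘ₗ f - f ∘ₗ A) := by
    rw [← map_add]; congr 1; simp [F₀]
  rw [hsplit, add_apply_apply, map_add, Finsupp.add_apply, h₀, zero_add, hweight] at hF
  have := mul_left_cancel₀ hl hF
  rw [map_smul, add_apply_apply, smul_apply_apply, map_add, map_smul, Finsupp.add_apply,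
    Finsupp.smul_apply, this]
  simp

/-- For the vanishing of `H²(g, g)`, only cocycles of weight zero matter. -/
theorem subsingleton_H2_of_weight_zero (b : Basis (Fin n) ℝ g) (h : g) (w : Fin n → ℝ)
    (hw : ∀ i, ⁅h, b i⁆ = w i • b i)
    (H : ∀ ψ ∈ twoCocycle ℝ g g,
      (∀ i j k, w i + w j ≠ w k → b.repr (ψ (b i) (b j)) k = 0) → ∃ f, d₁₂ ℝ g g f = ψ) :
    Subsingleton (H2 g) := by
  rw [subsingleton_H2_iff]
  intro a ha
  obtain ⟨f, hf⟩ := exists_weight_zero b h w hw ha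
  have hd : d₂₃ ℝ g g (a + d₁₂ ℝ g g f) = 0 := by
    have h₂ : d₂₃ ℝ g g (d₁₂ ℝ g g f) = 0 := LinearMap.congr_fun (d₂₃_comp_d₁₂ ℝ g g) f
    rw [map_add, h₂, (mem_twoCocycle_iff ℝ g g a).1 ha, add_zero]
  obtain ⟨f', hf'⟩ := H _ ((mem_twoCocycle_iff ℝ g g _).2 hd) hf
  refine ⟨f' + (-1 : ℝ) • f, ?_⟩
  rw [map_add, map_smul, hf']
  refine DFunLike.ext _ _ fun x => LinearMap.ext fun y => ?_
  rw [add_apply_apply, add_apply_apply, smul_apply_apply, neg_one_smul, add_neg_cancel_right]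

end Weights
end LowDimLie
namespace LowDimLie
open Filter Topology Module LieModule.Cohomology

/-! ### The cohomology of `L_{6,2}` and `L_{6,3}` -/

/-- The coordinates on the Lie algebra of a law. -/
noncomputable def OfLaw.coord {n : ℕ} {C : lieVariety n} (k : Fin n) : OfLaw C →ₗ[ℝ] ℝ :=
  (OfLaw.basis C).coord k

theorem OfLaw.coord_basis {n : ℕ} (C : lieVariety n) (i k : Fin n) :
    OfLaw.coord k (OfLaw.basis C i) = if i = k then 1 else 0 := by
  rw [OfLaw.coord, Basis.coord_apply, Basis.repr_self, Finsupp.single_apply]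

theorem OfLaw.ext_coord {n : ℕ} {C : lieVariety n} {x y : OfLaw C}
    (h : ∀ k, OfLaw.coord k x = OfLaw.coord k y) : x = y :=
  (OfLaw.basis C).ext_elem h

theorem OfLaw.coord_lie {n : ℕ} {C : lieVariety n} (x y : OfLaw C) (k : Fin n) :
    OfLaw.coord k ⁅x, y⁆ = ∑ i, ∑ j, OfLaw.coord i x * OfLaw.coord j y * C.1 i j k := rfl

theorem realLaw_apply {n : ℕ} (c : Fin n → Fin n → Fin n → ℤ) (h₁ h₂) (i j k : Fin n) :
    (realLaw c h₁ h₂).1 i j k = (c i j k : ℝ) := rfl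

/-- The weights of `X₁` on the basis in `L_{6,2}` and `L_{6,3}`. -/
def weights : Fin 6 → ℤ := ![0, 2, -2, 1, -1, 0]

/-- Exactly sixteen triples `i < j`, `k` satisfy `weights i + weights j = weights k`; `aijk` is the
coefficient of the basis vector `k` in the value at `i, j`, with indices starting at 0. -/
theorem coord_weightZero {C : lieVariety 6} (ψ : twoCochain ℝ (OfLaw C) (OfLaw C))
    (hψ : ∀ i j k, (weights i : ℝ) + weights j ≠ weights k →
      (OfLaw.basis C).repr (ψ (OfLaw.basis C i) (OfLaw.basis C j)) k = 0) :
    ∃ a011 a022 a033 a044 a050 a055 a120 a125 a143 a151 a234 a252 a340 a345 a353 a454 : ℝ,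
      ∀ (x y : OfLaw C) (k : Fin 6), OfLaw.coord k (ψ x y) = ![
        (OfLaw.coord 0 x * OfLaw.coord 5 y - OfLaw.coord 5 x * OfLaw.coord 0 y) * a050 + (OfLaw.coord 1 x * OfLaw.coord 2 y - OfLaw.coord 2 x * OfLaw.coord 1 y) * a120 +
          (OfLaw.coord 3 x * OfLaw.coord 4 y - OfLaw.coord 4 x * OfLaw.coord 3 y) * a340,
        (OfLaw.coord 0 x * OfLaw.coord 1 y - OfLaw.coord 1 x * OfLaw.coord 0 y) * a011 + (OfLaw.coord 1 x * OfLaw.coord 5 y - OfLaw.coord 5 x * OfLaw.coord 1 y) * a151,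
        (OfLaw.coord 0 x * OfLaw.coord 2 y - OfLaw.coord 2 x * OfLaw.coord 0 y) * a022 + (OfLaw.coord 2 x * OfLaw.coord 5 y - OfLaw.coord 5 x * OfLaw.coord 2 y) * a252,
        (OfLaw.coord 0 x * OfLaw.coord 3 y - OfLaw.coord 3 x * OfLaw.coord 0 y) * a033 + (OfLaw.coord 1 x * OfLaw.coord 4 y - OfLaw.coord 4 x * OfLaw.coord 1 y) * a143 +
          (OfLaw.coord 3 x * OfLaw.coord 5 y - OfLaw.coord 5 x * OfLaw.coord 3 y) * a353,
        (OfLaw.coord 0 x * OfLaw.coord 4 y - OfLaw.coord 4 x * OfLaw.coord 0 y) * a044 + (OfLaw.coord 2 x * OfLaw.coord 3 y - OfLaw.coord 3 x * OfLaw.coord 2 y) * a234 +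
          (OfLaw.coord 4 x * OfLaw.coord 5 y - OfLaw.coord 5 x * OfLaw.coord 4 y) * a454,
        (OfLaw.coord 0 x * OfLaw.coord 5 y - OfLaw.coord 5 x * OfLaw.coord 0 y) * a055 + (OfLaw.coord 1 x * OfLaw.coord 2 y - OfLaw.coord 2 x * OfLaw.coord 1 y) * a125 +
          (OfLaw.coord 3 x * OfLaw.coord 4 y - OfLaw.coord 4 x * OfLaw.coord 3 y) * a345] k := by
  let e := OfLaw.basis C
  let A : Fin 6 → Fin 6 → Fin 6 → ℝ := fun i j k => OfLaw.coord k (ψ (e i) (e j))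
  have hz : ∀ i j k, ¬ weights i + weights j = weights k → A i j k = 0 := fun i j k h =>
    hψ i j k (by exact_mod_cast h)
  have hs : ∀ i j k, A i j k = -A j i k := fun i j k => by
    simp only [A]
    rw [← twoCochain_skew ψ (e j) (e i), map_neg]
  have hd : ∀ i k, A i i k = 0 := fun i k => by linarith [hs i i k]
  have hA : ∀ (x y : OfLaw C) k, OfLaw.coord k (ψ x y) =
      ∑ i, ∑ j, OfLaw.coord i x * OfLaw.coord j y * A i j k := fun x y k => by
    have h : ∀ z : OfLaw C, z = ∑ i, OfLaw.coord i z • e i := fun z => (e.sum_repr z).symm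
    conv_lhs => rw [h x, h y]
    simp only [map_sum, map_smul, LinearMap.sum_apply, LinearMap.smul_apply, smul_eq_mul,
      Finset.mul_sum]
    rw [Finset.sum_comm]
    refine Finset.sum_congr rfl fun i _ => Finset.sum_congr rfl fun j _ => ?_
    simp only [A]
    ring
  refine ⟨A 0 1 1, A 0 2 2, A 0 3 3, A 0 4 4, A 0 5 0, A 0 5 5, A 1 2 0, A 1 2 5, A 1 4 3, A 1 5 1,
    A 2 3 4, A 2 5 2, A 3 4 0, A 3 4 5, A 3 5 3, A 4 5 4, fun x y k => ?_⟩
  rw [hA]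
  fin_cases k <;>
    simp [Fin.sum_univ_six, hz, hd, weights, hs 5 0, hs 2 1, hs 4 3, hs 1 0, hs 5 1, hs 2 0, hs 5 2,
      hs 3 0, hs 4 1, hs 5 3, hs 4 0, hs 3 2, hs 5 4] <;> ring

theorem L62.coord_lie (x y : L62) (k : Fin 6) : OfLaw.coord k ⁅x, y⁆ =
    ![OfLaw.coord 1 x * OfLaw.coord 2 y - OfLaw.coord 2 x * OfLaw.coord 1 y, 2 * (OfLaw.coord 0 x * OfLaw.coord 1 y - OfLaw.coord 1 x * OfLaw.coord 0 y),
    2 * (OfLaw.coord 2 x * OfLaw.coord 0 y - OfLaw.coord 0 x * OfLaw.coord 2 y), OfLaw.coord 0 x * OfLaw.coord 3 y - OfLaw.coord 3 x * OfLaw.coord 0 y + OfLaw.coord 1 x * OfLaw.coord 4 y - OfLaw.coord 4 x * OfLaw.coord 1 y,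
    OfLaw.coord 2 x * OfLaw.coord 3 y - OfLaw.coord 3 x * OfLaw.coord 2 y + OfLaw.coord 4 x * OfLaw.coord 0 y - OfLaw.coord 0 x * OfLaw.coord 4 y, OfLaw.coord 3 x * OfLaw.coord 4 y - OfLaw.coord 4 x * OfLaw.coord 3 y] k := by
  rw [OfLaw.coord_lie]
  fin_cases k <;> simp [Fin.sum_univ_six, realLaw_apply, c62, ofTable] <;> ring

theorem L63.coord_lie (x y : L63) (k : Fin 6) : OfLaw.coord k ⁅x, y⁆ =
    ![OfLaw.coord 1 x * OfLaw.coord 2 y - OfLaw.coord 2 x * OfLaw.coord 1 y, 2 * (OfLaw.coord 0 x * OfLaw.coord 1 y - OfLaw.coord 1 x * OfLaw.coord 0 y),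
    2 * (OfLaw.coord 2 x * OfLaw.coord 0 y - OfLaw.coord 0 x * OfLaw.coord 2 y),
    OfLaw.coord 0 x * OfLaw.coord 3 y - OfLaw.coord 3 x * OfLaw.coord 0 y + OfLaw.coord 1 x * OfLaw.coord 4 y - OfLaw.coord 4 x * OfLaw.coord 1 y + OfLaw.coord 3 x * OfLaw.coord 5 y - OfLaw.coord 5 x * OfLaw.coord 3 y,
    OfLaw.coord 2 x * OfLaw.coord 3 y - OfLaw.coord 3 x * OfLaw.coord 2 y + OfLaw.coord 4 x * OfLaw.coord 0 y - OfLaw.coord 0 x * OfLaw.coord 4 y + OfLaw.coord 4 x * OfLaw.coord 5 y - OfLaw.coord 5 x * OfLaw.coord 4 y, 0] k := by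
  rw [OfLaw.coord_lie]
  fin_cases k <;> simp [Fin.sum_univ_six, realLaw_apply, c63, ofTable] <;> ring

/-- The linear maps of weight zero. -/
noncomputable def weightZeroMap (C : lieVariety 6) (f00 f05 f11 f22 f33 f44 f50 f55 : ℝ) :
    OfLaw C →ₗ[ℝ] OfLaw C :=
  (OfLaw.basis C).constr ℝ ![f00 • OfLaw.basis C 0 + f05 • OfLaw.basis C 5, f11 • OfLaw.basis C 1,
    f22 • OfLaw.basis C 2, f33 • OfLaw.basis C 3, f44 • OfLaw.basis C 4,
    f50 • OfLaw.basis C 0 + f55 • OfLaw.basis C 5]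

theorem coord_weightZeroMap {C : lieVariety 6} (f00 f05 f11 f22 f33 f44 f50 f55 : ℝ)
    (x : OfLaw C) (k : Fin 6) :
    OfLaw.coord k (weightZeroMap C f00 f05 f11 f22 f33 f44 f50 f55 x) =
      ![f00 * OfLaw.coord 0 x + f50 * OfLaw.coord 5 x, f11 * OfLaw.coord 1 x, f22 * OfLaw.coord 2 x, f33 * OfLaw.coord 3 x, f44 * OfLaw.coord 4 x,
        f05 * OfLaw.coord 0 x + f55 * OfLaw.coord 5 x] k := by
  rw [weightZeroMap, Basis.constr_apply_fintype, Fin.sum_univ_six]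
  fin_cases k <;> simp [OfLaw.basis_repr, OfLaw.coord] <;> ring

/-- In weight zero the cocycles form a space of dimension at most six, and the coboundary of an
explicit weight-zero map realizes every choice of the six parameters. -/
theorem subsingleton_H2_L62 : Subsingleton (H2 L62) := by
  refine subsingleton_H2_of_weight_zero (OfLaw.basis _) (OfLaw.basis _ 0) (fun i => weights i)
    (fun i => OfLaw.ext_coord fun k => ?_) fun ψ hψ hw => ?_
  · rw [L62.coord_lie, map_smul]
    fin_cases i <;> fin_cases k <;> simp [OfLaw.coord_basis, weights]
  obtain ⟨a011, a022, a033, a044, a050, a055, a120, a125, a143, a151, a234, a252, a340, a345, a353,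
    a454, h⟩ := coord_weightZero ψ hw
  have hJ : ∀ i j k l : Fin 6, OfLaw.coord l
      (d₂₃ ℝ L62 L62 ψ (OfLaw.basis _ i) (OfLaw.basis _ j) (OfLaw.basis _ k)) = 0 :=
    fun i j k l => by
      rw [(mem_twoCocycle_iff ℝ _ _ ψ).1 hψ]
      exact map_zero _
  simp only [d₂₃_apply, map_sub, map_add, h, L62.coord_lie] at hJ
  -- The digits are the three arguments of the cocycle identity and the coordinate taken. These ten
  -- equations suffice to eliminate ten of the sixteen coefficients.
  have h0120 := hJ 0 1 2 0
  have h0143 := hJ 0 1 4 3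
  have h0151 := hJ 0 1 5 1
  have h0345 := hJ 0 3 4 5
  have h1233 := hJ 1 2 3 3
  have h1250 := hJ 1 2 5 0
  have h1255 := hJ 1 2 5 5
  have h1341 := hJ 1 3 4 1
  have h1453 := hJ 1 4 5 3
  have h3455 := hJ 3 4 5 5
  clear hJ
  simp [OfLaw.coord_basis] at h0120 h0143 h0151 h0345 h1233 h1250 h1255 h1341 h1453 h3455
  obtain rfl : a050 = 0 := by linarith
  obtain rfl : a055 = 0 := by linarith
  obtain rfl : a022 = -a011 := by linarith
  obtain rfl : a033 = a011 / 2 := by linarith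
  obtain rfl : a044 = -(a011 / 2) := by linarith
  obtain rfl : a234 = a120 + a011 / 2 - a143 := by linarith
  obtain rfl : a252 = -a151 := by linarith
  obtain rfl : a340 = a151 / 2 := by linarith
  obtain rfl : a353 = a151 / 2 := by linarith
  obtain rfl : a454 = -(a151 / 2) := by linarith
  -- The entries on `X₄` and `X₅` can be normalized to 0 by adding derivations: `ad X₁`, and the one
  -- that is 0 on the Levi factor, 1 on `X₄`, `X₅` and 2 on `X₆`.
  refine ⟨weightZeroMap _ (a011 / 2) (-a125) a143 (a120 + a011 / 2 - a143) 0 0 (-a151 / 2) (-a345), ?_⟩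
  refine DFunLike.ext _ _ fun x => LinearMap.ext fun y => OfLaw.ext_coord fun k => ?_
  rw [h, d₁₂_apply_apply, map_sub, map_sub, L62.coord_lie, L62.coord_lie, coord_weightZeroMap]
  simp only [coord_weightZeroMap, L62.coord_lie]
  fin_cases k <;> simp <;> ring

theorem subsingleton_H2_L63 : Subsingleton (H2 L63) := by
  refine subsingleton_H2_of_weight_zero (OfLaw.basis _) (OfLaw.basis _ 0) (fun i => weights i)
    (fun i => OfLaw.ext_coord fun k => ?_) fun ψ hψ hw => ?_
  · rw [L63.coord_lie, map_smul]
    fin_cases i <;> fin_cases k <;> simp [OfLaw.coord_basis, weights]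
  obtain ⟨a011, a022, a033, a044, a050, a055, a120, a125, a143, a151, a234, a252, a340, a345, a353,
    a454, h⟩ := coord_weightZero ψ hw
  have hJ : ∀ i j k l : Fin 6, OfLaw.coord l
      (d₂₃ ℝ L63 L63 ψ (OfLaw.basis _ i) (OfLaw.basis _ j) (OfLaw.basis _ k)) = 0 :=
    fun i j k l => by
      rw [(mem_twoCocycle_iff ℝ _ _ ψ).1 hψ]
      exact map_zero _
  simp only [d₂₃_apply, map_sub, map_add, h, L63.coord_lie] at hJ
  have h0120 := hJ 0 1 2 0
  have h0143 := hJ 0 1 4 3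
  have h0151 := hJ 0 1 5 1
  have h1233 := hJ 1 2 3 3
  have h1244 := hJ 1 2 4 4
  have h1250 := hJ 1 2 5 0
  have h1255 := hJ 1 2 5 5
  have h1341 := hJ 1 3 4 1
  have h1453 := hJ 1 4 5 3
  have h3455 := hJ 3 4 5 5
  clear hJ
  simp [OfLaw.coord_basis] at h0120 h0143 h0151 h1233 h1244 h1250 h1255 h1341 h1453 h3455
  obtain rfl : a050 = 0 := by linarith
  obtain rfl : a055 = 0 := by linarith
  obtain rfl : a022 = -a011 := by linarith
  obtain rfl : a033 = a011 / 2 + a125 := by linarith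
  obtain rfl : a044 = a125 - a011 / 2 := by linarith
  obtain rfl : a234 = a120 + a011 / 2 - a143 := by linarith
  obtain rfl : a252 = -a151 := by linarith
  obtain rfl : a340 = 0 := by linarith
  obtain rfl : a345 = 0 := by linarith
  obtain rfl : a454 = a353 - a151 := by linarith
  -- Here the derivations `ad X₁` and `ad X₆` allow the normalization to 0 on `X₄` and `X₅`.
  refine ⟨weightZeroMap _ (a011 / 2) (-a125) a143 (a120 + a011 / 2 - a143) 0 0 (-a151 / 2)
    (a353 - a151 / 2), ?_⟩
  refine DFunLike.ext _ _ fun x => LinearMap.ext fun y => OfLaw.ext_coord fun k => ?_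
  rw [h, d₁₂_apply_apply, map_sub, map_sub, L63.coord_lie, L63.coord_lie, coord_weightZeroMap]
  simp only [coord_weightZeroMap, L63.coord_lie]
  fin_cases k <;> simp <;> ring

end LowDimLie

namespace LowDimLie

open Filter Topology Module

/-! ### Matrix realizations -/

/-- The element of the Lie algebra of a law with given coordinates. -/
def OfLaw.ofCoords {n : ℕ} (C : lieVariety n) (v : Fin n → ℝ) : OfLaw C := v

theorem OfLaw.coord_ofCoords {n : ℕ} (C : lieVariety n) (v : Fin n → ℝ) (k : Fin n) :
    OfLaw.coord k (OfLaw.ofCoords C v) = v k := rfl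

/-- The law with entries `σ` for the brackets of the last three basis elements: it is the law of
`𝔰𝔬(4)` for `σ = 1`, and that of `𝔰𝔬(3,1)` for `σ = -1`. -/
def rotationTable (σ : ℤ) : Fin 6 → Fin 6 → Fin 6 → ℤ :=
  ofTable 6 [(2, 3, 1, 1), (1, 2, 3, 1), (1, 3, 2, -1), (1, 5, 6, 1), (1, 6, 5, -1),
    (2, 4, 6, -1), (2, 6, 4, 1), (3, 4, 5, 1), (3, 5, 4, -1), (5, 6, 1, σ), (4, 5, 3, σ),
    (4, 6, 2, -σ)]

/-- The law with entries `σ` for the brackets of the last three basis elements: it is the law of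
`𝔰𝔬(2,2)` for `σ = 1`, and that of `𝔰𝔬(3,1)` for `σ = -1`. -/
def slTable (σ : ℤ) : Fin 6 → Fin 6 → Fin 6 → ℤ :=
  ofTable 6 [(1, 2, 2, 2), (1, 3, 3, -2), (2, 3, 1, 1), (1, 4, 4, 2), (1, 6, 6, -2),
    (2, 5, 4, 2), (2, 6, 5, 1), (3, 4, 5, 1), (3, 5, 6, 2), (4, 5, 2, 2 * σ), (4, 6, 1, -σ),
    (5, 6, 3, -(2 * σ))]

/-- The bracket of `rotationTable σ` in coordinates. -/
def rotationBracket (σ : ℝ) (a b : Fin 6 → ℝ) : Fin 6 → ℝ :=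
  ![a 1 * b 2 - a 2 * b 1 + σ * (a 4 * b 5 - a 5 * b 4),
    a 2 * b 0 - a 0 * b 2 + σ * (a 5 * b 3 - a 3 * b 5),
    a 0 * b 1 - a 1 * b 0 + σ * (a 3 * b 4 - a 4 * b 3),
    a 1 * b 5 - a 2 * b 4 + a 4 * b 2 - a 5 * b 1,
    a 2 * b 3 - a 0 * b 5 + a 5 * b 0 - a 3 * b 2,
    a 0 * b 4 - a 1 * b 3 + a 3 * b 1 - a 4 * b 0]

/-- The bracket of `slTable σ` in coordinates. -/
def slBracket (σ : ℝ) (a b : Fin 6 → ℝ) : Fin 6 → ℝ :=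
  ![a 1 * b 2 - a 2 * b 1 - σ * (a 3 * b 5 - a 5 * b 3),
    2 * (a 0 * b 1 - a 1 * b 0) + 2 * σ * (a 3 * b 4 - a 4 * b 3),
    2 * (a 2 * b 0 - a 0 * b 2) + 2 * σ * (a 5 * b 4 - a 4 * b 5),
    2 * (a 0 * b 3 - a 3 * b 0) + 2 * (a 1 * b 4 - a 4 * b 1),
    a 1 * b 5 - a 5 * b 1 + a 2 * b 3 - a 3 * b 2,
    2 * (a 5 * b 0 - a 0 * b 5) + 2 * (a 2 * b 4 - a 4 * b 2)]

theorem coord_lie_rotationTable {σ : ℤ} {h₁ h₂} (x y : OfLaw (realLaw (rotationTable σ) h₁ h₂))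
    (k : Fin 6) : OfLaw.coord k ⁅x, y⁆ =
      rotationBracket σ (fun i => OfLaw.coord i x) (fun i => OfLaw.coord i y) k := by
  rw [OfLaw.coord_lie]
  fin_cases k <;> simp [Fin.sum_univ_six, realLaw_apply, rotationBracket, rotationTable, ofTable] <;> ring

theorem coord_lie_slTable {σ : ℤ} {h₁ h₂} (x y : OfLaw (realLaw (slTable σ) h₁ h₂))
    (k : Fin 6) : OfLaw.coord k ⁅x, y⁆ =
      slBracket σ (fun i => OfLaw.coord i x) (fun i => OfLaw.coord i y) k := by
  rw [OfLaw.coord_lie]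
  fin_cases k <;> simp [Fin.sum_univ_six, realLaw_apply, slBracket, slTable, ofTable] <;> ring

theorem L61.coord_lie (x y : L61)
    (k : Fin 6) : OfLaw.coord k ⁅x, y⁆ =
      rotationBracket 0 (fun i => OfLaw.coord i x) (fun i => OfLaw.coord i y) k := by
  rw [OfLaw.coord_lie]
  fin_cases k <;> simp [Fin.sum_univ_six, realLaw_apply, rotationBracket, c61, ofTable] <;> ring

theorem L64.coord_lie (x y : L64)
    (k : Fin 6) : OfLaw.coord k ⁅x, y⁆ =
      slBracket 0 (fun i => OfLaw.coord i x) (fun i => OfLaw.coord i y) k := by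
  rw [OfLaw.coord_lie]
  fin_cases k <;> simp [Fin.sum_univ_six, realLaw_apply, slBracket, c64, ofTable] <;> ring

/-- The law of `𝔰𝔬(4)`. -/
abbrev so4Law : lieVariety 6 :=
  realLaw (rotationTable 1) (by decide +kernel) (by decide +kernel)

/-- The law of `𝔰𝔬(3,1)` in a basis adapted to the subalgebra `𝔰𝔬(3)`. -/
abbrev so31Law : lieVariety 6 :=
  realLaw (rotationTable (-1)) (by decide +kernel) (by decide +kernel)

/-- The law of `𝔰𝔬(2,2)` in a basis adapted to the subalgebra `𝔰𝔬(2,1) ≅ 𝔰𝔩(2,ℝ)`. -/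
abbrev so22Law : lieVariety 6 :=
  realLaw (slTable 1) (by decide +kernel) (by decide +kernel)

/-- The law of `𝔰𝔬(3,1)` in a basis adapted to the subalgebra `𝔰𝔬(2,1) ≅ 𝔰𝔩(2,ℝ)`. -/
abbrev so31Law' : lieVariety 6 :=
  realLaw (slTable (-1)) (by decide +kernel) (by decide +kernel)

/-- Scaling the basis vector `i` by `t ^ (-w i)` multiplies `c i j k` by `t ^ (w k - w i - w j)`:
terms of exact degree survive and terms of lower target degree vanish in the limit. For concrete
integral laws the condition is decidable. -/
theorem isContraction_of_degrees {n : ℕ} {c d : Fin n → Fin n → Fin n → ℤ} {h₁ h₂ h₃ h₄}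
    (w : Fin n → ℕ)
    (h : ∀ i j k, (c i j k = 0 ∧ d i j k = 0) ∨ (w k = w i + w j ∧ c i j k = d i j k) ∨
      (w k < w i + w j ∧ d i j k = 0)) :
    IsContraction (OfLaw (realLaw c h₁ h₂)) (OfLaw (realLaw d h₃ h₄)) := by
  refine isContraction_of_scaling _ _ w fun i j k => ?_
  rw [realLaw_apply, realLaw_apply]
  rcases h i j k with ⟨hc, hd⟩ | ⟨hw, hc⟩ | ⟨hw, hd⟩
  · simp [hc, hd]
  · rw [← hc]
    refine tendsto_const_nhds.congr' ?_
    filter_upwards [eventually_ne_atTop (0 : ℝ)] with t ht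
    rw [hw, pow_add]
    field_simp
  · obtain ⟨m, hm⟩ := Nat.exists_eq_add_of_lt hw
    have h0 : Tendsto (fun t : ℝ => (t ^ (m + 1))⁻¹ * (c i j k : ℝ)) atTop (𝓝 (0 * (c i j k : ℝ))) :=
      ((tendsto_pow_atTop (Nat.succ_ne_zero m)).inv_tendsto_atTop).mul_const _
    rw [hd, Int.cast_zero]
    rw [zero_mul] at h0
    refine h0.congr' ?_
    filter_upwards [eventually_ne_atTop (0 : ℝ)] with t ht
    have hp : t ^ w i * t ^ w j = t ^ w k * t ^ (m + 1) := by
      rw [← pow_add, ← pow_add, hm, add_assoc]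
    rw [mul_assoc (t ^ w k), ← mul_inv, hp]
    field_simp

/-- An Inönü–Wigner contraction: the first three basis vectors span a subalgebra and stay fixed,
while the brackets among the last three acquire the factor `t⁻²`. -/
theorem isContraction_so4Law : IsContraction (OfLaw so4Law) L61 :=
  isContraction_of_degrees ![0, 0, 0, 1, 1, 1] (by decide +kernel)

theorem isContraction_so31Law : IsContraction (OfLaw so31Law) L61 :=
  isContraction_of_degrees ![0, 0, 0, 1, 1, 1] (by decide +kernel)

theorem isContraction_so22Law : IsContraction (OfLaw so22Law) L64 :=
  isContraction_of_degrees ![0, 0, 0, 1, 1, 1] (by decide +kernel)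

theorem isContraction_so31Law' : IsContraction (OfLaw so31Law') L64 :=
  isContraction_of_degrees ![0, 0, 0, 1, 1, 1] (by decide +kernel)

end LowDimLie
-- Realizations by orthogonal and special linear matrices
namespace LowDimLie
open Filter Topology Module Matrix

section Orthogonal

attribute [local instance] LieRing.ofAssociativeRing LieAlgebra.ofAssociativeAlgebra

theorem mem_skewAdjoint_diagonal {n : Type*} [Fintype n] [DecidableEq n] {d : n → ℝ}
    {A : Matrix n n ℝ} : A ∈ skewAdjointMatricesLieSubalgebra (Matrix.diagonal d) ↔
      ∀ i j, A j i * d j = -(d i * A i j) := by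
  rw [mem_skewAdjointMatricesLieSubalgebra, mem_skewAdjointMatricesSubmodule,
    Matrix.IsSkewAdjoint, Matrix.IsAdjointPair, ← Matrix.ext_iff]
  simp [Matrix.mul_diagonal, Matrix.diagonal_mul]

/-- The Lie algebra of matrices that are skew-adjoint for a diagonal form. -/
abbrev SoDiag (d : Fin 4 → ℝ) : LieSubalgebra ℝ (Matrix (Fin 4) (Fin 4) ℝ) :=
  skewAdjointMatricesLieSubalgebra (Matrix.diagonal d)

/-- `𝔰𝔬(p,q)` in terms of a diagonal form on `ℝⁿ`. -/
theorem nonempty_soDiag_equiv {p q : ℕ} (e : Fin p ⊕ Fin q ≃ Fin 4)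
    {d : Fin 4 → ℝ} (hd : ∀ i, d (e i) = Sum.elim (fun _ => (1 : ℝ)) (fun _ => -1) i) :
    Nonempty (SoDiag d ≃ₗ⁅ℝ⁆ LieAlgebra.Orthogonal.so' (Fin p) (Fin q) ℝ) := by
  have h : Matrix.reindexAlgEquiv ℝ ℝ e (LieAlgebra.Orthogonal.indefiniteDiagonal _ _ ℝ) =
      Matrix.diagonal d := by
    ext i j
    obtain ⟨i, rfl⟩ := e.surjective i
    simp [LieAlgebra.Orthogonal.indefiniteDiagonal, Matrix.diagonal_apply, hd, Equiv.eq_symm_apply]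
  rw [SoDiag, ← h]
  exact ⟨(skewAdjointMatricesLieSubalgebraEquivTranspose _ (Matrix.reindexAlgEquiv ℝ ℝ e)
    fun A => rfl).symm⟩

/-- A matrix realization of a six-dimensional law with bracket `β` by skew-adjoint matrices. -/
noncomputable def equivSoDiag {C : lieVariety 6} {d : Fin 4 → ℝ}
    (β : (Fin 6 → ℝ) → (Fin 6 → ℝ) → Fin 6 → ℝ)
    (hβ : ∀ (x y : OfLaw C) k, OfLaw.coord k ⁅x, y⁆ =
      β (fun i => OfLaw.coord i x) (fun i => OfLaw.coord i y) k)
    (M : (Fin 6 → ℝ) → Matrix (Fin 4) (Fin 4) ℝ)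
    (N : Matrix (Fin 4) (Fin 4) ℝ → Fin 6 → ℝ)
    (hadd : ∀ a b, M (a + b) = M a + M b) (hsmul : ∀ (t : ℝ) a, M (t • a) = t • M a)
    (hM : ∀ a i j, M a j i * d j = -(d i * M a i j))
    (hl : ∀ a b, M (β a b) = M a * M b - M b * M a)
    (hN : ∀ a, N (M a) = a)
    (hMN : ∀ A : Matrix (Fin 4) (Fin 4) ℝ, (∀ i j, A j i * d j = -(d i * A i j)) →
      M (N A) = A) : OfLaw C ≃ₗ⁅ℝ⁆ SoDiag d where
  toFun x := ⟨M fun k => OfLaw.coord k x, mem_skewAdjoint_diagonal.2 (hM _)⟩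
  map_add' _ _ := Subtype.ext (hadd _ _)
  map_smul' _ _ := Subtype.ext (hsmul _ _)
  map_lie' {x y} := Subtype.ext ((congrArg M (funext fun k => hβ x y k)).trans (hl _ _))
  invFun A := OfLaw.ofCoords C (N A)
  left_inv _ := OfLaw.ext_coord fun k => congrFun (hN _) k
  right_inv A := Subtype.ext (hMN A (mem_skewAdjoint_diagonal.1 A.2))

/-- The first three coordinates are the rotations of the first three axes, the last three the
rotations that involve the fourth axis. -/
theorem nonempty_equiv_so4 : Nonempty (OfLaw so4Law ≃ₗ⁅ℝ⁆ SoDiag ![1, 1, 1, 1]) := by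
  refine ⟨equivSoDiag (rotationBracket (1 : ℤ)) (fun x y k => ?_)
    (fun a => !![0, -a 2, a 1, a 3; a 2, 0, -a 0, a 4; -a 1, a 0, 0, a 5; -a 3, -a 4, -a 5, 0])
    (fun A => ![A 2 1, A 0 2, A 1 0, A 0 3, A 1 3, A 2 3])
    (fun a b => ?_) (fun t a => ?_) (fun a i j => ?_) (fun a b => ?_) (fun a => ?_) (fun A hA => ?_)⟩
  · exact coord_lie_rotationTable x y k
  · ext i j; fin_cases i <;> fin_cases j <;> simp <;> ring
  · ext i j; fin_cases i <;> fin_cases j <;> simp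
  · fin_cases i <;> fin_cases j <;> simp
  · ext i j
    rw [Matrix.sub_apply, Matrix.mul_apply, Matrix.mul_apply, Fin.sum_univ_four,
      Fin.sum_univ_four]
    fin_cases i <;> fin_cases j <;> simp [rotationBracket] <;> ring
  · ext k; fin_cases k <;> simp
  · have h00 := hA 0 0
    have h11 := hA 1 1
    have h22 := hA 2 2
    have h33 := hA 3 3
    have h01 := hA 0 1
    have h02 := hA 0 2
    have h03 := hA 0 3
    have h12 := hA 1 2
    have h13 := hA 1 3
    have h23 := hA 2 3
    simp at h00 h11 h22 h33 h01 h02 h03 h12 h13 h23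
    ext i j; fin_cases i <;> fin_cases j <;> simp <;> linarith

/-- As in the compact case, with boosts, which are symmetric matrices, in place of the rotations
that involve the fourth axis. -/
theorem nonempty_equiv_so31 : Nonempty (OfLaw so31Law ≃ₗ⁅ℝ⁆ SoDiag ![1, 1, 1, -1]) := by
  refine ⟨equivSoDiag (rotationBracket (-1 : ℤ)) (fun x y k => ?_)
    (fun a => !![0, -a 2, a 1, a 3; a 2, 0, -a 0, a 4; -a 1, a 0, 0, a 5; a 3, a 4, a 5, 0])
    (fun A => ![A 2 1, A 0 2, A 1 0, A 0 3, A 1 3, A 2 3])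
    (fun a b => ?_) (fun t a => ?_) (fun a i j => ?_) (fun a b => ?_) (fun a => ?_) (fun A hA => ?_)⟩
  · exact coord_lie_rotationTable x y k
  · ext i j; fin_cases i <;> fin_cases j <;> simp <;> ring
  · ext i j; fin_cases i <;> fin_cases j <;> simp
  · fin_cases i <;> fin_cases j <;> simp
  · ext i j
    rw [Matrix.sub_apply, Matrix.mul_apply, Matrix.mul_apply, Fin.sum_univ_four,
      Fin.sum_univ_four]
    fin_cases i <;> fin_cases j <;> simp [rotationBracket] <;> ring
  · ext k; fin_cases k <;> simp
  · have h00 := hA 0 0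
    have h11 := hA 1 1
    have h22 := hA 2 2
    have h33 := hA 3 3
    have h01 := hA 0 1
    have h02 := hA 0 2
    have h03 := hA 0 3
    have h12 := hA 1 2
    have h13 := hA 1 3
    have h23 := hA 2 3
    simp at h00 h11 h22 h33 h01 h02 h03 h12 h13 h23
    ext i j; fin_cases i <;> fin_cases j <;> simp <;> linarith

set_option maxHeartbeats 1000000 in
theorem nonempty_equiv_so22 : Nonempty (OfLaw so22Law ≃ₗ⁅ℝ⁆ SoDiag ![1, 1, -1, -1]) := by
  refine ⟨equivSoDiag (slBracket (1 : ℤ)) (fun x y k => ?_)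
    -- The first three coordinates fix the first axis and give a copy of 𝔰𝔩(2,ℝ) acting on the other
    -- three. The boost `X₁` carries a factor 2, since its weights on this three-dimensional module
    -- are 2, 0, -2.
    (fun a => !![0, -a 3 - a 5, -(2 * a 4), a 3 - a 5; a 3 + a 5, 0, -a 1 - a 2, 2 * a 0;
      -(2 * a 4), -a 1 - a 2, 0, a 1 - a 2; a 3 - a 5, 2 * a 0, -a 1 + a 2, 0])
    (fun A => ![A 1 3 / 2, (A 2 3 - A 1 2) / 2, (-A 1 2 - A 2 3) / 2, (A 0 3 - A 0 1) / 2, -A 0 2 / 2, (-A 0 1 - A 0 3) / 2])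
    (fun a b => ?_) (fun t a => ?_) (fun a i j => ?_) (fun a b => ?_) (fun a => ?_) (fun A hA => ?_)⟩
  · exact coord_lie_slTable x y k
  · ext i j; fin_cases i <;> fin_cases j <;> simp <;> ring
  · ext i j; fin_cases i <;> fin_cases j <;> simp <;> ring
  · fin_cases i <;> fin_cases j <;> simp <;> ring
  · ext i j
    rw [Matrix.sub_apply, Matrix.mul_apply, Matrix.mul_apply, Fin.sum_univ_four,
      Fin.sum_univ_four]
    fin_cases i <;> fin_cases j <;> simp [slBracket] <;> ring
  · ext k; fin_cases k <;> simp <;> ring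
  · have h00 := hA 0 0
    have h11 := hA 1 1
    have h22 := hA 2 2
    have h33 := hA 3 3
    have h01 := hA 0 1
    have h02 := hA 0 2
    have h03 := hA 0 3
    have h12 := hA 1 2
    have h13 := hA 1 3
    have h23 := hA 2 3
    simp at h00 h11 h22 h33 h01 h02 h03 h12 h13 h23
    ext i j; fin_cases i <;> fin_cases j <;> simp <;> linarith

set_option maxHeartbeats 1000000 in
theorem nonempty_equiv_so31' : Nonempty (OfLaw so31Law' ≃ₗ⁅ℝ⁆ SoDiag ![1, 1, 1, -1]) := by
  refine ⟨equivSoDiag (slBracket (-1 : ℤ)) (fun x y k => ?_)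
    -- Again 𝔰𝔩(2,ℝ) acts on the last three axes, now of signature (2,1), and the complement
    -- occupies the first row and column.
    (fun a => !![0, 2 * a 4, -a 3 + a 5, a 3 + a 5; -(2 * a 4), 0, a 1 - a 2, -a 1 - a 2;
      a 3 - a 5, -a 1 + a 2, 0, 2 * a 0; a 3 + a 5, -a 1 - a 2, 2 * a 0, 0])
    (fun A => ![A 2 3 / 2, (A 1 2 - A 1 3) / 2, (-A 1 2 - A 1 3) / 2, (A 0 3 - A 0 2) / 2, A 0 1 / 2, (A 0 2 + A 0 3) / 2])
    (fun a b => ?_) (fun t a => ?_) (fun a i j => ?_) (fun a b => ?_) (fun a => ?_) (fun A hA => ?_)⟩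
  · exact coord_lie_slTable x y k
  · ext i j; fin_cases i <;> fin_cases j <;> simp <;> ring
  · ext i j; fin_cases i <;> fin_cases j <;> simp <;> ring
  · fin_cases i <;> fin_cases j <;> simp <;> ring
  · ext i j
    rw [Matrix.sub_apply, Matrix.mul_apply, Matrix.mul_apply, Fin.sum_univ_four,
      Fin.sum_univ_four]
    fin_cases i <;> fin_cases j <;> simp [slBracket] <;> ring
  · ext k; fin_cases k <;> simp <;> ring
  · have h00 := hA 0 0
    have h11 := hA 1 1
    have h22 := hA 2 2
    have h33 := hA 3 3
    have h01 := hA 0 1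
    have h02 := hA 0 2
    have h03 := hA 0 3
    have h12 := hA 1 2
    have h13 := hA 1 3
    have h23 := hA 2 3
    simp at h00 h11 h22 h33 h01 h02 h03 h12 h13 h23
    ext i j; fin_cases i <;> fin_cases j <;> simp <;> linarith

/-- The skew-symmetric matrix of the cross product with a vector. -/
def crossMatrix (a b c : ℝ) : Matrix (Fin 3) (Fin 3) ℝ := !![0, -c, b; c, 0, -a; -b, a, 0]

theorem crossMatrix_mem (a b c : ℝ) : crossMatrix a b c ∈ LieAlgebra.Orthogonal.so (Fin 3) ℝ := by
  rw [LieAlgebra.Orthogonal.mem_so]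
  ext i j; fin_cases i <;> fin_cases j <;> simp [crossMatrix]

theorem nonempty_L61_equiv_Iso3 : Nonempty (L61 ≃ₗ⁅ℝ⁆ Iso3) := by
  refine ⟨{
    toFun x := (⟨crossMatrix (OfLaw.coord 0 x) (OfLaw.coord 1 x) (OfLaw.coord 2 x), crossMatrix_mem _ _ _⟩,
      ![OfLaw.coord 3 x, OfLaw.coord 4 x, OfLaw.coord 5 x])
    map_add' x y := ?_
    map_smul' t x := ?_
    map_lie' {x y} := ?_
    invFun p := OfLaw.ofCoords _ ![p.1.1 2 1, p.1.1 0 2, p.1.1 1 0, p.2 0, p.2 1, p.2 2]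
    left_inv x := OfLaw.ext_coord fun k => ?_
    right_inv p := ?_ }⟩
  · refine Prod.ext (Subtype.ext ?_) ?_
    · ext i j
      change crossMatrix _ _ _ i j = crossMatrix _ _ _ i j + crossMatrix _ _ _ i j
      fin_cases i <;> fin_cases j <;> simp [crossMatrix] <;> ring
    · change ![_, _, _] = ![_, _, _] + ![_, _, _]
      ext i; fin_cases i <;> simp
  · refine Prod.ext (Subtype.ext ?_) ?_
    · ext i j
      change crossMatrix _ _ _ i j = t * crossMatrix _ _ _ i j
      fin_cases i <;> fin_cases j <;> simp [crossMatrix]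
    · change ![_, _, _] = t • ![_, _, _]
      ext i; fin_cases i <;> simp
  · refine Prod.ext (Subtype.ext ?_) ?_
    · change crossMatrix _ _ _ = crossMatrix _ _ _ * crossMatrix _ _ _ - crossMatrix _ _ _ * crossMatrix _ _ _
      ext i j
      fin_cases i <;> fin_cases j <;> simp [crossMatrix, L61.coord_lie, rotationBracket] <;> ring
    · change ![_, _, _] = crossMatrix _ _ _ *ᵥ ![_, _, _] - crossMatrix _ _ _ *ᵥ ![_, _, _]
      ext i
      fin_cases i <;> simp [crossMatrix, L61.coord_lie, rotationBracket, Matrix.vecHead, Matrix.vecTail] <;> ring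
  · rw [OfLaw.coord_ofCoords]
    fin_cases k <;> simp [crossMatrix]
  · have h := p.1.2
    rw [LieAlgebra.Orthogonal.mem_so, ← Matrix.ext_iff] at h
    simp only [Matrix.transpose_apply, Matrix.neg_apply] at h
    have h00 := h 0 0
    have h11 := h 1 1
    have h22 := h 2 2
    have h01 := h 0 1
    have h02 := h 0 2
    have h12 := h 1 2
    refine Prod.ext (Subtype.ext ?_) ?_
    · ext i j
      fin_cases i <;> fin_cases j <;> simp [crossMatrix, OfLaw.coord_ofCoords] <;> linarith
    · ext i
      fin_cases i <;> simp [OfLaw.coord_ofCoords]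

theorem nonempty_L64_equiv_Isl2 : Nonempty (L64 ≃ₗ⁅ℝ⁆ Isl2) := by
  have hm (a b c : ℝ) : !![a, b; c, -a] ∈ LieAlgebra.SpecialLinear.sl (Fin 2) ℝ := by
    simp [LieAlgebra.SpecialLinear.sl, Matrix.trace, Fin.sum_univ_two]
  refine ⟨{
    -- With the standard matrices H, E, F, the first three basis vectors go to H, E, F, and the last
    -- three to E, -H, -F in the module; these signs match the table of `L64`.
    toFun x := (⟨!![OfLaw.coord 0 x, OfLaw.coord 1 x; OfLaw.coord 2 x, -OfLaw.coord 0 x], hm _ _ _⟩,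
      ⟨!![-OfLaw.coord 4 x, OfLaw.coord 3 x; -OfLaw.coord 5 x, - -OfLaw.coord 4 x], hm _ _ _⟩)
    map_add' x y := ?_
    map_smul' t x := ?_
    map_lie' {x y} := ?_
    invFun p := OfLaw.ofCoords _ ![p.1.1 0 0, p.1.1 0 1, p.1.1 1 0, p.2.1 0 1, -p.2.1 0 0, -p.2.1 1 0]
    left_inv x := OfLaw.ext_coord fun k => ?_
    right_inv p := ?_ }⟩
  · refine Prod.ext (Subtype.ext ?_) (Subtype.ext ?_) <;>
    · change !![_, _; _, _] = !![_, _; _, _] + !![_, _; _, _]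
      ext i j; fin_cases i <;> fin_cases j <;> simp <;> ring
  · refine Prod.ext (Subtype.ext ?_) (Subtype.ext ?_) <;>
    · change !![_, _; _, _] = t • !![_, _; _, _]
      ext i j; fin_cases i <;> fin_cases j <;> simp
  · refine Prod.ext (Subtype.ext ?_) (Subtype.ext ?_)
    · change !![_, _; _, _] = !![_, _; _, _] * !![_, _; _, _] - !![_, _; _, _] * !![_, _; _, _]
      ext i j
      fin_cases i <;> fin_cases j <;> simp [L64.coord_lie, slBracket] <;> ring
    · change !![_, _; _, _] = (!![_, _; _, _] * !![_, _; _, _] - !![_, _; _, _] * !![_, _; _, _]) -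
        (!![_, _; _, _] * !![_, _; _, _] - !![_, _; _, _] * !![_, _; _, _])
      ext i j
      fin_cases i <;> fin_cases j <;> simp [L64.coord_lie, slBracket] <;> ring
  · rw [OfLaw.coord_ofCoords]
    fin_cases k <;> simp
  · have h (q : LieAlgebra.SpecialLinear.sl (Fin 2) ℝ) : q.1 1 1 = - q.1 0 0 := by
      have := q.2
      simp only [LieAlgebra.SpecialLinear.sl, LieSubalgebra.mem_mk_iff', LinearMap.mem_ker, Matrix.traceLinearMap_apply,
        Matrix.trace_fin_two] at this
      linarith
    refine Prod.ext (Subtype.ext ?_) (Subtype.ext ?_)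
    · ext i j
      fin_cases i <;> fin_cases j <;> simp [OfLaw.coord_ofCoords, h]
    · ext i j
      fin_cases i <;> fin_cases j <;> simp [OfLaw.coord_ofCoords, h]
end Orthogonal
end LowDimLie
-- Semisimplicity and contractions of the classical algebras
namespace LowDimLie
open Filter Topology Module

/-- A law with diagonal and non-degenerate Killing form. -/
theorem isKilling_of_diagonal {n : ℕ} {c : Fin n → Fin n → Fin n → ℤ} {h₁ h₂}
    (hd : ∀ i j, i ≠ j → ∑ k, ∑ m, c j k m * c i m k = 0)
    (h0 : ∀ i, ∑ k, ∑ m, c i k m * c i m k ≠ 0) :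
    LieAlgebra.IsKilling ℝ (OfLaw (realLaw c h₁ h₂)) := by
  set b := OfLaw.basis (realLaw c h₁ h₂) with hb
  have hc (i j k : Fin n) : b.repr ⁅b i, b j⁆ k = c i j k := OfLaw.basis_lie _ i j k
  have hκ (i j : Fin n) : killingForm ℝ _ (b i) (b j) =
      ((∑ k, ∑ m, c j k m * c i m k : ℤ) : ℝ) := by
    rw [LieModule.traceForm_apply_apply, LinearMap.trace_eq_matrix_trace ℝ b, Matrix.trace]
    push_cast
    refine Finset.sum_congr rfl fun k _ => ?_
    rw [Matrix.diag_apply, LinearMap.toMatrix_apply, LinearMap.comp_apply, LieModule.toEnd_apply_apply,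
      LieModule.toEnd_apply_apply]
    conv_lhs => rw [← b.sum_repr ⁅b j, b k⁆]
    rw [lie_sum, map_sum, Finsupp.finsetSum_apply]
    refine Finset.sum_congr rfl fun m _ => ?_
    rw [lie_smul, map_smul, Finsupp.smul_apply, hc, hc, smul_eq_mul]
  refine ⟨?_⟩
  rw [LieSubmodule.eq_bot_iff]
  intro x hx
  rw [LieIdeal.mem_killingCompl] at hx
  refine OfLaw.ext_coord fun i => ?_
  have h := hx (b i) trivial
  rw [← b.sum_repr x, map_sum, Finset.sum_eq_single i] at h
  · rw [map_smul, hκ, smul_eq_mul, mul_eq_zero] at h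
    rw [map_zero]
    exact h.resolve_right (by exact_mod_cast h0 i)
  · intro j _ hj
    rw [map_smul, hκ, hd _ _ hj.symm, Int.cast_zero, smul_zero]
  · simp

theorem isKilling_so31Law : LieAlgebra.IsKilling ℝ (OfLaw so31Law) :=
  isKilling_of_diagonal (by decide +kernel) (by decide +kernel)

universe u

theorem isContractionOfSemisimple_of_equiv {g s' : Type u} [LieRing g] [LieAlgebra ℝ g]
    [LieRing s'] [LieAlgebra ℝ s'] {s : Type} [LieRing s] [LieAlgebra ℝ s]
    [FiniteDimensional ℝ s] [LieAlgebra.IsKilling ℝ s] (e : s ≃ₗ⁅ℝ⁆ s')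
    (h : IsContraction s g) : IsContractionOfSemisimple g := by
  have hf : FiniteDimensional ℝ s' := e.toLinearEquiv.finiteDimensional
  have hk : LieAlgebra.IsKilling ℝ s' := LieAlgebra.isKilling_of_equiv e
  exact ⟨s', inferInstance, inferInstance, hf, inferInstance, h.congr_left e⟩

/-- The semisimple algebra has to live in the universe of `g`, so the concrete one is lifted. -/
theorem isContractionOfSemisimple_of_isKilling {g : Type u} [LieRing g] [LieAlgebra ℝ g]
    {s : Type} [LieRing s] [LieAlgebra ℝ s] [FiniteDimensional ℝ s] [LieAlgebra.IsKilling ℝ s]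
    (h : IsContraction s g) : IsContractionOfSemisimple g :=
  let _ : LieRing (ULift.{u} s) := Equiv.ulift.lieRing
  let _ : LieAlgebra ℝ (ULift.{u} s) := Equiv.lieAlgebra ℝ Equiv.ulift
  isContractionOfSemisimple_of_equiv
    (LieEquiv.symm (Equiv.lieEquiv ℝ Equiv.ulift) : s ≃ₗ⁅ℝ⁆ ULift.{u} s) h

section

attribute [local instance] LieRing.ofAssociativeRing LieAlgebra.ofAssociativeAlgebra

theorem nonempty_equiv_So4 : Nonempty (OfLaw so4Law ≃ₗ⁅ℝ⁆ So4) := by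
  obtain ⟨e⟩ := nonempty_equiv_so4
  refine ⟨e.trans (LieEquiv.ofEq _ _ ?_)⟩
  ext A
  rw [SetLike.mem_coe, SetLike.mem_coe, mem_skewAdjoint_diagonal, LieAlgebra.Orthogonal.mem_so,
    ← Matrix.ext_iff]
  have h1 : (![1, 1, 1, 1] : Fin 4 → ℝ) = fun _ => 1 := by
    ext i; fin_cases i <;> rfl
  simp [h1]

end

theorem nonempty_equiv_So31 : Nonempty (OfLaw so31Law ≃ₗ⁅ℝ⁆ So31) := by
  obtain ⟨e⟩ := nonempty_equiv_so31
  obtain ⟨f⟩ := nonempty_soDiag_equiv (p := 3) (q := 1) finSumFinEquiv (d := ![1, 1, 1, -1]) (by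
    rintro (i | i) <;> fin_cases i <;> rfl)
  exact ⟨e.trans f⟩

theorem nonempty_equiv_So31' : Nonempty (OfLaw so31Law' ≃ₗ⁅ℝ⁆ So31) := by
  obtain ⟨e⟩ := nonempty_equiv_so31'
  obtain ⟨f⟩ := nonempty_soDiag_equiv (p := 3) (q := 1) finSumFinEquiv (d := ![1, 1, 1, -1]) (by
    rintro (i | i) <;> fin_cases i <;> rfl)
  exact ⟨e.trans f⟩

theorem nonempty_equiv_So22 : Nonempty (OfLaw so22Law ≃ₗ⁅ℝ⁆ So22) := by
  obtain ⟨e⟩ := nonempty_equiv_so22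
  obtain ⟨f⟩ := nonempty_soDiag_equiv (p := 2) (q := 2) finSumFinEquiv (d := ![1, 1, -1, -1]) (by
    rintro (i | i) <;> fin_cases i <;> rfl)
  exact ⟨e.trans f⟩

theorem isContraction_So4_L61 : IsContraction So4 L61 :=
  isContraction_so4Law.congr_left nonempty_equiv_So4.some

theorem isContraction_So31_L61 : IsContraction So31 L61 :=
  isContraction_so31Law.congr_left nonempty_equiv_So31.some

theorem isContraction_So22_L64 : IsContraction So22 L64 :=
  isContraction_so22Law.congr_left nonempty_equiv_So22.some

theorem isContraction_So31_L64 : IsContraction So31 L64 :=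
  isContraction_so31Law'.congr_left nonempty_equiv_So31'.some

theorem isContractionOfSemisimple_of_So31 {g : Type u} [LieRing g] [LieAlgebra ℝ g]
    (h : IsContraction So31 g) : IsContractionOfSemisimple g :=
  have := isKilling_so31Law
  isContractionOfSemisimple_of_isKilling (h.congr_left nonempty_equiv_So31.some.symm)

end LowDimLie

namespace LowDimLie

open Module

/-! ### Three-dimensional representations of `𝔰𝔩(2)` and `𝔰𝔬(3)` -/

section Representations

variable {V : Type*} [AddCommGroup V] [Module ℝ V]

theorem coeff_eq_zero {x y z : V} (h : LinearIndependent ℝ ![x, y, z]) {a b c : ℝ}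
    (h0 : a • x + b • y + c • z = 0) : a = 0 ∧ b = 0 ∧ c = 0 := by
  have := Fintype.linearIndependent_iff.1 h ![a, b, c] (by simpa [Fin.sum_univ_three] using h0)
  exact ⟨this 0, this 1, this 2⟩

theorem exists_coeff [FiniteDimensional ℝ V] {x y z : V} (h : LinearIndependent ℝ ![x, y, z]) (hV : finrank ℝ V = 3)
    (v : V) : ∃ a b c : ℝ, v = a • x + b • y + c • z := by
  have hs := h.span_eq_top_of_card_eq_finrank' (by simp [hV])
  have hv : v ∈ Submodule.span ℝ (Set.range ![x, y, z]) := hs ▸ Submodule.mem_top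
  obtain ⟨c, hc⟩ := (Submodule.mem_span_range_iff_exists_fun ℝ).1 hv
  exact ⟨c 0, c 1, c 2, by simpa [Fin.sum_univ_three] using hc.symm⟩

theorem linearIndependent_of_eigenvectors {n : ℕ} {T : End ℝ V} (μ : Fin n → ℝ)
    (hμ : Function.Injective μ) {v : Fin n → V} (h : ∀ i, T (v i) = μ i • v i)
    (h0 : ∀ i, v i ≠ 0) : LinearIndependent ℝ v :=
  T.eigenvectors_linearIndependent' μ hμ v fun i =>
    Module.End.hasEigenvector_iff.2 ⟨Module.End.mem_eigenspace_iff.2 (h i), h0 i⟩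

variable [FiniteDimensional ℝ V]

/-- Each nonzero power `E ^ m` is an eigenvector, with eigenvalue `2m`, of the commutator with `H`
on endomorphisms, which has only finitely many eigenvalues. -/
theorem isNilpotent_raising {H E : End ℝ V} (hHE : ∀ v, H (E v) = E (H v) + (2 : ℝ) • E v) :
    IsNilpotent E := by
  by_contra hE
  have hpow (m : ℕ) : H * E ^ m = E ^ m * H + (2 * m : ℝ) • E ^ m := by
    have h1 : H * E = E * H + (2 : ℝ) • E := LinearMap.ext hHE
    induction m with
    | zero => simp
    | succ m ih =>
      rw [pow_succ, ← mul_assoc, ih, add_mul, mul_assoc, h1, mul_add, smul_mul_assoc,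
        mul_smul_comm, ← mul_assoc, add_assoc, ← add_smul]
      push_cast
      ring_nf
  let D : End ℝ (End ℝ V) := LinearMap.mulLeft ℝ H - LinearMap.mulRight ℝ H
  refine Set.infinite_of_injective_forall_mem (f := fun m : ℕ => (2 * m : ℝ)) (fun m n h => ?_)
    (fun m => ?_) D.finite_hasEigenvalue
  · simpa using h
  · refine Module.End.hasEigenvalue_of_hasEigenvector (x := E ^ m)
      (Module.End.hasEigenvector_iff.2 ⟨Module.End.mem_eigenspace_iff.2 ?_, fun h => hE ⟨m, h⟩⟩)
    simp [D, hpow m]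

/-- Complete reducibility is avoided by a case distinction on `E²`. A nonzero `E² x` is a highest
weight vector of weight 2 and generates everything. If `E² = 0`, a nonzero `E x` has weight 1, and a
third basis vector is corrected until it is invariant. -/
theorem exists_sl2_basis (hV : finrank ℝ V = 3) {H E F : End ℝ V}
    (hHE : ∀ v, H (E v) = E (H v) + (2 : ℝ) • E v)
    (hHF : ∀ v, H (F v) = F (H v) - (2 : ℝ) • F v)
    (hEF : ∀ v, E (F v) = F (E v) + H v) (h0 : ¬ (H = 0 ∧ E = 0 ∧ F = 0)) :
    (∃ v₀ v₁ v₂ : V, LinearIndependent ℝ ![v₀, v₁, v₂] ∧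
      H v₀ = (2 : ℝ) • v₀ ∧ H v₁ = 0 ∧ H v₂ = (-2 : ℝ) • v₂ ∧
      E v₀ = 0 ∧ E v₁ = (2 : ℝ) • v₀ ∧ E v₂ = v₁ ∧ F v₀ = v₁ ∧ F v₁ = (2 : ℝ) • v₂ ∧ F v₂ = 0) ∨
    (∃ v w u : V, LinearIndependent ℝ ![v, w, u] ∧
      H v = v ∧ H w = -w ∧ H u = 0 ∧ E v = 0 ∧ E w = v ∧ E u = 0 ∧ F v = w ∧ F w = 0 ∧ F u = 0) := by
  have hnil : E ^ 3 = 0 := by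
    have h := LinearMap.aeval_self_charpoly E
    rw [(LinearMap.charpoly_eq_X_pow_iff E).2 fun m => ?_, hV] at h
    · simpa using h
    · obtain ⟨n, hn⟩ := isNilpotent_raising hHE
      exact ⟨n, by simp [hn]⟩
  have hE3 (x : V) : E (E (E x)) = 0 := by
    have := LinearMap.congr_fun hnil x
    simpa [pow_succ] using this
  -- Four distinct weights cannot occur in dimension three; this stops both strings of lowered
  -- vectors.
  have no4 (μ : Fin 4 → ℝ) (hμ : Function.Injective μ) (v : Fin 4 → V)
      (h : ∀ i, H (v i) = μ i • v i) : ∃ i, v i = 0 := by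
    by_contra! hv
    have := (linearIndependent_of_eigenvectors μ hμ h hv).fintype_card_le_finrank
    simp [hV] at this
  by_cases hE2 : ∀ x, E (E x) = 0
  · right
    have hE : ∃ x, E x ≠ 0 := by
      by_contra! hE
      have hH : H = 0 := LinearMap.ext fun v => by
        have := hEF v
        rw [hE, hE, map_zero, zero_add] at this
        exact this.symm
      refine h0 ⟨hH, LinearMap.ext hE, LinearMap.ext fun v => ?_⟩
      have := hHF v
      rw [hH] at this
      simpa using this
    obtain ⟨x, hx⟩ := hE
    set v := E x with hv
    have hEv : E v = 0 := hE2 x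
    have hHv : H v = v := by
      have h1 := hE2 (F x)
      have h2 : E (E (F x)) = (2 : ℝ) • (H v - v) := by
        rw [hEF, map_add, hEF, ← hv, hEv, map_zero, zero_add, hv, hHE]
        module
      rw [h2, smul_eq_zero] at h1
      exact sub_eq_zero.1 (h1.resolve_left two_ne_zero)
    set w := F v with hw
    have hHw : H w = -w := by rw [hw, hHF, hHv]; module
    have hEw : E w = v := by rw [hw, hEF, hEv, hHv, map_zero, zero_add]
    have hw0 : w ≠ 0 := fun h => hx (by rw [← hEw, h, map_zero])
    have hFw : F w = 0 := by
      by_contra hy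
      have hHy : H (F w) = (-3 : ℝ) • F w := by rw [hHF, hHw, map_neg]; module
      have hEy : E (F w) = 0 := by rw [hEF, hEw, hHw, ← hw]; module
      have hEz : E (F (F w)) = (-3 : ℝ) • F w := by rw [hEF, hEy, hHy, map_zero, zero_add]
      have hHz : H (F (F w)) = (-5 : ℝ) • F (F w) := by rw [hHF, hHy, map_smul]; module
      have hz : F (F w) ≠ 0 := fun h => hy (by
        rw [h, map_zero, eq_comm, smul_eq_zero] at hEz
        exact hEz.resolve_left (by norm_num))
      obtain ⟨i, hi⟩ := no4 ![1, -1, -3, -5] (by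
        intro i j; fin_cases i <;> fin_cases j <;> norm_num) ![v, w, F w, F (F w)] (by
        intro i; fin_cases i <;> simp [hHv, hHw, hHy, hHz])
      fin_cases i
      exacts [hx hi, hw0 hi, hy hi, hz hi]
    have hvw : LinearIndependent ℝ ![v, w] :=
      linearIndependent_of_eigenvectors (T := H) ![1, -1] (by
        intro i j; fin_cases i <;> fin_cases j <;> norm_num) (by
        intro i; fin_cases i <;> simp [hHv, hHw]) (by
        intro i; fin_cases i; exacts [hx, hw0])
    obtain ⟨u, hu⟩ := exists_linearIndependent_snoc_of_lt_finrank hvw (by rw [hV]; norm_num)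
    replace hu : LinearIndependent ℝ ![v, w, u] := by
      have e : (Fin.snoc ![v, w] u : Fin 3 → V) = ![v, w, u] := by
        ext i; fin_cases i <;> rfl
      exact e ▸ hu
    obtain ⟨α₁, β₁, γ₁, hEu⟩ := exists_coeff hu hV (E u)
    obtain ⟨α₂, β₂, γ₂, hFu⟩ := exists_coeff hu hV (F u)
    obtain ⟨α₃, β₃, γ₃, hHu⟩ := exists_coeff hu hV (H u)
    obtain ⟨-, -, e3⟩ : _ ∧ _ ∧ _ := coeff_eq_zero hu
      (a := β₂ + γ₂ * α₁ - γ₁ * α₂ - α₃) (b := γ₂ * β₁ - α₁ - γ₁ * β₂ - β₃) (c := -γ₃) (by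
        have h := hEF u
        rw [hEu, hFu, hHu] at h
        simp only [map_add, map_smul, hEv, hEw, hFw, ← hw, hEu, hFu] at h
        rw [← sub_eq_zero] at h
        rw [← h]; module)
    replace e3 : γ₃ = 0 := neg_eq_zero.1 e3
    subst e3
    obtain ⟨e4, e5, e6⟩ : _ ∧ _ ∧ _ := coeff_eq_zero hu
      (a := γ₁ * α₃ - α₁ - β₃) (b := γ₁ * β₃ - 3 * β₁) (c := -2 * γ₁) (by
        have h := hHE u
        rw [hEu, hHu] at h
        simp only [map_add, map_smul, hEv, hEw, hHv, hHw, hEu, hHu] at h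
        rw [← sub_eq_zero] at h
        rw [← h]; module)
    obtain ⟨e7, e8, e9⟩ : _ ∧ _ ∧ _ := coeff_eq_zero hu
      (a := γ₂ * α₃ + 3 * α₂) (b := γ₂ * β₃ + β₂ - α₃) (c := 2 * γ₂) (by
        have h := hHF u
        rw [hFu, hHu] at h
        simp only [map_add, map_smul, hFw, ← hw, hHv, hHw, hFu, hHu] at h
        rw [← sub_eq_zero] at h
        rw [← h]; module)
    obtain rfl : γ₁ = 0 := by linarith
    obtain rfl : γ₂ = 0 := by linarith
    obtain rfl : β₁ = 0 := by linarith
    obtain rfl : α₂ = 0 := by linarith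
    obtain rfl : β₃ = -α₁ := by linarith
    obtain rfl : α₃ = β₂ := by linarith
    -- By now `E u = α₁ v`, `F u = α₃ w` and `H u = α₃ v - α₁ w`. Subtracting `α₁ w + α₃ v` makes
    -- `u` invariant.
    refine ⟨v, w, u - α₁ • w - α₃ • v, ?_, hHv, hHw, ?_, hEv, hEw, ?_, hw.symm, hFw, ?_⟩
    · refine Fintype.linearIndependent_iff.2 fun g hg => ?_
      obtain ⟨h1, h2, h3⟩ := coeff_eq_zero hu (a := g 0 - g 2 * α₃) (b := g 1 - g 2 * α₁)
        (c := g 2) (by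
          rw [← hg, Fin.sum_univ_three]
          simp only [Matrix.cons_val]
          module)
      rw [h3] at h1 h2
      intro i; fin_cases i <;> simp <;> linarith
    · simp only [map_sub, map_smul, hHu, hHv, hHw]; module
    · simp only [map_sub, map_smul, hEu, hEv, hEw]; module
    · simp only [map_sub, map_smul, hFu, hFw, ← hw]; module
  · left
    push Not at hE2
    obtain ⟨x, hx⟩ := hE2
    set v₀ := E (E x) with hv₀
    have hE0 : E v₀ = 0 := hE3 x
    have hH0 : H v₀ = (2 : ℝ) • v₀ := by
      have h1 := hE3 (F x)
      have h2 : E (E (E (F x))) = (3 : ℝ) • (H v₀ - (2 : ℝ) • v₀) := by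
        rw [hEF, map_add, map_add, hEF, map_add, hEF (E (E x)), ← hv₀, hE0, map_zero, zero_add]
        have h3 : E (H (E x)) = H v₀ - (2 : ℝ) • v₀ := by rw [hv₀, hHE (E x)]; module
        have h4 : E (E (H x)) = H v₀ - (4 : ℝ) • v₀ := by
          have : E (H x) = H (E x) - (2 : ℝ) • E x := by rw [hHE]; module
          rw [this, map_sub, map_smul, h3]; module
        rw [h3, h4]; module
      rw [h2, smul_eq_zero] at h1
      exact sub_eq_zero.1 (h1.resolve_left three_ne_zero)
    set v₁ := F v₀ with hv₁
    have hH1 : H v₁ = 0 := by rw [hv₁, hHF, hH0, map_smul]; module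
    have hE1 : E v₁ = (2 : ℝ) • v₀ := by rw [hv₁, hEF, hE0, map_zero, zero_add, hH0]
    obtain ⟨v₂, hv₂⟩ : ∃ v₂, F v₁ = (2 : ℝ) • v₂ := ⟨(1 / 2 : ℝ) • F v₁, by module⟩
    have hH2 : H v₂ = (-2 : ℝ) • v₂ := by
      have : (2 : ℝ) • H v₂ = (2 : ℝ) • ((-2 : ℝ) • v₂) := by
        rw [← map_smul, ← hv₂, hHF, hH1, map_zero, hv₂]; module
      exact smul_right_injective V (two_ne_zero (α := ℝ)) this
    have hE2 : E v₂ = v₁ := by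
      have : (2 : ℝ) • E v₂ = (2 : ℝ) • v₁ := by
        rw [← map_smul, ← hv₂, hEF, hE1, hH1, map_smul, ← hv₁, add_zero]
      exact smul_right_injective V (two_ne_zero (α := ℝ)) this
    have n1 : v₁ ≠ 0 := fun h => by
      rw [h, map_zero, eq_comm, smul_eq_zero] at hE1
      exact hx (hE1.resolve_left two_ne_zero)
    have n2 : v₂ ≠ 0 := fun h => n1 (by rw [← hE2, h, map_zero])
    have hF2 : F v₂ = 0 := by
      by_contra hy
      have hHy : H (F v₂) = (-4 : ℝ) • F v₂ := by rw [hHF, hH2, map_smul]; module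
      obtain ⟨i, hi⟩ := no4 ![2, 0, -2, -4] (by
        intro i j; fin_cases i <;> fin_cases j <;> norm_num) ![v₀, v₁, v₂, F v₂] (by
        intro i; fin_cases i <;> simp [hH0, hH1, hH2, hHy, -neg_smul])
      fin_cases i
      exacts [hx hi, n1 hi, n2 hi, hy hi]
    refine ⟨v₀, v₁, v₂, ?_, hH0, hH1, hH2, hE0, hE1, hE2, hv₁.symm, hv₂, hF2⟩
    exact linearIndependent_of_eigenvectors (T := H) ![2, 0, -2] (by
        intro i j; fin_cases i <;> fin_cases j <;> norm_num) (by
        intro i; fin_cases i <;> simp [hH0, hH1, hH2, -neg_smul]) (by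
        intro i; fin_cases i; exacts [hx, n1, n2])

/-- Linear endomorphisms of a three-dimensional real space have eigenvectors. -/
theorem exists_eigenvector (hV : finrank ℝ V = 3) (A : End ℝ V) :
    ∃ (μ : ℝ) (v : V), v ≠ 0 ∧ A v = μ • v := by
  obtain ⟨μ, hμ⟩ : ∃ μ, A.charpoly.IsRoot μ := by
    by_contra! h
    have hl : 0 ≤ A.charpoly.leadingCoeff := by rw [A.charpoly_monic.leadingCoeff]; exact zero_le_one
    -- Without roots, the value of this monic cubic at 0 would have the sign of both ends at
    -- infinity.
    have h1 := Polynomial.zero_lt_eval_of_roots_lt_of_leadingCoeff_nonneg (x := 0)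
      (fun y hy => (h y hy).elim) hl
    have h2 := Polynomial.zero_lt_negOnePow_mul_eval_of_lt_roots_of_leadingCoeff_nonneg (x := 0)
      (fun y hy => (h y hy).elim) hl
    rw [A.charpoly_natDegree, hV, Int.negOnePow_odd _ (by decide)] at h2
    push_cast at h2
    linarith
  obtain ⟨v, hv⟩ := ((Module.End.hasEigenvalue_iff_isRoot_charpoly A μ).2 hμ).exists_hasEigenvector
  exact ⟨μ, v, hv.2, hv.apply_eq_smul⟩

/-- Matrices in `𝔰𝔩(2,ℝ)` that satisfy the relations of `𝔰𝔬(3)` vanish. -/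
theorem so3_relations_sl2 {a₁ a₂ a₃ b₁ b₂ b₃ c₁ c₂ c₃ : ℝ}
    (hc₁ : c₁ = a₂ * b₃ - a₃ * b₂) (hc₂ : c₂ = 2 * (a₁ * b₂ - a₂ * b₁))
    (hc₃ : c₃ = 2 * (a₃ * b₁ - a₁ * b₃))
    (ha₁ : a₁ = b₂ * c₃ - b₃ * c₂) (ha₂ : a₂ = 2 * (b₁ * c₂ - b₂ * c₁))
    (ha₃ : a₃ = 2 * (b₃ * c₁ - b₁ * c₃))
    (hb₁ : b₁ = c₂ * a₃ - c₃ * a₂) (hb₂ : b₂ = 2 * (c₁ * a₂ - c₂ * a₁))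
    (hb₃ : b₃ = 2 * (c₃ * a₁ - c₁ * a₃)) : c₁ = 0 := by
  have hab : 2 * a₁ * b₁ + a₂ * b₃ + a₃ * b₂ = 0 := by
    rw [hb₁, hb₂, hb₃]; ring
  have hta : a₁ ^ 2 + a₂ * a₃ = c₁ ^ 2 + c₂ * c₃ := by
    linear_combination a₁ * ha₁ + a₃ / 2 * ha₂ + a₂ / 2 * ha₃ - c₁ * hc₁ - c₃ / 2 * hc₂ - c₂ / 2 * hc₃
  have htb : b₁ ^ 2 + b₂ * b₃ = c₁ ^ 2 + c₂ * c₃ := by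
    linear_combination b₁ * hb₁ + b₃ / 2 * hb₂ + b₂ / 2 * hb₃ - c₁ * hc₁ - c₃ / 2 * hc₂ - c₂ / 2 * hc₃
  obtain ⟨t, ht⟩ : ∃ t, t = c₁ ^ 2 + c₂ * c₃ := ⟨_, rfl⟩
  rw [← ht] at hta htb
  have h1 : t = -4 * t ^ 2 := by
    have : t = (2 * a₁ * b₁ + a₂ * b₃ + a₃ * b₂) ^ 2
        - 4 * (a₁ ^ 2 + a₂ * a₃) * (b₁ ^ 2 + b₂ * b₃) := by
      rw [ht, hc₁, hc₂, hc₃]; ring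
    rw [hab, hta, htb] at this
    linarith
  have h2 : c₁ ^ 2 + 4 * t ^ 2 - 4 * t * (a₁ ^ 2 + b₁ ^ 2) = 0 := by
    have e1 : a₂ * a₃ = t - a₁ ^ 2 := by linarith
    have e2 : b₂ * b₃ = t - b₁ ^ 2 := by linarith
    have e3 : c₁ ^ 2 = (a₂ * b₃ + a₃ * b₂) ^ 2 - 4 * ((a₂ * a₃) * (b₂ * b₃)) := by
      rw [hc₁]; ring
    have e4 : a₂ * b₃ + a₃ * b₂ = -2 * a₁ * b₁ := by linarith
    rw [e3, e4, e1, e2]; ring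
  have ht0 : t ≤ 0 := by nlinarith [sq_nonneg t]
  have : c₁ ^ 2 ≤ 0 := by nlinarith [sq_nonneg t, sq_nonneg a₁, sq_nonneg b₁]
  exact pow_eq_zero_iff two_ne_zero |>.1 (le_antisymm this (sq_nonneg _))

/-- An invariant vector of a three-dimensional representation of `𝔰𝔬(3)`: the representation is
trivial. -/
theorem so3_trivial_of_invariant (hV : finrank ℝ V = 3) {A B C : End ℝ V}
    (hAB : ∀ v, A (B v) = B (A v) + C v) (hBC : ∀ v, B (C v) = C (B v) + A v)
    (hCA : ∀ v, C (A v) = A (C v) + B v) {v : V} (hv : v ≠ 0) (hA : A v = 0) (hB : B v = 0)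
    (hC : C v = 0) (x : V) : C x = 0 := by
  obtain ⟨p, hp⟩ := exists_linearIndependent_pair_of_one_lt_finrank (R := ℝ) (by rw [hV]; norm_num) hv
  obtain ⟨q, hq⟩ := exists_linearIndependent_snoc_of_lt_finrank hp (by rw [hV]; norm_num)
  replace hq : LinearIndependent ℝ ![v, p, q] := by
    have e : (Fin.snoc ![v, p] q : Fin 3 → V) = ![v, p, q] := by
      ext i; fin_cases i <;> rfl
    exact e ▸ hq
  -- The commutator relation modulo the invariant line. It makes the quotient matrices traceless, so
  -- `so3_relations_sl2` applies to all three by cyclic symmetry. Once they vanish, the operators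
  -- map into the line, which they kill, and so do not act.
  have key {A B C : End ℝ V} (hAB : ∀ v, A (B v) = B (A v) + C v)
      (hA : A v = 0) (hB : B v = 0) {α β γ α' β' γ' a₁ a₂ a₃ a₄ b₁ b₂ b₃ b₄ c₁ c₂ c₃ c₄ : ℝ}
      (hAp : A p = α • v + a₁ • p + a₃ • q) (hAq : A q = α' • v + a₂ • p + a₄ • q)
      (hBp : B p = β • v + b₁ • p + b₃ • q) (hBq : B q = β' • v + b₂ • p + b₄ • q)
      (hCp : C p = γ • v + c₁ • p + c₃ • q) (hCq : C q = γ' • v + c₂ • p + c₄ • q) :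
      c₁ = a₂ * b₃ - a₃ * b₂ ∧ c₂ = a₁ * b₂ + a₂ * b₄ - a₂ * b₁ - a₄ * b₂ ∧
      c₃ = a₃ * b₁ + a₄ * b₃ - a₁ * b₃ - a₃ * b₄ ∧ c₄ = a₃ * b₂ - a₂ * b₃ := by
    obtain ⟨-, h1, h2⟩ := coeff_eq_zero hq
      (a := b₁ * α + b₃ * α' - a₁ * β - a₃ * β' - γ)
      (b := a₂ * b₃ - a₃ * b₂ - c₁) (c := a₃ * b₁ + a₄ * b₃ - a₁ * b₃ - a₃ * b₄ - c₃) (by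
        have h := hAB p
        rw [hAp, hBp, hCp] at h
        simp only [map_add, map_smul, hA, hB, hAp, hBp, hAq, hBq] at h
        rw [← sub_eq_zero] at h
        rw [← h]; module)
    obtain ⟨-, h3, h4⟩ := coeff_eq_zero hq
      (a := b₂ * α + b₄ * α' - a₂ * β - a₄ * β' - γ')
      (b := a₁ * b₂ + a₂ * b₄ - a₂ * b₁ - a₄ * b₂ - c₂) (c := a₃ * b₂ - a₂ * b₃ - c₄) (by
        have h := hAB q
        rw [hAq, hBq, hCq] at h
        simp only [map_add, map_smul, hA, hB, hAp, hBp, hAq, hBq] at h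
        rw [← sub_eq_zero] at h
        rw [← h]; module)
    exact ⟨by linarith, by linarith, by linarith, by linarith⟩
  obtain ⟨α, a₁, a₃, hAp⟩ := exists_coeff hq hV (A p)
  obtain ⟨α', a₂, a₄, hAq⟩ := exists_coeff hq hV (A q)
  obtain ⟨β, b₁, b₃, hBp⟩ := exists_coeff hq hV (B p)
  obtain ⟨β', b₂, b₄, hBq⟩ := exists_coeff hq hV (B q)
  obtain ⟨γ, c₁, c₃, hCp⟩ := exists_coeff hq hV (C p)
  obtain ⟨γ', c₂, c₄, hCq⟩ := exists_coeff hq hV (C q)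
  obtain ⟨r1, r2, r3, r4⟩ := key hAB hA hB hAp hAq hBp hBq hCp hCq
  obtain ⟨s1, s2, s3, s4⟩ := key hBC hB hC hBp hBq hCp hCq hAp hAq
  obtain ⟨t1, t2, t3, t4⟩ := key hCA hC hA hCp hCq hAp hAq hBp hBq
  obtain rfl : a₄ = -a₁ := by linarith
  obtain rfl : b₄ = -b₁ := by linarith
  obtain rfl : c₄ = -c₁ := by linarith
  replace r2 : c₂ = 2 * (a₁ * b₂ - a₂ * b₁) := by linarith
  replace r3 : c₃ = 2 * (a₃ * b₁ - a₁ * b₃) := by linarith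
  replace s2 : a₂ = 2 * (b₁ * c₂ - b₂ * c₁) := by linarith
  replace s3 : a₃ = 2 * (b₃ * c₁ - b₁ * c₃) := by linarith
  replace t2 : b₂ = 2 * (c₁ * a₂ - c₂ * a₁) := by linarith
  replace t3 : b₃ = 2 * (c₃ * a₁ - c₁ * a₃) := by linarith
  have hc₁ := so3_relations_sl2 r1 r2 r3 s1 s2 s3 t1 t2 t3
  have ha₁ := so3_relations_sl2 s1 s2 s3 t1 t2 t3 r1 r2 r3
  have hb₁ := so3_relations_sl2 t1 t2 t3 r1 r2 r3 s1 s2 s3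
  have hmem {T : End ℝ V} (h0 : T v = 0) {τ τ' : ℝ} (h1 : T p = τ • v) (h2 : T q = τ' • v) (x : V) :
      ∃ t : ℝ, T x = t • v := by
    obtain ⟨a, b, c, rfl⟩ := exists_coeff hq hV x
    exact ⟨b * τ + c * τ', by simp only [map_add, map_smul, h0, h1, h2]; module⟩
  subst hc₁ ha₁ hb₁
  obtain ⟨s, hs⟩ := hmem hA (τ := α) (τ' := α') (by rw [hAp, s3]; module) (by rw [hAq, s2]; module) x
  obtain ⟨t, ht⟩ := hmem hB (τ := β) (τ' := β') (by rw [hBp, t3]; module) (by rw [hBq, t2]; module) x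
  have := hAB x
  rw [hs, ht, map_smul, map_smul, hA, hB, smul_zero, smul_zero, zero_add] at this
  exact this.symm

/-- In odd dimension `A` has a real eigenvector `v`. It spans the module together with `B v` and `C
v`, unless it is invariant, which would make the representation trivial. The relations then leave no
freedom. -/
theorem exists_so3_basis (hV : finrank ℝ V = 3) {A B C : End ℝ V}
    (hAB : ∀ v, A (B v) = B (A v) + C v) (hBC : ∀ v, B (C v) = C (B v) + A v)
    (hCA : ∀ v, C (A v) = A (C v) + B v) (h0 : ¬ (A = 0 ∧ B = 0 ∧ C = 0)) :
    ∃ v₀ v₁ v₂ : V, LinearIndependent ℝ ![v₀, v₁, v₂] ∧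
      A v₀ = 0 ∧ A v₁ = v₂ ∧ A v₂ = -v₁ ∧ B v₀ = -v₂ ∧ B v₁ = 0 ∧ B v₂ = v₀ ∧
      C v₀ = v₁ ∧ C v₁ = -v₀ ∧ C v₂ = 0 := by
  obtain ⟨μ, v, hv, hμ⟩ := exists_eigenvector hV A
  have hABv : A (B v) = μ • B v + C v := by rw [hAB, hμ, map_smul]
  have hACv : A (C v) = μ • C v - B v := by
    have := hCA v
    rw [hμ, map_smul] at this
    rw [this]; module
  -- The operator `A - μ` kills `v` and rotates `B v` and `C v` by a right angle. Applied twice to a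
  -- linear relation, it gives two equations with determinant `c₁² + c₂²`.
  have hli : LinearIndependent ℝ ![v, B v, C v] := by
    refine Fintype.linearIndependent_iff.2 fun c hc => ?_
    rw [Fin.sum_univ_three] at hc
    simp only [Matrix.cons_val] at hc
    have h1 : c 1 • C v - c 2 • B v = 0 := by
      have := congrArg A hc
      simp only [map_add, map_smul, hμ, hABv, hACv, map_zero] at this
      calc _ = (c 0 • μ • v + c 1 • (μ • B v + C v) + c 2 • (μ • C v - B v))
          - μ • (c 0 • v + c 1 • B v + c 2 • C v) := by module
        _ = 0 := by rw [this, hc, smul_zero, sub_zero]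
    have h2 : c 1 • B v + c 2 • C v = 0 := by
      have := congrArg A h1
      simp only [map_sub, map_smul, hABv, hACv, map_zero] at this
      calc _ = -((c 1 • (μ • C v - B v) - c 2 • (μ • B v + C v))
          - μ • (c 1 • C v - c 2 • B v)) := by module
        _ = 0 := by rw [this, h1, smul_zero, sub_zero, neg_zero]
    by_cases hz : c 1 ^ 2 + c 2 ^ 2 = 0
    · have z1 : c 1 = 0 := by nlinarith [sq_nonneg (c 1), sq_nonneg (c 2)]
      have z2 : c 2 = 0 := by nlinarith [sq_nonneg (c 1), sq_nonneg (c 2)]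
      rw [z1, z2, zero_smul, zero_smul, add_zero, add_zero, smul_eq_zero] at hc
      intro i; fin_cases i
      exacts [hc.resolve_right hv, z1, z2]
    · have hBv : B v = 0 := by
        have : (c 1 ^ 2 + c 2 ^ 2) • B v = 0 := by
          calc _ = c 1 • (c 1 • B v + c 2 • C v) - c 2 • (c 1 • C v - c 2 • B v) := by module
            _ = 0 := by rw [h1, h2, smul_zero, smul_zero, sub_zero]
        exact (smul_eq_zero.1 this).resolve_left hz
      have hCv : C v = 0 := by
        have : (c 1 ^ 2 + c 2 ^ 2) • C v = 0 := by
          calc _ = c 2 • (c 1 • B v + c 2 • C v) + c 1 • (c 1 • C v - c 2 • B v) := by module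
            _ = 0 := by rw [h1, h2, smul_zero, smul_zero, add_zero]
        exact (smul_eq_zero.1 this).resolve_left hz
      have hAv : A v = 0 := by
        have := hBC v
        rw [hCv, hBv, map_zero, map_zero, zero_add] at this
        exact this.symm
      exact (h0 ⟨LinearMap.ext (so3_trivial_of_invariant hV hBC hCA hAB hv hBv hCv hAv),
        LinearMap.ext (so3_trivial_of_invariant hV hCA hAB hBC hv hCv hAv hBv),
        LinearMap.ext (so3_trivial_of_invariant hV hAB hBC hCA hv hAv hBv hCv)⟩).elim
  -- As a commutator `A` has trace zero, and its trace in this basis is `3μ`.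
  have hμ0 : μ = 0 := by
    let b : Basis (Fin 3) ℝ V := basisOfLinearIndependentOfCardEqFinrank hli (by simp [hV])
    have hb0 : b 0 = v := by simp [b]
    have hb1 : b 1 = B v := by simp [b]
    have hb2 : b 2 = C v := by simp [b]
    have htr : LinearMap.trace ℝ V A = 0 := by
      have : A = B * C - C * B := LinearMap.ext fun x => by simp [hBC x]
      rw [this, map_sub, LinearMap.trace_mul_comm, sub_self]
    rw [LinearMap.trace_eq_matrix_trace ℝ b, Matrix.trace, Fin.sum_univ_three] at htr
    simp only [Matrix.diag_apply, LinearMap.toMatrix_apply, hb0, hb1, hb2, hμ, hABv, hACv] at htr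
    rw [← hb1, ← hb2, ← hb0] at htr
    simp at htr
    linarith
  subst hμ0
  rw [zero_smul] at hμ
  rw [zero_smul, zero_add] at hABv
  rw [zero_smul, zero_sub] at hACv
  have hCB : C (B v) = B (C v) := by
    have := hBC v
    rw [hμ, add_zero] at this
    exact this.symm
  have hBCv : B (C v) = 0 := by
    obtain ⟨a, b, c, h⟩ := exists_coeff hli hV (B (C v))
    have e1 : A (B (C v)) = C (C v) - B (B v) := by rw [hAB, hACv, map_neg]; abel
    -- In the basis `v`, `B v`, `C v` the square of `A` has eigenvalues 0 and -1 only, so a vector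
    -- with eigenvalue -4 vanishes.
    have e2 : A (A (B (C v))) = (-4 : ℝ) • B (C v) := by
      rw [e1, map_sub, hAB, hABv, hCB]
      have := hCA (C v)
      rw [hACv, map_neg, hCB] at this
      rw [show A (C (C v)) = -B (C v) - B (C v) by rw [this]; abel]
      module
    rw [h] at e2
    simp only [map_add, map_smul, hμ, hABv, hACv, map_neg] at e2
    obtain ⟨h1, h2, h3⟩ := coeff_eq_zero hli (a := 4 * a) (b := 3 * b) (c := 3 * c) (by
      rw [← sub_eq_zero] at e2
      rw [← e2]
      simp only [map_zero]
      module)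
    rw [h, show a = 0 by linarith, show b = 0 by linarith, show c = 0 by linarith]
    simp
  have hBB : B (B v) = C (C v) := by
    have e1 : A (B (C v)) = C (C v) - B (B v) := by rw [hAB, hACv, map_neg]; abel
    rw [hBCv, map_zero] at e1
    exact (sub_eq_zero.1 e1.symm).symm
  have hBBv : B (B v) = -v := by
    obtain ⟨a, b, c, h⟩ := exists_coeff hli hV (B (B v))
    have e1 : A (B (B v)) = 0 := by rw [hAB, hABv, hBCv, hCB, hBCv, add_zero]
    rw [h] at e1
    simp only [map_add, map_smul, hμ, hABv, hACv] at e1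
    obtain ⟨-, hc, hb⟩ := coeff_eq_zero hli (a := 0) (b := -c) (c := b) (by rw [← e1]; module)
    obtain rfl : c = 0 := by linarith
    subst hb
    have e2 := hBC (B v)
    rw [hCB, hBCv, map_zero, h, hABv] at e2
    simp only [map_smul, zero_smul, add_zero] at e2
    obtain ⟨-, -, hc⟩ := coeff_eq_zero hli (a := 0) (b := 0) (c := a + 1) (by rw [e2]; module)
    rw [h, show a = -1 by linarith]
    module
  refine ⟨v, C v, -B v, ?_, hμ, hACv, by rw [map_neg, hABv], (neg_neg _).symm, hBCv,
    by rw [map_neg, hBBv, neg_neg], rfl, by rw [← hBB, hBBv], by rw [map_neg, hCB, hBCv, neg_zero]⟩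
  refine Fintype.linearIndependent_iff.2 fun g hg => ?_
  obtain ⟨h1, h2, h3⟩ := coeff_eq_zero hli (a := g 0) (b := -g 2) (c := g 1) (by
      rw [← hg, Fin.sum_univ_three]
      simp only [Matrix.cons_val]
      module)
  intro i; fin_cases i
  exacts [h1, h3, neg_eq_zero.1 h2]

end Representations

end LowDimLie

namespace LowDimLie

open Module

/-! ### Three-dimensional semisimple Lie algebras -/

section ThreeDim

variable {S : Type*} [LieRing S] [LieAlgebra ℝ S]

/-- The relations of the standard basis of `𝔰𝔬(3)`. -/
structure IsSo3Triple {L : Type*} [LieRing L] (x y z : L) : Prop where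
  lie_x_y : ⁅x, y⁆ = z
  lie_y_z : ⁅y, z⁆ = x
  lie_z_x : ⁅z, x⁆ = y

/-- On the plane of `x` and `y` the square of `ad z` is the positive scalar `-αβ = μ²`. The
eigenvectors `μx ± βy` give the raising and lowering elements, `2/μ` normalizes the weights to ±2,
and the factor of the second eigenvector normalizes the bracket. -/
theorem exists_sl2_of_neg {x y z : S} (hs : Submodule.span ℝ {x, y, z} = ⊤) {α β γ : ℝ}
    (hyz : ⁅y, z⁆ = α • x) (hzx : ⁅z, x⁆ = β • y) (hxy : ⁅x, y⁆ = γ • z) (hz : z ≠ 0) (hγ : γ ≠ 0)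
    (hαβ : α * β < 0) :
    ∃ h e f : S, IsSl2Triple h e f ∧ Submodule.span ℝ {h, e, f} = ⊤ := by
  have hβ : β ≠ 0 := fun h => by simp [h] at hαβ
  obtain ⟨μ, hμ, hμ2⟩ : ∃ μ : ℝ, 0 < μ ∧ μ * μ = -(α * β) :=
    ⟨√(-(α * β)), Real.sqrt_pos.2 (by linarith), Real.mul_self_sqrt (by linarith)⟩
  have hμ0 := hμ.ne'
  have hyx : ⁅y, x⁆ = -(γ • z) := by rw [← hxy, lie_skew]
  have hzy : ⁅z, y⁆ = -(α • x) := by rw [← hyz, lie_skew]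
  have hα : α = -(μ * μ) / β := by field_simp; linarith
  refine ⟨(2 / μ) • z, μ • x + β • y, (-1 / (μ * μ * β * γ)) • (μ • x - β • y), ⟨?_, ?_, ?_, ?_⟩, ?_⟩
  · exact smul_ne_zero (div_ne_zero two_ne_zero hμ0) hz
  · simp only [lie_smul, lie_sub, add_lie, smul_lie, lie_self, hxy, hyx]
    match_scalars
    field_simp
    ring
  · simp only [lie_smul, lie_add, smul_lie, hzx, hzy, hα]
    match_scalars <;> field_simp
  · simp only [lie_smul, lie_sub, smul_lie, hzx, hzy, hα]
    match_scalars <;> field_simp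
  · rw [eq_top_iff, ← hs, Submodule.span_le]
    rintro w (rfl | rfl | rfl)
    · refine Submodule.mem_span_triple.2 ⟨0, 1 / (2 * μ), -(μ * β * γ) / 2, ?_⟩
      match_scalars <;> field_simp <;> ring
    · refine Submodule.mem_span_triple.2 ⟨0, 1 / (2 * β), (μ * μ * γ) / 2, ?_⟩
      match_scalars <;> field_simp <;> ring
    · refine Submodule.mem_span_triple.2 ⟨μ / 2, 0, 0, ?_⟩
      match_scalars <;> field_simp <;> ring

/-- In a Killing-orthogonal basis, invariance makes each bracket of two members a multiple of the
third. If the three multiples have equal signs, rescaling gives 𝔰𝔬(3); otherwise some `ad` is real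
diagonalizable and 𝔰𝔩(2,ℝ) appears. -/
theorem exists_triple [LieAlgebra.IsKilling ℝ S] (h3 : finrank ℝ S = 3) :
    (∃ x y z : S, IsSo3Triple x y z ∧ Submodule.span ℝ {x, y, z} = ⊤) ∨
    (∃ h e f : S, IsSl2Triple h e f ∧ Submodule.span ℝ {h, e, f} = ⊤) := by
  have hfin : FiniteDimensional ℝ S := FiniteDimensional.of_finrank_pos (by rw [h3]; norm_num)
  obtain ⟨b', hb'⟩ := LinearMap.BilinForm.exists_orthogonal_basis
    (B := killingForm ℝ S) (LieModule.traceForm_isSymm ℝ S S)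
  obtain ⟨b, hb⟩ : ∃ b : Basis (Fin 3) ℝ S, ∀ i j, i ≠ j → killingForm ℝ S (b i) (b j) = 0 :=
    ⟨b'.reindex (finCongr h3), fun i j hij => by
      rw [Basis.reindex_apply, Basis.reindex_apply]
      exact hb' (fun h => hij ((finCongr h3).symm.injective h))⟩
  set κ := killingForm ℝ S with hκ
  have hinv (x y z : S) : κ ⁅x, y⁆ z = κ x ⁅y, z⁆ := LieModule.traceForm_apply_lie_apply ℝ S S x y z
  have hexp (x : S) : x = b.repr x 0 • b 0 + b.repr x 1 • b 1 + b.repr x 2 • b 2 := by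
    conv_lhs => rw [← b.sum_repr x, Fin.sum_univ_three]
  have hrepr (x : S) (i : Fin 3) : κ x (b i) = b.repr x i * κ (b i) (b i) := by
    conv_lhs => rw [hexp x]
    fin_cases i <;> simp [hb]
  have hnz (i : Fin 3) : κ (b i) (b i) ≠ 0 := by
    intro h
    have : b i ∈ LieIdeal.killingCompl ℝ S ⊤ := by
      rw [LieIdeal.mem_killingCompl]
      intro y _
      rw [← hκ, hrepr, h, mul_zero]
    rw [LieAlgebra.IsKilling.killingCompl_top_eq_bot, LieSubmodule.mem_bot] at this
    exact b.ne_zero i this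
  have hγ (i j : Fin 3) : b.repr ⁅b i, b j⁆ i = 0 ∧ b.repr ⁅b i, b j⁆ j = 0 := by
    constructor
    · have h := hrepr ⁅b i, b j⁆ i
      rw [← lie_skew, map_neg, LinearMap.neg_apply, hinv, lie_self, map_zero, neg_zero, lie_skew,
        eq_comm, mul_eq_zero] at h
      exact h.resolve_right (hnz i)
    · have h := hrepr ⁅b i, b j⁆ j
      rw [hinv, lie_self, map_zero, eq_comm, mul_eq_zero] at h
      exact h.resolve_right (hnz j)
  obtain ⟨α, hα⟩ : ∃ α, b.repr ⁅b 1, b 2⁆ 0 = α := ⟨_, rfl⟩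
  obtain ⟨β, hβ⟩ : ∃ β, b.repr ⁅b 2, b 0⁆ 1 = β := ⟨_, rfl⟩
  obtain ⟨γ, hγ'⟩ : ∃ γ, b.repr ⁅b 0, b 1⁆ 2 = γ := ⟨_, rfl⟩
  have hxy : ⁅b 0, b 1⁆ = γ • b 2 := by
    rw [hexp ⁅b 0, b 1⁆, (hγ 0 1).1, (hγ 0 1).2, hγ']; module
  have hyz : ⁅b 1, b 2⁆ = α • b 0 := by
    rw [hexp ⁅b 1, b 2⁆, (hγ 1 2).1, (hγ 1 2).2, hα]; module
  have hzx : ⁅b 2, b 0⁆ = β • b 1 := by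
    rw [hexp ⁅b 2, b 0⁆, (hγ 2 0).1, (hγ 2 0).2, hβ]; module
  have h1 : γ * κ (b 2) (b 2) = α * κ (b 0) (b 0) := by
    have := hinv (b 0) (b 1) (b 2)
    rwa [hxy, hyz, map_smul, map_smul] at this
  have h2 : α * κ (b 0) (b 0) = β * κ (b 1) (b 1) := by
    have := hinv (b 1) (b 2) (b 0)
    rwa [hyz, hzx, map_smul, map_smul] at this
  -- One vanishing constant makes all of them vanish by invariance; then `b 0` is central and
  -- isotropic.
  have hα0 : α ≠ 0 := by
    intro h0
    rw [h0, zero_mul] at h1 h2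
    have hγ0 : γ = 0 := (mul_eq_zero.1 h1).resolve_right (hnz 2)
    have hβ0 : β = 0 := (mul_eq_zero.1 h2.symm).resolve_right (hnz 1)
    have had : LieModule.toEnd ℝ S S (b 0) = 0 := by
      refine b.ext fun i => ?_
      fin_cases i
      · exact lie_self _
      · change ⁅b 0, b 1⁆ = 0
        rw [hxy, hγ0, zero_smul]
      · change ⁅b 0, b 2⁆ = 0
        rw [← lie_skew, hzx, hβ0, zero_smul, neg_zero]
    refine hnz 0 ?_
    rw [hκ, LieModule.traceForm_apply_apply, had, LinearMap.zero_comp, map_zero]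
  have hβ0 : β ≠ 0 := fun h => by
    rw [h, zero_mul] at h2
    exact mul_ne_zero hα0 (hnz 0) h2
  have hγ0 : γ ≠ 0 := fun h => by
    rw [h, zero_mul] at h1
    exact mul_ne_zero hα0 (hnz 0) h1.symm
  have hspan : Submodule.span ℝ {b 0, b 1, b 2} = ⊤ :=
    eq_top_iff.2 fun x _ => Submodule.mem_span_triple.2 ⟨_, _, _, (hexp x).symm⟩
  rcases lt_or_ge (α * β) 0 with hαβ | hαβ
  · exact Or.inr (exists_sl2_of_neg hspan hyz hzx hxy (b.ne_zero 2) hγ0 hαβ)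
  rcases lt_or_ge (β * γ) 0 with hβγ | hβγ
  · refine Or.inr (exists_sl2_of_neg (x := b 1) (y := b 2) (z := b 0) ?_ hzx hxy hyz (b.ne_zero 0)
      hα0 hβγ)
    rw [← hspan]
    congr 1
    ext w
    simp only [Set.mem_insert_iff, Set.mem_singleton_iff]
    tauto
  left
  have hαβ' : 0 < α * β := lt_of_le_of_ne hαβ (mul_ne_zero hα0 hβ0).symm
  have hβγ' : 0 < β * γ := lt_of_le_of_ne hβγ (mul_ne_zero hβ0 hγ0).symm
  have hαγ' : 0 < α * γ := by
    have : 0 < (α * γ) * β ^ 2 := by nlinarith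
    exact pos_of_mul_pos_left this (sq_nonneg β)
  obtain ⟨p, hp, hp2⟩ : ∃ p : ℝ, 0 < p ∧ p * p = β * γ :=
    ⟨√(β * γ), Real.sqrt_pos.2 hβγ', Real.mul_self_sqrt hβγ'.le⟩
  obtain ⟨q, hq, hq2⟩ : ∃ q : ℝ, 0 < q ∧ q * q = α * γ :=
    ⟨√(α * γ), Real.sqrt_pos.2 hαγ', Real.mul_self_sqrt hαγ'.le⟩
  have hp0 := hp.ne'
  have hq0 := hq.ne'
  have eα : α = q * q / γ := by field_simp; linarith
  have eβ : β = p * p / γ := by field_simp; linarith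
  refine ⟨p⁻¹ • b 0, q⁻¹ • b 1, (γ * p⁻¹ * q⁻¹) • b 2, ⟨?_, ?_, ?_⟩, ?_⟩
  · simp only [lie_smul, smul_lie, hxy]
    match_scalars
    field_simp
  · simp only [lie_smul, smul_lie, hyz, eα]
    match_scalars
    field_simp
  · simp only [lie_smul, smul_lie, hzx, eβ]
    match_scalars
    field_simp
  · rw [eq_top_iff, ← hspan, Submodule.span_le]
    rintro w (rfl | rfl | rfl)
    · refine Submodule.mem_span_triple.2 ⟨p, 0, 0, ?_⟩
      match_scalars <;> field_simp <;> ring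
    · refine Submodule.mem_span_triple.2 ⟨0, q, 0, ?_⟩
      match_scalars <;> field_simp <;> ring
    · refine Submodule.mem_span_triple.2 ⟨0, 0, p * q / γ, ?_⟩
      match_scalars <;> field_simp <;> ring

end ThreeDim
end LowDimLie

namespace LowDimLie

open Module

/-! ### Dimensions in a Levi decomposition -/

section Levi

/-- All brackets are multiples of a single one, so the derived algebra is abelian. -/
theorem isSolvable_of_finrank_le_two {L : Type*} [LieRing L] [LieAlgebra ℝ L]
    [FiniteDimensional ℝ L] (h : finrank ℝ L ≤ 2) : LieAlgebra.IsSolvable L := by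
  obtain ⟨x, y, hxy⟩ : ∃ x y : L, ∀ z : L, ∃ a b : ℝ, z = a • x + b • y := by
    let b := finBasis ℝ L
    obtain h | h | h : finrank ℝ L = 0 ∨ finrank ℝ L = 1 ∨ finrank ℝ L = 2 := by omega
    · have := finrank_zero_iff.1 h
      exact ⟨0, 0, fun z => ⟨0, 0, Subsingleton.elim _ _⟩⟩
    · obtain ⟨v, -, hv⟩ := finrank_eq_one_iff'.1 h
      exact ⟨v, 0, fun z => by
        obtain ⟨c, hc⟩ := hv z
        exact ⟨c, 0, by rw [← hc]; simp⟩⟩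
    · let b := finBasisOfFinrankEq ℝ L h
      exact ⟨b 0, b 1, fun z => ⟨b.repr z 0, b.repr z 1, by
        rw [← Fin.sum_univ_two (fun i => b.repr z i • b i), b.sum_repr]⟩⟩
  have hlie (u v : L) : ∃ t : ℝ, ⁅u, v⁆ = t • ⁅x, y⁆ := by
    obtain ⟨a, b, rfl⟩ := hxy u
    obtain ⟨c, d, rfl⟩ := hxy v
    refine ⟨a * d - b * c, ?_⟩
    simp only [lie_add, add_lie, lie_smul, smul_lie, lie_self]
    rw [← lie_skew y x]
    module
  have hmem : ∀ z ∈ LieAlgebra.derivedSeries ℝ L 1, ∃ t : ℝ, z = t • ⁅x, y⁆ := by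
    intro z hz
    rw [LieAlgebra.derivedSeries_def, LieAlgebra.derivedSeriesOfIdeal_succ,
      LieAlgebra.derivedSeriesOfIdeal_zero, ← LieSubmodule.mem_toSubmodule,
      LieSubmodule.lieIdeal_oper_eq_linear_span'] at hz
    refine Submodule.span_induction ?_ ⟨0, by simp⟩ ?_ ?_ hz
    · rintro _ ⟨u, -, v, -, rfl⟩
      exact hlie u v
    · rintro _ _ - - ⟨s, rfl⟩ ⟨t, rfl⟩
      exact ⟨s + t, by module⟩
    · rintro c _ - ⟨t, rfl⟩
      exact ⟨c * t, by module⟩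
  refine LieAlgebra.IsSolvable.mk (R := ℝ) (k := 2) ?_
  rw [LieAlgebra.derivedSeries_def, LieAlgebra.derivedSeriesOfIdeal_succ,
    LieSubmodule.lie_eq_bot_iff]
  intro u hu v hv
  obtain ⟨s, rfl⟩ := hmem u hu
  obtain ⟨t, rfl⟩ := hmem v hv
  simp

variable {S : Type*} [LieRing S] [LieAlgebra ℝ S] [FiniteDimensional ℝ S]
  [LieAlgebra.IsSemisimple ℝ S]

theorem ideal_eq_bot_of_finrank_le_two {I : LieIdeal ℝ S} (h : finrank ℝ I ≤ 2) : I = ⊥ :=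
  have := isSolvable_of_finrank_le_two h
  LieAlgebra.HasTrivialRadical.eq_bot_of_isSolvable I

/-- An ideal of codimension at most two in a semisimple Lie algebra. -/
theorem ideal_eq_top_of_finrank {I : LieIdeal ℝ S} (h : finrank ℝ S ≤ finrank ℝ I + 2) : I = ⊤ := by
  have hc : IsCompl I Iᶜ := isCompl_compl
  have hd : finrank ℝ I + finrank ℝ (Iᶜ : LieIdeal ℝ S) = finrank ℝ S :=
    Submodule.finrank_add_eq_of_isCompl
      (U := I.toSubmodule) (W := (Iᶜ : LieIdeal ℝ S).toSubmodule)
      ((LieSubmodule.isCompl_toSubmodule).2 hc)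
  exact compl_eq_bot.1 (ideal_eq_bot_of_finrank_le_two (by omega))

variable {V : Type*} [AddCommGroup V] [Module ℝ V] [FiniteDimensional ℝ V] [LieRingModule S V]
  [LieModule ℝ S V]

theorem finrank_ker_add (S V : Type*) [LieRing S] [LieAlgebra ℝ S] [FiniteDimensional ℝ S]
    [AddCommGroup V] [Module ℝ V] [FiniteDimensional ℝ V] [LieRingModule S V] [LieModule ℝ S V] :
    finrank ℝ S ≤ finrank ℝ (LieModule.ker ℝ S V) + finrank ℝ V * finrank ℝ V := by
  have h := LinearMap.finrank_range_add_finrank_ker (LieModule.toEnd ℝ S V : S →ₗ[ℝ] End ℝ V)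
  have h2 := Submodule.finrank_le (LinearMap.range (LieModule.toEnd ℝ S V : S →ₗ[ℝ] End ℝ V))
  rw [Module.finrank_linearMap] at h2
  change _ + finrank ℝ (LieModule.ker ℝ S V) = _ at h
  omega

/-- A nontrivial action has a proper kernel, whose codimension is then at least three. This excludes
small `S`, and also dimension five, where the module is a line. -/
theorem finrank_eq_three_of_action (hd : finrank ℝ S + finrank ℝ V = 6)
    (hV : 0 < finrank ℝ V) (hact : ∃ (x : S) (v : V), ⁅x, v⁆ ≠ 0) :
    finrank ℝ S = 3 := by
  have htop : LieModule.ker ℝ S V ≠ ⊤ := fun h => by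
    obtain ⟨x, v, hxv⟩ := hact
    have : x ∈ LieModule.ker ℝ S V := h ▸ LieSubmodule.mem_top x
    exact hxv ((LieModule.mem_ker ℝ S V x).1 this v)
  have hdim := finrank_ker_add S V
  have hS : 3 ≤ finrank ℝ S := by
    by_contra h
    exact htop (ideal_eq_top_of_finrank (by omega))
  obtain h | h | h : finrank ℝ S = 3 ∨ finrank ℝ S = 4 ∨ finrank ℝ S = 5 := by omega
  · exact h
  · exfalso
    have hV2 : finrank ℝ V = 2 := by omega
    -- A faithful action would identify `S` with all endomorphisms of the plane, and the identity
    -- would be a nonzero central element. The kernel thus has dimension at least three, which is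
    -- too large.
    have hker : LieModule.ker ℝ S V ≠ ⊥ := by
      intro hk
      have hinj : Function.Injective (LieModule.toEnd ℝ S V : S →ₗ[ℝ] End ℝ V) := by
        rw [← LinearMap.ker_eq_bot]
        have := congrArg LieSubmodule.toSubmodule hk
        exact this
      have hsurj := (LinearMap.injective_iff_surjective_of_finrank_eq_finrank (by
        rw [Module.finrank_linearMap, hV2, h])).1 hinj
      obtain ⟨x, hx⟩ := hsurj 1
      have hx1 (v : V) : ⁅x, v⁆ = v := LinearMap.congr_fun hx v
      have hc : x ∈ LieAlgebra.center ℝ S := fun y => hinj (LinearMap.ext fun v => by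
        change ⁅⁅y, x⁆, v⁆ = _
        rw [lie_lie, hx1, hx1]
        simp)
      rw [LieAlgebra.center_eq_bot, LieSubmodule.mem_bot] at hc
      have : Nontrivial V := nontrivial_of_finrank_pos (R := ℝ) hV
      obtain ⟨v, hv⟩ := exists_ne (0 : V)
      exact hv (by rw [← hx1 v, hc, zero_lie])
    have h3 : 2 < finrank ℝ (LieModule.ker ℝ S V) := by
      by_contra hlt
      exact hker (ideal_eq_bot_of_finrank_le_two (by omega))
    exact htop (ideal_eq_top_of_finrank (by omega))
  · have hV1 : finrank ℝ V = 1 := by omega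
    rw [hV1] at hdim
    exact (htop (ideal_eq_top_of_finrank (by omega))).elim

end Levi

end LowDimLie

namespace LowDimLie

open Module

/-! ### Classification -/

section Classification

variable {g : Type*} [LieRing g] [LieAlgebra ℝ g]

theorem nonempty_equiv_of_span (h6 : finrank ℝ g = 6) {b : Fin 6 → g}
    (hb : ⊤ ≤ Submodule.span ℝ (Set.range b)) {c : Fin 6 → Fin 6 → Fin 6 → ℤ} {h₁ h₂}
    (h : ∀ i j, i < j → ⁅b i, b j⁆ = ∑ k, (c i j k : ℝ) • b k) :
    Nonempty (g ≃ₗ⁅ℝ⁆ OfLaw (realLaw c h₁ h₂)) := by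
  have hfin : FiniteDimensional ℝ g := FiniteDimensional.of_finrank_pos (by rw [h6]; norm_num)
  let b' : Basis (Fin 6) ℝ g := basisOfTopLeSpanOfCardEqFinrank b hb (by simp [h6])
  have hb' : ⇑b' = b := coe_basisOfTopLeSpanOfCardEqFinrank _ _ _
  exact ⟨equivOfLawOfLT b' _ fun i j hij => by rw [hb']; exact h i j hij⟩

/-- An equivariant skew bracket on the vector representation is a multiple of the cross product: `z`
annihilates `[v₀, v₁]`, which is then a multiple of `v₂`, and `x`, `y` carry this to the other
brackets. -/
theorem so3_brackets {x y z v₀ v₁ v₂ : g} (hli : LinearIndependent ℝ ![v₀, v₁, v₂])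
    (hx₁ : ⁅x, v₁⁆ = v₂) (hx₀ : ⁅x, v₀⁆ = 0) (hx₂ : ⁅x, v₂⁆ = -v₁)
    (hy₀ : ⁅y, v₀⁆ = -v₂) (hy₁ : ⁅y, v₁⁆ = 0) (hy₂ : ⁅y, v₂⁆ = v₀)
    (hz₀ : ⁅z, v₀⁆ = v₁) (hz₁ : ⁅z, v₁⁆ = -v₀) (hz₂ : ⁅z, v₂⁆ = 0)
    {a b c : ℝ} (h : ⁅v₀, v₁⁆ = a • v₀ + b • v₁ + c • v₂) :
    ⁅v₀, v₁⁆ = c • v₂ ∧ ⁅v₀, v₂⁆ = -c • v₁ ∧ ⁅v₁, v₂⁆ = c • v₀ := by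
  have hz : ⁅z, ⁅v₀, v₁⁆⁆ = 0 := by rw [leibniz_lie, hz₀, hz₁, lie_self, lie_neg, lie_self]; simp
  rw [h, lie_add, lie_add, lie_smul, lie_smul, lie_smul, hz₀, hz₁, hz₂] at hz
  obtain ⟨hb, ha, -⟩ := coeff_eq_zero hli (a := -b) (b := a) (c := 0) (by rw [← hz]; module)
  rw [neg_eq_zero] at hb
  subst ha hb
  rw [zero_smul, zero_smul, zero_add, zero_add] at h
  have hx : ⁅x, ⁅v₀, v₁⁆⁆ = ⁅v₀, v₂⁆ := by rw [leibniz_lie, hx₀, hx₁, zero_lie, zero_add]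
  have hy : ⁅y, ⁅v₀, v₁⁆⁆ = ⁅v₁, v₂⁆ := by
    rw [leibniz_lie, hy₀, hy₁, lie_zero, neg_lie, lie_skew, add_zero]
  refine ⟨h, ?_, ?_⟩
  · rw [← hx, h, lie_smul, hx₂, smul_neg, neg_smul]
  · rw [← hy, h, lie_smul, hy₂]

/-- The bracket `[v₀, v₁]` has weight 2, so it is a multiple of `v₀`; lowering by `f` determines the
rest. -/
theorem sl2_brackets_irreducible {x f v₀ v₁ v₂ : g} (hli : LinearIndependent ℝ ![v₀, v₁, v₂])
    (hx₀ : ⁅x, v₀⁆ = (2 : ℝ) • v₀) (hx₁ : ⁅x, v₁⁆ = 0) (hx₂ : ⁅x, v₂⁆ = (-2 : ℝ) • v₂)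
    (hf₀ : ⁅f, v₀⁆ = v₁) (hf₁ : ⁅f, v₁⁆ = (2 : ℝ) • v₂) (hf₂ : ⁅f, v₂⁆ = 0)
    {a b c : ℝ} (h : ⁅v₀, v₁⁆ = a • v₀ + b • v₁ + c • v₂) :
    ⁅v₀, v₁⁆ = a • v₀ ∧ ⁅v₀, v₂⁆ = (a / 2) • v₁ ∧ ⁅v₁, v₂⁆ = a • v₂ := by
  have hx : ⁅x, ⁅v₀, v₁⁆⁆ = (2 : ℝ) • ⁅v₀, v₁⁆ := by
    rw [leibniz_lie, hx₀, hx₁, smul_lie, lie_zero, add_zero]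
  rw [h, lie_add, lie_add, lie_smul, lie_smul, lie_smul, hx₀, hx₁, hx₂, ← sub_eq_zero] at hx
  obtain ⟨-, hb, hc⟩ := coeff_eq_zero hli (a := 0) (b := -2 * b) (c := -4 * c) (by
    rw [← hx]; module)
  obtain rfl : b = 0 := by linarith
  obtain rfl : c = 0 := by linarith
  rw [zero_smul, zero_smul, add_zero, add_zero] at h
  have h02 : ⁅v₀, v₂⁆ = (a / 2) • v₁ := by
    have : ⁅f, ⁅v₀, v₁⁆⁆ = (2 : ℝ) • ⁅v₀, v₂⁆ := by
      rw [leibniz_lie, hf₀, hf₁, lie_self, zero_add, lie_smul]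
    rw [h, lie_smul, hf₀] at this
    rw [div_eq_inv_mul, mul_smul, this]
    module
  refine ⟨h, h02, ?_⟩
  have : ⁅f, ⁅v₀, v₂⁆⁆ = ⁅v₁, v₂⁆ := by rw [leibniz_lie, hf₀, hf₂, lie_zero, add_zero]
  rw [← this, h02, lie_smul, hf₁]
  module

/-- Weights force the shape of the brackets. As `u` acts on the plane by the scalar `a'`, it acts on
`[v, w] = c u` by `2a'`; since `u` commutes with itself, `a' c = 0`. -/
theorem sl2_brackets_reducible {x f v w u : g} (hli : LinearIndependent ℝ ![v, w, u])
    (hxv : ⁅x, v⁆ = v) (hxw : ⁅x, w⁆ = -w) (hxu : ⁅x, u⁆ = 0) (hfv : ⁅f, v⁆ = w)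
    (hfu : ⁅f, u⁆ = 0) {a b c a' b' c' : ℝ}
    (h : ⁅v, w⁆ = a • v + b • w + c • u) (h' : ⁅u, v⁆ = a' • v + b' • w + c' • u) :
    ⁅v, w⁆ = c • u ∧ ⁅u, v⁆ = a' • v ∧ ⁅u, w⁆ = a' • w ∧ a' * c = 0 := by
  have hx : ⁅x, ⁅v, w⁆⁆ = 0 := by rw [leibniz_lie, hxv, hxw, lie_neg, add_neg_cancel]
  rw [h, lie_add, lie_add, lie_smul, lie_smul, lie_smul, hxv, hxw, hxu] at hx
  obtain ⟨ha, hb, -⟩ := coeff_eq_zero hli (a := a) (b := -b) (c := 0) (by rw [← hx]; module)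
  rw [neg_eq_zero] at hb
  subst ha hb
  rw [zero_smul, zero_smul, zero_add, zero_add] at h
  have hx' : ⁅x, ⁅u, v⁆⁆ = ⁅u, v⁆ := by rw [leibniz_lie, hxu, hxv, zero_lie, zero_add]
  rw [h', lie_add, lie_add, lie_smul, lie_smul, lie_smul, hxv, hxw, hxu, ← sub_eq_zero] at hx'
  obtain ⟨-, hb, hc⟩ := coeff_eq_zero hli (a := 0) (b := -2 * b') (c := -c') (by
    rw [← hx']; module)
  obtain rfl : b' = 0 := by linarith
  obtain rfl : c' = 0 := by linarith
  rw [zero_smul, zero_smul, add_zero, add_zero] at h'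
  have huw : ⁅u, w⁆ = a' • w := by
    have : ⁅f, ⁅u, v⁆⁆ = ⁅u, w⁆ := by rw [leibniz_lie, hfu, hfv, zero_lie, zero_add]
    rw [← this, h', lie_smul, hfv]
  refine ⟨h, h', huw, ?_⟩
  have hj := leibniz_lie u v w
  rw [h, h', huw, lie_smul, lie_self, smul_zero, smul_lie, lie_smul, h] at hj
  obtain ⟨-, -, h0⟩ := coeff_eq_zero hli (a := 0) (b := 0) (c := 2 * (a' * c)) (by
    rw [hj]; module)
  linarith

/-- The radical is not generated by its brackets. -/
theorem false_of_brackets [FiniteDimensional ℝ g] {v₀ v₁ v₂ : LieAlgebra.radical ℝ g}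
    (hli : LinearIndependent ℝ ![v₀, v₁, v₂]) (h3 : finrank ℝ (LieAlgebra.radical ℝ g) = 3)
    (h : ∀ v ∈ [v₀, v₁, v₂], ∃ (t : ℝ) (a b : LieAlgebra.radical ℝ g), (v : g) = t • ⁅(a : g), (b : g)⁆) :
    False := by
  have : Nontrivial (LieAlgebra.radical ℝ g) := nontrivial_of_finrank_pos (R := ℝ) (by rw [h3]; norm_num)
  refine (LieAlgebra.derivedSeries_lt_top_of_solvable ℝ (LieAlgebra.radical ℝ g)).ne ?_
  have hv : ∀ v ∈ [v₀, v₁, v₂], v ∈ LieAlgebra.derivedSeries ℝ (LieAlgebra.radical ℝ g) 1 := by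
    intro v hv
    obtain ⟨t, a, b, hab⟩ := h v hv
    have : v = t • ⁅a, b⁆ := Subtype.ext hab
    rw [this, LieAlgebra.derivedSeries_def, LieAlgebra.derivedSeriesOfIdeal_succ,
      LieAlgebra.derivedSeriesOfIdeal_zero]
    exact SMulMemClass.smul_mem _ (LieSubmodule.lie_mem_lie (LieSubmodule.mem_top _) (LieSubmodule.mem_top _))
  rw [eq_top_iff]
  intro x _
  obtain ⟨a, b, c, rfl⟩ := exists_coeff hli h3 x
  refine add_mem (add_mem ?_ ?_) ?_ <;> exact SMulMemClass.smul_mem _ (hv _ (by simp))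

/-- The central line of `b 5` is a direct factor, because the kernel of its coordinate contains all
brackets and is therefore a complementary ideal. -/
theorem not_isIndecomposable_of_central (b : Basis (Fin 6) ℝ g)
    (h : ∀ i j, b.coord 5 ⁅b i, b j⁆ = 0) (h5 : ∀ i, ⁅b i, b 5⁆ = 0) : ¬ IsIndecomposable g := by
  rintro ⟨-, hind⟩
  have hlie (x y : g) : b.coord 5 ⁅x, y⁆ = 0 := by
    rw [← b.sum_repr x, ← b.sum_repr y, sum_lie, map_sum]
    refine Finset.sum_eq_zero fun i _ => ?_
    rw [lie_sum, map_sum]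
    refine Finset.sum_eq_zero fun j _ => ?_
    rw [lie_smul, smul_lie, map_smul, map_smul, h, smul_zero, smul_zero]
  have hcen (x : g) : ⁅x, b 5⁆ = 0 := by
    rw [← b.sum_repr x, sum_lie]
    refine Finset.sum_eq_zero fun i _ => ?_
    rw [smul_lie, h5, smul_zero]
  have h55 : b.coord 5 (b 5) = 1 := by simp
  have h50 : b.coord 5 (b 0) = 0 := by simp
  let I : LieIdeal ℝ g := { Submodule.span ℝ {b 5} with
    lie_mem := fun {x m} hm => by
      obtain ⟨t, rfl⟩ := Submodule.mem_span_singleton.1 hm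
      change ⁅x, t • b 5⁆ ∈ Submodule.span ℝ {b 5}
      rw [lie_smul, hcen, smul_zero]
      exact zero_mem _ }
  let J : LieIdeal ℝ g := { LinearMap.ker (b.coord 5) with
    lie_mem := fun {x m} _ => LinearMap.mem_ker.2 (hlie x m) }
  have hIJ : IsCompl I J := by
    rw [← LieSubmodule.isCompl_toSubmodule]
    constructor
    · rw [Submodule.disjoint_def]
      intro x hI hJ
      obtain ⟨t, rfl⟩ := Submodule.mem_span_singleton.1 hI
      have : b.coord 5 (t • b 5) = 0 := hJ
      rw [map_smul, h55, smul_eq_mul, mul_one] at this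
      rw [this, zero_smul]
    · rw [codisjoint_iff, eq_top_iff]
      intro x _
      refine Submodule.mem_sup.2 ⟨b.coord 5 x • b 5,
        Submodule.mem_span_singleton.2 ⟨_, rfl⟩, x - b.coord 5 x • b 5, ?_, add_sub_cancel _ _⟩
      change b.coord 5 (x - b.coord 5 x • b 5) = 0
      rw [map_sub, map_smul, h55, smul_eq_mul, mul_one, sub_self]
  rcases hind I J hIJ with h | h
  · have : b 5 ∈ I := Submodule.mem_span_singleton_self (b 5)
    rw [h, LieSubmodule.mem_bot] at this
    exact b.ne_zero 5 this
  · have : b 0 ∈ J := h50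
    rw [h, LieSubmodule.mem_bot] at this
    exact b.ne_zero 0 this

theorem top_le_span_levi [FiniteDimensional ℝ g] {s : LieSubalgebra ℝ g} {r : LieIdeal ℝ g}
    (hc : IsCompl s.toSubmodule r.toSubmodule) {x y z : s} (hs : Submodule.span ℝ {x, y, z} = ⊤)
    {u v w : r} (hli : LinearIndependent ℝ ![u, v, w]) (h3 : finrank ℝ r = 3) :
    ⊤ ≤ Submodule.span ℝ (Set.range ![(x : g), y, z, u, v, w]) := by
  have hmem (i : Fin 6) : ![(x : g), y, z, u, v, w] i ∈
      Submodule.span ℝ (Set.range ![(x : g), y, z, u, v, w]) := Submodule.subset_span ⟨i, rfl⟩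
  rw [← hc.sup_eq_top]
  refine sup_le (fun p hp => ?_) (fun p hp => ?_)
  · have : (⟨p, hp⟩ : s) ∈ Submodule.span ℝ {x, y, z} := hs ▸ Submodule.mem_top
    obtain ⟨a, b, c, h⟩ := Submodule.mem_span_triple.1 this
    have h' : p = a • (x : g) + b • (y : g) + c • (z : g) := congrArg Subtype.val h.symm
    rw [h']
    exact add_mem (add_mem (Submodule.smul_mem _ _ (hmem 0)) (Submodule.smul_mem _ _ (hmem 1)))
      (Submodule.smul_mem _ _ (hmem 2))
  · obtain ⟨a, b, c, h⟩ := exists_coeff hli h3 (⟨p, hp⟩ : r)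
    have h' : p = a • (u : g) + b • (v : g) + c • (w : g) := congrArg Subtype.val h
    rw [h']
    exact add_mem (add_mem (Submodule.smul_mem _ _ (hmem 3)) (Submodule.smul_mem _ _ (hmem 4)))
      (Submodule.smul_mem _ _ (hmem 5))

theorem linearIndependent_coe {r : LieIdeal ℝ g} {u v w : r}
    (hli : LinearIndependent ℝ ![u, v, w]) :
    LinearIndependent ℝ ![(u : g), (v : g), (w : g)] := by
  have h := hli.map' r.toSubmodule.subtype (Submodule.ker_subtype _)
  have e : (r.toSubmodule.subtype ∘ ![u, v, w] : Fin 3 → g) = ![(u : g), (v : g), (w : g)] := by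
    ext i; fin_cases i <;> rfl
  exact e ▸ h

theorem exists_lie_coeff [FiniteDimensional ℝ g] {r : LieIdeal ℝ g} {u v w : r}
    (hli : LinearIndependent ℝ ![u, v, w]) (h3 : finrank ℝ r = 3) (p q : r) :
    ∃ a b c : ℝ, ⁅(p : g), (q : g)⁆ = a • (u : g) + b • (v : g) + c • (w : g) := by
  obtain ⟨a, b, c, h⟩ := exists_coeff hli h3 ⁅p, q⁆
  exact ⟨a, b, c, congrArg Subtype.val h⟩

theorem toEnd_ne_zero {s : LieSubalgebra ℝ g} {r : LieIdeal ℝ g} {x y z : s}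
    (hs : Submodule.span ℝ {x, y, z} = ⊤) (hact : ∃ (p : s) (v : r), ⁅(p : g), (v : g)⁆ ≠ 0) :
    ¬ (LieModule.toEnd ℝ g r (x : g) = 0 ∧ LieModule.toEnd ℝ g r (y : g) = 0 ∧
      LieModule.toEnd ℝ g r (z : g) = 0) := by
  rintro ⟨hx, hy, hz⟩
  obtain ⟨p, v, hv⟩ := hact
  have : p ∈ Submodule.span ℝ {x, y, z} := hs ▸ Submodule.mem_top
  obtain ⟨a, b, c, rfl⟩ := Submodule.mem_span_triple.1 this
  have ex : ⁅(x : g), (v : g)⁆ = 0 := congrArg Subtype.val (LinearMap.congr_fun hx v)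
  have ey : ⁅(y : g), (v : g)⁆ = 0 := congrArg Subtype.val (LinearMap.congr_fun hy v)
  have ez : ⁅(z : g), (v : g)⁆ = 0 := congrArg Subtype.val (LinearMap.congr_fun hz v)
  refine hv ?_
  change ⁅a • (x : g) + b • (y : g) + c • (z : g), (v : g)⁆ = 0
  simp [ex, ey, ez]

end Classification

end LowDimLie

/-! ### From the Levi factor and the radical to the four laws -/

namespace LowDimLie

open Module

section Classification

variable {g : Type*} [LieRing g] [LieAlgebra ℝ g] [FiniteDimensional ℝ g]

theorem nonempty_equiv_of_so3 (h6 : finrank ℝ g = 6) {s : LieSubalgebra ℝ g}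
    (hc : IsCompl s.toSubmodule (LieAlgebra.radical ℝ g).toSubmodule)
    (h3 : finrank ℝ (LieAlgebra.radical ℝ g) = 3)
    (hact : ∃ (p : s) (v : LieAlgebra.radical ℝ g), ⁅(p : g), (v : g)⁆ ≠ 0)
    {x y z : s} (ht : IsSo3Triple x y z) (hs : Submodule.span ℝ {x, y, z} = ⊤) :
    Nonempty (g ≃ₗ⁅ℝ⁆ L61) := by
  have hxy : ⁅(x : g), (y : g)⁆ = z := congrArg Subtype.val ht.lie_x_y
  have hyz : ⁅(y : g), (z : g)⁆ = x := congrArg Subtype.val ht.lie_y_z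
  have hzx : ⁅(z : g), (x : g)⁆ = y := congrArg Subtype.val ht.lie_z_x
  have hxz : ⁅(x : g), (z : g)⁆ = -y := by rw [← lie_skew, hzx]
  obtain ⟨v₀, v₁, v₂, hli, hx₀, hx₁, hx₂, hy₀, hy₁, hy₂, hz₀, hz₁, hz₂⟩ :=
    exists_so3_basis h3 (A := LieModule.toEnd ℝ g _ (x : g)) (B := LieModule.toEnd ℝ g _ (y : g))
      (C := LieModule.toEnd ℝ g _ (z : g))
      (fun v => by simp only [LieModule.toEnd_apply_apply]; rw [leibniz_lie, hxy, add_comm])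
      (fun v => by simp only [LieModule.toEnd_apply_apply]; rw [leibniz_lie, hyz, add_comm])
      (fun v => by simp only [LieModule.toEnd_apply_apply]; rw [leibniz_lie, hzx, add_comm])
      (toEnd_ne_zero hs hact)
  replace hx₀ : ⁅(x : g), (v₀ : g)⁆ = 0 := congrArg Subtype.val hx₀
  replace hx₁ : ⁅(x : g), (v₁ : g)⁆ = v₂ := congrArg Subtype.val hx₁
  replace hx₂ : ⁅(x : g), (v₂ : g)⁆ = -v₁ := congrArg Subtype.val hx₂
  replace hy₀ : ⁅(y : g), (v₀ : g)⁆ = -v₂ := congrArg Subtype.val hy₀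
  replace hy₁ : ⁅(y : g), (v₁ : g)⁆ = 0 := congrArg Subtype.val hy₁
  replace hy₂ : ⁅(y : g), (v₂ : g)⁆ = v₀ := congrArg Subtype.val hy₂
  replace hz₀ : ⁅(z : g), (v₀ : g)⁆ = v₁ := congrArg Subtype.val hz₀
  replace hz₁ : ⁅(z : g), (v₁ : g)⁆ = -v₀ := congrArg Subtype.val hz₁
  replace hz₂ : ⁅(z : g), (v₂ : g)⁆ = 0 := congrArg Subtype.val hz₂
  obtain ⟨a, b, c, h⟩ := exists_lie_coeff hli h3 v₀ v₁
  obtain ⟨h01, h02, h12⟩ := so3_brackets (linearIndependent_coe hli) hx₁ hx₀ hx₂ hy₀ hy₁ hy₂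
    hz₀ hz₁ hz₂ h
  -- A nonzero multiple of the cross product would make the radical perfect, although it is solvable
  -- and nonzero.
  have hc0 : c = 0 := by
    by_contra hc0
    refine false_of_brackets hli h3 fun v hv => ?_
    simp only [List.mem_cons, List.not_mem_nil, or_false] at hv
    rcases hv with hv | hv | hv <;> rw [hv]
    · exact ⟨c⁻¹, v₁, v₂, by rw [h12, inv_smul_smul₀ hc0]⟩
    · exact ⟨(-c)⁻¹, v₀, v₂, by rw [h02, inv_smul_smul₀ (neg_ne_zero.2 hc0)]⟩
    · exact ⟨c⁻¹, v₀, v₁, by rw [h01, inv_smul_smul₀ hc0]⟩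
  rw [hc0] at h01 h02 h12
  refine nonempty_equiv_of_span h6 (top_le_span_levi hc hs hli h3) fun i j hij => ?_
  fin_cases i <;> fin_cases j <;> first
    | exact absurd hij (by decide)
    | simp [Fin.sum_univ_six, c61, ofTable, hxy, hyz, hxz, hx₀, hx₁, hx₂, hy₀, hy₁, hy₂, hz₀, hz₁, hz₂,
        h01, h02, h12]

/-- The adjoint module forces an abelian radical and gives `L64`. In the reducible case, with `[v,
w] = c u` and `[u, v] = a v`, the Heisenberg radical (`c ≠ 0`) gives `L62`, the dilation (`a ≠ 0`)
gives `L63`, and `a = c = 0` splits off a central line. -/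
theorem nonempty_equiv_of_sl2 (h6 : finrank ℝ g = 6) (hind : IsIndecomposable g)
    {s : LieSubalgebra ℝ g} (hc : IsCompl s.toSubmodule (LieAlgebra.radical ℝ g).toSubmodule)
    (h3 : finrank ℝ (LieAlgebra.radical ℝ g) = 3)
    (hact : ∃ (p : s) (v : LieAlgebra.radical ℝ g), ⁅(p : g), (v : g)⁆ ≠ 0)
    {x e f : s} (ht : IsSl2Triple x e f) (hs : Submodule.span ℝ {x, e, f} = ⊤) :
    Nonempty (g ≃ₗ⁅ℝ⁆ L62) ∨ Nonempty (g ≃ₗ⁅ℝ⁆ L63) ∨ Nonempty (g ≃ₗ⁅ℝ⁆ L64) := by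
  have hxe : ⁅(x : g), (e : g)⁆ = (2 : ℝ) • (e : g) := congrArg Subtype.val (ht.lie_h_e_smul ℝ)
  have hxf : ⁅(x : g), (f : g)⁆ = -((2 : ℝ) • (f : g)) := congrArg Subtype.val (ht.lie_lie_smul_f ℝ)
  have hef : ⁅(e : g), (f : g)⁆ = x := congrArg Subtype.val ht.lie_e_f
  obtain ⟨v₀, v₁, v₂, hli, hx₀, hx₁, hx₂, he₀, he₁, he₂, hf₀, hf₁, hf₂⟩ |
    ⟨v, w, u, hli, hxv, hxw, hxu, hev, hew, heu, hfv, hfw, hfu⟩ :=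
    exists_sl2_basis h3 (H := LieModule.toEnd ℝ g _ (x : g)) (E := LieModule.toEnd ℝ g _ (e : g))
      (F := LieModule.toEnd ℝ g _ (f : g))
      (fun v => by simp only [LieModule.toEnd_apply_apply]; rw [leibniz_lie, hxe, smul_lie, add_comm])
      (fun v => by
        simp only [LieModule.toEnd_apply_apply]; rw [leibniz_lie, hxf, neg_lie, smul_lie]; abel)
      (fun v => by simp only [LieModule.toEnd_apply_apply]; rw [leibniz_lie, hef, add_comm])
      (toEnd_ne_zero hs hact)
  · replace hx₀ : ⁅(x : g), (v₀ : g)⁆ = (2 : ℝ) • (v₀ : g) := congrArg Subtype.val hx₀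
    replace hx₁ : ⁅(x : g), (v₁ : g)⁆ = 0 := congrArg Subtype.val hx₁
    replace hx₂ : ⁅(x : g), (v₂ : g)⁆ = (-2 : ℝ) • (v₂ : g) := congrArg Subtype.val hx₂
    replace he₀ : ⁅(e : g), (v₀ : g)⁆ = 0 := congrArg Subtype.val he₀
    replace he₁ : ⁅(e : g), (v₁ : g)⁆ = (2 : ℝ) • (v₀ : g) := congrArg Subtype.val he₁
    replace he₂ : ⁅(e : g), (v₂ : g)⁆ = v₁ := congrArg Subtype.val he₂
    replace hf₀ : ⁅(f : g), (v₀ : g)⁆ = v₁ := congrArg Subtype.val hf₀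
    replace hf₁ : ⁅(f : g), (v₁ : g)⁆ = (2 : ℝ) • (v₂ : g) := congrArg Subtype.val hf₁
    replace hf₂ : ⁅(f : g), (v₂ : g)⁆ = 0 := congrArg Subtype.val hf₂
    obtain ⟨a, b, c, h⟩ := exists_lie_coeff hli h3 v₀ v₁
    obtain ⟨h01, h02, h12⟩ := sl2_brackets_irreducible (linearIndependent_coe hli) hx₀ hx₁ hx₂
      hf₀ hf₁ hf₂ h
    have ha0 : a = 0 := by
      by_contra ha0
      refine false_of_brackets hli h3 fun v hv => ?_
      simp only [List.mem_cons, List.not_mem_nil, or_false] at hv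
      rcases hv with hv | hv | hv <;> rw [hv]
      · exact ⟨a⁻¹, v₀, v₁, by rw [h01, inv_smul_smul₀ ha0]⟩
      · exact ⟨(a / 2)⁻¹, v₀, v₂, by rw [h02, inv_smul_smul₀ (div_ne_zero ha0 two_ne_zero)]⟩
      · exact ⟨a⁻¹, v₁, v₂, by rw [h12, inv_smul_smul₀ ha0]⟩
    rw [ha0] at h01 h02 h12
    refine Or.inr (Or.inr ?_)
    refine nonempty_equiv_of_span h6 (top_le_span_levi hc hs hli h3) fun i j hij => ?_
    fin_cases i <;> fin_cases j <;> first
      | exact absurd hij (by decide)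
      | simp [Fin.sum_univ_six, c64, ofTable, hxe, hxf, hef, hx₀, hx₁, hx₂, he₀, he₁, he₂, hf₀, hf₁,
          hf₂, h01, h02, h12]
  · replace hxv : ⁅(x : g), (v : g)⁆ = v := congrArg Subtype.val hxv
    replace hxw : ⁅(x : g), (w : g)⁆ = -w := congrArg Subtype.val hxw
    replace hxu : ⁅(x : g), (u : g)⁆ = 0 := congrArg Subtype.val hxu
    replace hev : ⁅(e : g), (v : g)⁆ = 0 := congrArg Subtype.val hev
    replace hew : ⁅(e : g), (w : g)⁆ = v := congrArg Subtype.val hew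
    replace heu : ⁅(e : g), (u : g)⁆ = 0 := congrArg Subtype.val heu
    replace hfv : ⁅(f : g), (v : g)⁆ = w := congrArg Subtype.val hfv
    replace hfw : ⁅(f : g), (w : g)⁆ = 0 := congrArg Subtype.val hfw
    replace hfu : ⁅(f : g), (u : g)⁆ = 0 := congrArg Subtype.val hfu
    obtain ⟨_, _, c, h⟩ := exists_lie_coeff hli h3 v w
    obtain ⟨a, _, _, h'⟩ := exists_lie_coeff hli h3 u v
    obtain ⟨hvw, huv, huw, hac⟩ := sl2_brackets_reducible (linearIndependent_coe hli) hxv hxw hxu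
      hfv hfu h h'
    have hvu : ⁅(v : g), (u : g)⁆ = -(a • (v : g)) := by rw [← lie_skew, huv]
    have hwu : ⁅(w : g), (u : g)⁆ = -(a • (w : g)) := by rw [← lie_skew, huw]
    have hscale {t : ℝ} (ht : t ≠ 0) : LinearIndependent ℝ ![v, w, t • u] := by
      refine Fintype.linearIndependent_iff.2 fun k hk => ?_
      obtain ⟨h1, h2, h3⟩ := coeff_eq_zero hli (a := k 0) (b := k 1) (c := k 2 * t) (by
        rw [← hk, Fin.sum_univ_three]
        simp only [Matrix.cons_val]
        module)
      intro i; fin_cases i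
      exacts [h1, h2, (mul_eq_zero.1 h3).resolve_right ht]
    rcases eq_or_ne c 0 with hc0 | hc0
    · rcases eq_or_ne a 0 with ha0 | ha0
      · exfalso
        have hspan := top_le_span_levi hc hs hli h3
        let b' : Basis (Fin 6) ℝ g := basisOfTopLeSpanOfCardEqFinrank _ hspan (by simp [h6])
        have hb' : ⇑b' = ![(x : g), e, f, v, w, u] := coe_basisOfTopLeSpanOfCardEqFinrank _ _ _
        have hφ (i : Fin 6) : b'.coord 5 (![(x : g), e, f, v, w, u] i) = if i = 5 then 1 else 0 := by
          rw [← hb', Basis.coord_apply, Basis.repr_self, Finsupp.single_apply]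
        have hφx : b'.coord 5 (x : g) = 0 := hφ 0
        have hφe : b'.coord 5 (e : g) = 0 := hφ 1
        have hφf : b'.coord 5 (f : g) = 0 := hφ 2
        have hφv : b'.coord 5 (v : g) = 0 := hφ 3
        have hφw : b'.coord 5 (w : g) = 0 := hφ 4
        have hlt (i j : Fin 6) (hij : i < j) : b'.coord 5 ⁅b' i, b' j⁆ = 0 := by
          rw [hb']
          generalize b'.coord 5 = φ at hφx hφe hφf hφv hφw
          fin_cases i <;> fin_cases j <;> first
            | exact absurd hij (by decide)
            | simp [hxe, hxf, hef, hxv, hxw, hxu, hev, hew, heu, hfv, hfw, hfu, hvw, hvu, hwu,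
                hc0, ha0, hφx, hφe, hφf, hφv, hφw]
        refine not_isIndecomposable_of_central b' (fun i j => ?_) (fun i => ?_) hind
        · rcases lt_trichotomy i j with hij | rfl | hij
          · exact hlt i j hij
          · rw [lie_self, map_zero]
          · rw [← lie_skew, map_neg, hlt j i hij, neg_zero]
        · rw [hb']
          fin_cases i <;> simp [hxu, heu, hfu, hvu, hwu, ha0]
      · refine Or.inr (Or.inl ?_)
        refine nonempty_equiv_of_span h6
          -- Since `[v, u] = -a v`, the last basis vector is `-a⁻¹ u`, so that `[X₄, X₆] = X₄`.
          (top_le_span_levi hc hs (hscale (neg_ne_zero.2 (inv_ne_zero ha0))) h3) fun i j hij => ?_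
        fin_cases i <;> fin_cases j <;> first
          | exact absurd hij (by decide)
          | simp [Fin.sum_univ_six, c63, ofTable, hxe, hxf, hef, hxv, hxw, hxu, hev, hew, heu,
              hfv, hfw, hfu, hvw, hvu, hwu, hc0, ha0, smul_smul]
    · have ha0 : a = 0 := (mul_eq_zero.1 hac).resolve_right hc0
      left
      refine nonempty_equiv_of_span h6 (top_le_span_levi hc hs (hscale hc0) h3) fun i j hij => ?_
      fin_cases i <;> fin_cases j <;> first
        | exact absurd hij (by decide)
        | simp [Fin.sum_univ_six, c62, ofTable, hxe, hxf, hef, hxv, hxw, hxu, hev, hew, heu,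
            hfv, hfw, hfu, hvw, hvu, hwu, ha0]

theorem classification (h6 : finrank ℝ g = 6) (hind : IsIndecomposable g)
    (hlevi : HasNontrivialLeviDecomposition g) :
    Nonempty (g ≃ₗ⁅ℝ⁆ L61) ∨ Nonempty (g ≃ₗ⁅ℝ⁆ L62) ∨
      Nonempty (g ≃ₗ⁅ℝ⁆ L63) ∨ Nonempty (g ≃ₗ⁅ℝ⁆ L64) := by
  obtain ⟨s, hs, -, hr0, hc, x, hx, y, hy, hxy⟩ := hlevi
  have hact : ∃ (p : s) (v : LieAlgebra.radical ℝ g), ⁅(p : g), (v : g)⁆ ≠ 0 :=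
    ⟨⟨x, hx⟩, ⟨y, hy⟩, hxy⟩
  have hd : finrank ℝ s + finrank ℝ (LieAlgebra.radical ℝ g) = 6 := by
    rw [← h6]
    exact Submodule.finrank_add_eq_of_isCompl hc
  have hr : 0 < finrank ℝ (LieAlgebra.radical ℝ g) := by
    have : Nontrivial (LieAlgebra.radical ℝ g) :=
      LieSubmodule.nontrivial_iff_ne_bot ℝ g g |>.2 hr0
    exact finrank_pos
  have hs3 : finrank ℝ s = 3 := finrank_eq_three_of_action hd hr
    ⟨⟨x, hx⟩, ⟨y, hy⟩, fun h => hxy (congrArg Subtype.val h)⟩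
  have h3 : finrank ℝ (LieAlgebra.radical ℝ g) = 3 := by omega
  rcases exists_triple hs3 with ⟨x, y, z, ht, hspan⟩ | ⟨h, e, f, ht, hspan⟩
  · exact Or.inl (nonempty_equiv_of_so3 h6 hc h3 hact ht hspan)
  · exact Or.inr (nonempty_equiv_of_sl2 h6 hind hc h3 hact ht hspan)

end Classification

/-! ### Stability against contraction, and the final assembly -/

theorem radical_eq_bot_of_equiv {s g : Type*} [LieRing s] [LieAlgebra ℝ s]
    [FiniteDimensional ℝ s] [LieAlgebra.IsSemisimple ℝ s] [LieRing g] [LieAlgebra ℝ g]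
    (e : s ≃ₗ⁅ℝ⁆ g) : LieAlgebra.radical ℝ g = ⊥ := by
  have hf : FiniteDimensional ℝ g := e.toLinearEquiv.finiteDimensional
  have hk : LieAlgebra.IsKilling ℝ g := LieAlgebra.isKilling_of_equiv e
  exact LieAlgebra.HasTrivialRadical.radical_eq_bot

/-- A stable contraction is isomorphic to the algebra it comes from, so it would inherit the trivial
radical of a semisimple one. -/
theorem not_isStable_and_isContractionOfSemisimple {g : Type*} [LieRing g] [LieAlgebra ℝ g]
    [FiniteDimensional ℝ g] (hr : LieAlgebra.radical ℝ g ≠ ⊥) :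
    ¬ (IsStable g ∧ IsContractionOfSemisimple g) := by
  rintro ⟨hst, s, _, _, hf, hss, hcon⟩
  obtain ⟨e⟩ := hst.nonempty_lieEquiv_of_isContraction hcon
  exact hr (radical_eq_bot_of_equiv e)

end LowDimLie

open LowDimLie in
theorem proposition3 :
    (∀ (g : Type*) [LieRing g] [LieAlgebra ℝ g], Module.finrank ℝ g = 6 →
      IsIndecomposable g → HasNontrivialLeviDecomposition g →
        (Nonempty (g ≃ₗ⁅ℝ⁆ L61) ∨ Nonempty (g ≃ₗ⁅ℝ⁆ L62) ∨
          Nonempty (g ≃ₗ⁅ℝ⁆ L63) ∨ Nonempty (g ≃ₗ⁅ℝ⁆ L64)) ∧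
        (IsStable g ∨ IsContractionOfSemisimple g) ∧
        ¬ (IsStable g ∧ IsContractionOfSemisimple g)) ∧
    (Nonempty (L61 ≃ₗ⁅ℝ⁆ Iso3) ∧ IsContractionOfSemisimple L61 ∧
      IsContraction So4 L61 ∧ IsContraction So31 L61) ∧
    (Nonempty (L64 ≃ₗ⁅ℝ⁆ Isl2) ∧ IsContractionOfSemisimple L64 ∧
      IsContraction So22 L64 ∧ IsContraction So31 L64) ∧
    (Subsingleton (H2 L62) ∧ IsStable L62) ∧
    (Subsingleton (H2 L63) ∧ IsStable L63) := by
  have h62 : IsStable L62 := isStable_of_subsingleton_H2 subsingleton_H2_L62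
  have h63 : IsStable L63 := isStable_of_subsingleton_H2 subsingleton_H2_L63
  refine ⟨fun g _ _ h6 hind hlevi => ?_,
    ⟨nonempty_L61_equiv_Iso3, isContractionOfSemisimple_of_So31 isContraction_So31_L61,
      isContraction_So4_L61, isContraction_So31_L61⟩,
    ⟨nonempty_L64_equiv_Isl2, isContractionOfSemisimple_of_So31 isContraction_So31_L64,
      isContraction_So22_L64, isContraction_So31_L64⟩,
    ⟨subsingleton_H2_L62, h62⟩, ⟨subsingleton_H2_L63, h63⟩⟩
  have hfin : FiniteDimensional ℝ g := FiniteDimensional.of_finrank_pos (by rw [h6]; norm_num)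
  have hcl := classification h6 hind hlevi
  refine ⟨hcl, ?_, ?_⟩
  · rcases hcl with ⟨⟨e⟩⟩ | ⟨⟨e⟩⟩ | ⟨⟨e⟩⟩ | ⟨⟨e⟩⟩
    · exact Or.inr (isContractionOfSemisimple_of_So31 (isContraction_So31_L61.congr_right e))
    · exact Or.inl (h62.of_lieEquiv e.symm)
    · exact Or.inl (h63.of_lieEquiv e.symm)
    · exact Or.inr (isContractionOfSemisimple_of_So31 (isContraction_So31_L64.congr_right e))
  · obtain ⟨_, -, -, hr, -⟩ := hlevi
    exact not_isStable_and_isContractionOfSemisimple hr
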